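/- For a nonempty finite set (cluster) $P\subset\mathbb R^2$ let $d_{\mathrm f}(x,P)=\max_{p\in P}d(x,p)$, let $\mathrm{freg}_P(p)=\{x : d(x,p)>d(x,p')\ \text{for all } p'\in P\setminus\{p\}\}$ be the farthest Voronoi region of $p\in P$, let $\mathcal T(P)=\mathbb R^2\setminus\bigcup_{p\in P}\mathrm{freg}_P(p)$ if $|P|>1$ and $\mathcal T(P)=P$ if $|P|=1$, and let $\mathrm{FVD}(P)$ be the farthest Voronoi diagram of $P$. Its vertices are the points $w$ for which at least three points of $P$ are at distance $d_{\mathrm f}(w,P)$ from $w$ (the owners of the regions incident to $w$); $n_p$ denotes their number. Its edges are the sets $\{x : d(x,a)=d(x,b)=d_{\mathrm f}(x,P)\}$ with $a\ne b$ in $P$; two distinct vertices are adjacent if they lie on a common edge. Assume that no four points of $P$ lie on a common circle, so that every vertex has exactly three owners. A separator decomposition $\mathrm{SD}(P)$ is a rooted tree whose nodes are the vertices of $\mathrm{FVD}(P)$: its root is a centroid $w$, that is, a vertex whose removal leaves only connected components with at most $n_p/2$ vertices, and the subtrees of the root are, recursively, separator decompositions of the (at most three) components, the component reached from $w$ along the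 edge between the regions of two owners of $w$ being stored in the slot of the third owner; $\mathrm{SD}(P)$ is empty if $n_p=0$. $\mathrm{SD}(P)$ is stored together with the points of $P$ that have nonempty regions and, for each vertex, its coordinates and three owners. On a real RAM (unit-cost addition, subtraction, multiplication, division and comparison of reals; addition, subtraction and comparison of integers; indirect addressing; no rounding and no roots) there are three programs and a constant $K$, all independent of the input, such that for every such $P$ the following hold. 1. (Construction) Given $\mathrm{FVD}(P)$, with its vertices, regions and vertex adjacencies, the first program builds a separator decomposition $\mathrm{SD}(P)$ in at most $K(n_p\log n_p+1)$ steps. 2. (Point location) Given any separator decomposition $\mathrm{SD}(P)$ and a point $q\in\mathbb R^2$, the second program finds in at most $K(\log n_p+1)$ steps a point $p\in P$ with $q\in\overline{\mathrm{freg}}_P(p)$. 3. (Segment query) Given any separator decomposition $\mathrm{SD}(P)$ and a segment $uv\subset\mathcal T(C)$ of a cluster $C$, together with the chord $c_1c_2$ of $C$ that it bisects ($c_1\ne c_2$ in $C$, and $d(x,c_1)=d(x,c_2)=d_{\mathrm f}(x,C)$ for all $x\in uv$), such that $d_{\mathrm f}(u,C)<d_{\mathrm f}(u,P)$ and $d_{\mathrm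 f}(v,C)>d_{\mathrm f}(v,P)$, the third program finds in at most $K(\log n_p+1)$ steps the unique point $x\in uv$ with $d_{\mathrm f}(x,C)=d_{\mathrm f}(x,P)$. Both queries leave the stored $\mathrm{SD}(P)$ intact. (Here $\log 0$ is read as $0$.) -/

import Mathlib

/-! ## The machine model: a real RAM

The memory has natural-number and real registers, and natural-number and real arrays.  Registers
and arrays are named by literals in the program text, so a program touches finitely many of them;
array cells are addressed indirectly.  The arithmetic is addition and (truncated) subtraction on
natural numbers and the four field operations on reals; both sorts can be compared.  There is no
conversion between the two sorts (in particular no rounding), no root, and the only real constants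
are integers.  Every operation, memory access, test and instruction costs one step. -/

namespace RealRAM

/-- A memory state: registers `nv`, `rv` and arrays `na`, `ra` (first argument: the name of the
array, second argument: the index of the cell). -/
structure State where
  nv : ℕ → ℕ
  rv : ℕ → ℝ
  na : ℕ → ℕ → ℕ
  ra : ℕ → ℕ → ℝ

/-- Natural-number expressions. -/
inductive NExp where
  | lit (k : ℕ)
  | var (x : ℕ)
  | get (a : ℕ) (i : NExp)
  | add (e f : NExp)
  | sub (e f : NExp)

/-- Real expressions. -/
inductive RExp where
  | lit (k : ℤ)
  | var (x : ℕ)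
  | get (a : ℕ) (i : NExp)
  | add (e f : RExp)
  | sub (e f : RExp)
  | mul (e f : RExp)
  | div (e f : RExp)

/-- Tests. -/
inductive BExp where
  | nlt (e f : NExp)
  | neq (e f : NExp)
  | rlt (e f : RExp)
  | not (b : BExp)
  | and (b c : BExp)

/-- Programs. -/
inductive Cmd where
  | skip
  | nset (x : ℕ) (e : NExp)
  | rset (x : ℕ) (e : RExp)
  | nput (a : ℕ) (i : NExp) (e : NExp)
  | rput (a : ℕ) (i : NExp) (e : RExp)
  | seq (c d : Cmd)
  | ite (b : BExp) (c d : Cmd)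
  | loop (b : BExp) (c : Cmd)

def NExp.eval (s : State) : NExp → ℕ
  | .lit k => k
  | .var x => s.nv x
  | .get a i => s.na a (i.eval s)
  | .add e f => e.eval s + f.eval s
  | .sub e f => e.eval s - f.eval s

def NExp.cost : NExp → ℕ
  | .lit _ => 1
  | .var _ => 1
  | .get _ i => i.cost + 1
  | .add e f => e.cost + f.cost + 1
  | .sub e f => e.cost + f.cost + 1

noncomputable def RExp.eval (s : State) : RExp → ℝ
  | .lit k => (k : ℝ)
  | .var x => s.rv x
  | .get a i => s.ra a (i.eval s)
  | .add e f => e.eval s + f.eval s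
  | .sub e f => e.eval s - f.eval s
  | .mul e f => e.eval s * f.eval s
  | .div e f => e.eval s / f.eval s

def RExp.cost : RExp → ℕ
  | .lit _ => 1
  | .var _ => 1
  | .get _ i => i.cost + 1
  | .add e f => e.cost + f.cost + 1
  | .sub e f => e.cost + f.cost + 1
  | .mul e f => e.cost + f.cost + 1
  | .div e f => e.cost + f.cost + 1

def BExp.eval (s : State) : BExp → Prop
  | .nlt e f => e.eval s < f.eval s
  | .neq e f => e.eval s = f.eval s
  | .rlt e f => e.eval s < f.eval s
  | .not b => ¬ b.eval s
  | .and b c => b.eval s ∧ c.eval s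

def BExp.cost : BExp → ℕ
  | .nlt e f => e.cost + f.cost + 1
  | .neq e f => e.cost + f.cost + 1
  | .rlt e f => e.cost + f.cost + 1
  | .not b => b.cost + 1
  | .and b c => b.cost + c.cost + 1

/-- `Run c s t s'`: started in state `s`, the program `c` halts in state `s'` after exactly
`t` steps. -/
inductive Run : Cmd → State → ℕ → State → Prop
  | skip (s : State) : Run .skip s 1 s
  | nset (s : State) (x : ℕ) (e : NExp) :
      Run (.nset x e) s (e.cost + 1) { s with nv := Function.update s.nv x (e.eval s) }
  | rset (s : State) (x : ℕ) (e : RExp) :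
      Run (.rset x e) s (e.cost + 1) { s with rv := Function.update s.rv x (e.eval s) }
  | nput (s : State) (a : ℕ) (i e : NExp) :
      Run (.nput a i e) s (i.cost + e.cost + 1)
        { s with na := Function.update s.na a (Function.update (s.na a) (i.eval s) (e.eval s)) }
  | rput (s : State) (a : ℕ) (i : NExp) (e : RExp) :
      Run (.rput a i e) s (i.cost + e.cost + 1)
        { s with ra := Function.update s.ra a (Function.update (s.ra a) (i.eval s) (e.eval s)) }
  | seq {c d : Cmd} {s s₁ s₂ : State} {t₁ t₂ : ℕ} :
      Run c s t₁ s₁ → Run d s₁ t₂ s₂ → Run (.seq c d) s (t₁ + t₂) s₂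
  | iteTrue {b : BExp} {c d : Cmd} {s s' : State} {t : ℕ} :
      b.eval s → Run c s t s' → Run (.ite b c d) s (b.cost + 1 + t) s'
  | iteFalse {b : BExp} {c d : Cmd} {s s' : State} {t : ℕ} :
      ¬ b.eval s → Run d s t s' → Run (.ite b c d) s (b.cost + 1 + t) s'
  | loopStop {b : BExp} {c : Cmd} {s : State} :
      ¬ b.eval s → Run (.loop b c) s (b.cost + 1) s
  | loopStep {b : BExp} {c : Cmd} {s s₁ s₂ : State} {t₁ t₂ : ℕ} :
      b.eval s → Run c s t₁ s₁ → Run (.loop b c) s₁ t₂ s₂ →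
        Run (.loop b c) s (b.cost + 1 + t₁ + t₂) s₂

end RealRAM

/-! ## Farthest Voronoi diagrams and their separator decompositions -/

namespace FVD

open RealRAM

/-- The Euclidean plane. -/
abbrev Pt : Type := EuclideanSpace ℝ (Fin 2)

/-- The farthest distance `max_{p ∈ P} d(x, p)`. -/
noncomputable def dF (x : Pt) (P : Finset Pt) : ℝ :=
  ((P.sup fun p => nndist x p : NNReal) : ℝ)

/-- No four points of `P` lie on the same circle. -/
def NoFourCocircular (P : Finset Pt) : Prop :=
  ∀ Q ⊆ P, Q.card = 4 → ¬ EuclideanGeometry.Cospherical (Q : Set Pt)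

/-- The (open) farthest Voronoi region of `p` in the diagram of `P`. -/
def freg (P : Finset Pt) (p : Pt) : Set Pt :=
  {x | ∀ p' ∈ P, p' ≠ p → dist x p' < dist x p}

/-- The graph structure of the diagram of `P`, as a subset of the plane. -/
def skeleton (P : Finset Pt) : Set Pt :=
  {x | (1 < P.card ∧ x ∉ ⋃ p ∈ P, freg P p) ∨ (P.card ≤ 1 ∧ x ∈ P)}

/-- `p` is a point of `P` farthest from `x`, that is, an owner of a region incident to `x`. -/
def IsOwner (P : Finset Pt) (x p : Pt) : Prop :=
  p ∈ P ∧ dist x p = dF x P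

/-- The vertices of the diagram of `P`: the points incident to at least three regions. -/
def vertices (P : Finset Pt) : Set Pt :=
  {w | 3 ≤ {p | IsOwner P w p}.ncard}

/-- The (closed) edge of the diagram of `P` that separates the regions of `a` and `b`. -/
def edge (P : Finset Pt) (a b : Pt) : Set Pt :=
  {x | IsOwner P x a ∧ IsOwner P x b}

/-- The combinatorial graph of the diagram: two distinct vertices are adjacent if they lie on a
common edge.  (Points of the plane that are no vertices are isolated.) -/
def graph (P : Finset Pt) : SimpleGraph Pt where
  Adj w w' := w ≠ w' ∧ w ∈ vertices P ∧ w' ∈ vertices P ∧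
    ∃ a b, a ≠ b ∧ w ∈ edge P a b ∧ w' ∈ edge P a b
  symm := ⟨fun _ _ ⟨h, hw, hw', a, b, hab, ha, hb⟩ => ⟨h.symm, hw', hw, a, b, hab, hb, ha⟩⟩
  loopless := ⟨fun _ h => h.1 rfl⟩

/-- The connected component of `y` in the subgraph induced on `S` with `w` removed
(empty if `y ∉ S \ {w}`). -/
def component (P : Finset Pt) (S : Set Pt) (w y : Pt) : Set Pt :=
  {x | ∃ (hy : y ∈ S \ {w}) (hx : x ∈ S \ {w}),
    ((graph P).induce (S \ {w})).Reachable ⟨y, hy⟩ ⟨x, hx⟩}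

/-- `w` is a centroid of the subtree with vertex set `S`: its removal leaves only components with
at most `|S| / 2` vertices. -/
def IsCentroid (P : Finset Pt) (S : Set Pt) (w : Pt) : Prop :=
  w ∈ S ∧ ∀ y ∈ S \ {w}, 2 * (component P S w y).ncard ≤ S.ncard

/-- The component, after the removal of `w`, that is attached to `w` by the edge between the
regions of `a` and `b` (empty if that edge leads to infinity or out of `S`). -/
def branch (P : Finset Pt) (S : Set Pt) (w a b : Pt) : Set Pt :=
  {x | ∃ y ∈ edge P a b, x ∈ component P S w y}

/-- Ternary trees.  A node carries a vertex of the diagram and the owners of its three incident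
regions. -/
inductive SepTree where
  | nil
  | node (w : Pt) (p : Fin 3 → Pt) (child : Fin 3 → SepTree)

/-- The tree is a separator decomposition of the subtree with vertex set `S` of the diagram of `P`.
The root is a centroid `w`; the `k`-th child is a separator decomposition of the component attached
to `w` by the edge opposite to the region of the `k`-th owner. -/
def IsSepDecomp (P : Finset Pt) : SepTree → Set Pt → Prop
  | .nil, S => S = ∅
  | .node w p child, S =>
      IsCentroid P S w ∧ Function.Injective p ∧ (∀ k, IsOwner P w (p k)) ∧
        ∀ k, IsSepDecomp P (child k) (branch P S w (p (k + 1)) (p (k + 2)))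

/-! ### Memory layout -/

/-- Number of vertices. -/
def numVertices (s : State) : ℕ := s.nv 0

/-- Number of regions. -/
def numSites (s : State) : ℕ := s.nv 1

/-- Pointer to the root of the separator decomposition. -/
def root (s : State) : ℕ := s.nv 2

/-- Output register of a point location query. -/
def answer (s : State) : ℕ := s.nv 3

/-- The owner of the `j`-th region. -/
noncomputable def site (s : State) (j : ℕ) : Pt := !₂[s.ra 0 j, s.ra 1 j]

/-- The `i`-th vertex. -/
noncomputable def vertex (s : State) (i : ℕ) : Pt := !₂[s.ra 2 i, s.ra 3 i]

/-- Index of the `k`-th region incident to the `i`-th vertex. -/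
def own (s : State) (i : ℕ) (k : Fin 3) : ℕ := s.na 0 (3 * i + k)

/-- Pointer to the vertex at the other end of the edge at the `i`-th vertex that is opposite to its
`k`-th region.  Pointers are `j + 1` for the vertex with index `j`, and `0` for none. -/
def nbr (s : State) (i : ℕ) (k : Fin 3) : ℕ := s.na 1 (3 * i + k)

/-- Pointer to the `k`-th child of the `i`-th vertex in the separator decomposition. -/
def child (s : State) (i : ℕ) (k : Fin 3) : ℕ := s.na 2 (3 * i + k)

/-- The point held by the `j`-th pair of real registers (input and output of queries). -/
noncomputable def reg (s : State) (j : ℕ) : Pt := !₂[s.rv (2 * j), s.rv (2 * j + 1)]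

/-- The memory lists the owners of the non-empty regions and the vertices of the diagram of `P`,
each once, and for every vertex its three incident regions, in any order. -/
structure StoresFeatures (P : Finset Pt) (s : State) : Prop where
  site_inj : Set.InjOn (site s) (Set.Iio (numSites s))
  site_range : site s '' Set.Iio (numSites s) = {p | p ∈ P ∧ (freg P p).Nonempty}
  vertex_inj : Set.InjOn (vertex s) (Set.Iio (numVertices s))
  vertex_range : vertex s '' Set.Iio (numVertices s) = vertices P
  own_lt : ∀ i < numVertices s, ∀ k, own s i k < numSites s
  own_inj : ∀ i < numVertices s, Function.Injective (own s i)
  own_spec : ∀ i < numVertices s, ∀ k, IsOwner P (vertex s i) (site s (own s i k))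

/-- The memory stores the farthest Voronoi diagram of `P`, with its adjacency structure. -/
def StoresFVD (P : Finset Pt) (s : State) : Prop :=
  StoresFeatures P s ∧
    ∀ i < numVertices s, ∀ k : Fin 3, ∀ j, nbr s i k = j + 1 ↔
      j < numVertices s ∧ j ≠ i ∧
        vertex s j ∈ edge P (site s (own s i (k + 1))) (site s (own s i (k + 2)))

/-- The pointer `r` leads to the tree in memory. -/
def StoresTree (s : State) : SepTree → ℕ → Prop
  | .nil, r => r = 0
  | .node w p ch, r => ∃ i, r = i + 1 ∧ i < numVertices s ∧ vertex s i = w ∧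
      (∀ k, site s (own s i k) = p k) ∧ ∀ k, StoresTree s (ch k) (child s i k)

/-- The memory stores the separator decomposition `t` of the farthest Voronoi diagram of `P`. -/
def StoresSD (P : Finset Pt) (t : SepTree) (s : State) : Prop :=
  StoresFeatures P s ∧ IsSepDecomp P t (vertices P) ∧ StoresTree s t (root s)

/-- A valid input of the segment query: `uv` is a segment of the skeleton of `C` that bisects the
chord `c₁c₂` of `C`, with `u` closer to `C` than to `P`, and `v` closer to `P` than to `C`. -/
structure SegmentInput (P C : Finset Pt) (u v c₁ c₂ : Pt) : Prop where
  mem₁ : c₁ ∈ C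
  mem₂ : c₂ ∈ C
  ne : c₁ ≠ c₂
  subset_skeleton : segment ℝ u v ⊆ skeleton C
  subset_edge : segment ℝ u v ⊆ edge C c₁ c₂
  left : dF u C < dF u P
  right : dF v P < dF v C

end FVD

/-!
The programs rest on two facts about a vertex `w` with owners `p 0`, `p 1`, `p 2`.  The rays that
leave `w` away from the owners cut the plane into three sectors, numbered so that the `k`-th one
contains the edge opposite to `p k`.  First, a point of `P` that is no owner of `w` but at least as
far from a query point `q` as the three owners lies beyond the chord that bounds the sector of `q`
(`Owners.chord_sector_neg`), and no point of `P` lies beyond two of the three chords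
(`Owners.chord_disjoint`), because `P` lies in the disk around `w` through the owners.  Second, an
edge at `w` leads into the sector with its number, and no edge avoiding `w` joins vertices of
different sectors (`sector_of_mem_edge`, `sector_eq_of_adj`); so the diagram is a forest.

The diagram is in fact connected (`conn_vertices`).  If a point of `P` lies beyond a chord at `w`,
then the edge that bisects the chord leads to another vertex (`Owners.exists_next`), and on the way
the convex function `x ↦ d_f(x, P)² - d(x, o)²` decreases for every `o` beyond the chord.  Taking
for `o` the centre of gravity of the owners of a vertex `x`, such a descent from any vertex ends in
`x`.  Taking for `o` a point of `P` with nonempty region, it ends in a vertex owned by `o`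
(`exists_vertex_of_isOwner`), if there is any vertex.  Suppose now that `o` is at least as far from
`q` as the owners of `w`, and owns a vertex `y` but not `w`.  By the first fact, applied to `q` and
to `y`, the point `y` is in the sector of `q`, hence in the branch of this sector (`search_step`).

*Point location* keeps the best owner seen so far, and descends in the separator decomposition into
the branch of the sector of `q`.  As centroids halve the number of vertices, the depth is
logarithmic.  Sectors are found by comparing squared distances and signs of orientations, so that no
roots are needed.  Diagrams without vertices have at most two regions, which is why both queries
begin by inspecting the first and the last site (`StoresFeatures.exists_vertex_or_extreme`).

In a *segment query*, `d(x, c₁)² - d(x, p)²` is an affine function of `x` (`gap`) for every `p`, and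
the sought point is the first zero of these functions on the way from `v` to `u`.  The program
maintains a point `q` on the line `uv`, on the side of `u` of the sought point, and replaces it by
the zero of the function of every owner `p` that it encounters, if this is closer to `v` (`pull`).
A point `e` of `P` that determines the sought point is then at least as far from `q` as `c₁`, which
is at least as far as the owners of the visited vertices, so that `search_step` applies to `q`
although `q` moves.

The *construction* works on a stack of connected parts.  A part is traversed breadth first, which
yields a list in which parents precede their children (`Traversal`, `Enumeration`).  When subtree
sizes are accumulated from the end of the list, the first node whose subtree has at least half of
the vertices is a centroid (`Merging.centroid`).  It is flagged, which separates the parts beyond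
its three neighbours; these are pushed together with the addresses of the child pointers to be set.
The cost is constant per vertex and level, and the number of levels is logarithmic
(`rounds_finished`).
-/

namespace RealRAM

/-! ### Executing programs -/

/-- Programs without loops. -/
def Cmd.LoopFree : Cmd → Prop
  | .seq c d => c.LoopFree ∧ d.LoopFree
  | .ite _ c d => c.LoopFree ∧ d.LoopFree
  | .loop _ _ => False
  | _ => True

/-- An upper bound for the number of steps of a program without loops. -/
def Cmd.bound : Cmd → ℕ
  | .skip => 1
  | .nset _ e => e.cost + 1
  | .rset _ e => e.cost + 1
  | .nput _ i e => i.cost + e.cost + 1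
  | .rput _ i e => i.cost + e.cost + 1
  | .seq c d => c.bound + d.bound
  | .ite b c d => b.cost + 1 + max c.bound d.bound
  | .loop _ _ => 0

open Classical in
/-- The final state of a program without loops.  (Loops are skipped.) -/
noncomputable def Cmd.sem : Cmd → State → State
  | .skip, s => s
  | .nset x e, s => { s with nv := Function.update s.nv x (e.eval s) }
  | .rset x e, s => { s with rv := Function.update s.rv x (e.eval s) }
  | .nput a i e, s =>
      { s with na := Function.update s.na a (Function.update (s.na a) (i.eval s) (e.eval s)) }
  | .rput a i e, s =>
      { s with ra := Function.update s.ra a (Function.update (s.ra a) (i.eval s) (e.eval s)) }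
  | .seq c d, s => d.sem (c.sem s)
  | .ite b c d, s => if b.eval s then c.sem s else d.sem s
  | .loop _ _, s => s

theorem Cmd.sem_ite_pos {b : BExp} {c d : Cmd} {s : State} (h : b.eval s) :
    (Cmd.ite b c d).sem s = c.sem s := by rw [Cmd.sem, if_pos h]

theorem Cmd.sem_ite_neg {b : BExp} {c d : Cmd} {s : State} (h : ¬ b.eval s) :
    (Cmd.ite b c d).sem s = d.sem s := by rw [Cmd.sem, if_neg h]

theorem Cmd.LoopFree.run {c : Cmd} (hc : c.LoopFree) (s : State) :
    ∃ T, Run c s T (c.sem s) ∧ T ≤ c.bound := by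
  induction c generalizing s with
  | skip => exact ⟨_, .skip s, le_rfl⟩
  | nset x e => exact ⟨_, .nset s x e, le_rfl⟩
  | rset x e => exact ⟨_, .rset s x e, le_rfl⟩
  | nput a i e => exact ⟨_, .nput s a i e, le_rfl⟩
  | rput a i e => exact ⟨_, .rput s a i e, le_rfl⟩
  | seq c d ihc ihd =>
    obtain ⟨T₁, h₁, b₁⟩ := ihc hc.1 s
    obtain ⟨T₂, h₂, b₂⟩ := ihd hc.2 (c.sem s)
    exact ⟨_, .seq h₁ h₂, Nat.add_le_add b₁ b₂⟩
  | ite b c d ihc ihd =>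
    by_cases hb : b.eval s
    · obtain ⟨T, h, hT⟩ := ihc hc.1 s
      refine ⟨_, ?_, Nat.add_le_add_left (hT.trans (le_max_left _ d.bound)) (b.cost + 1)⟩
      rw [Cmd.sem_ite_pos hb]
      exact .iteTrue hb h
    · obtain ⟨T, h, hT⟩ := ihd hc.2 s
      refine ⟨_, ?_, Nat.add_le_add_left (hT.trans (le_max_right c.bound _)) (b.cost + 1)⟩
      rw [Cmd.sem_ite_neg hb]
      exact .iteFalse hb h
  | loop b c => exact hc.elim

/-- Total correctness with a time bound: started in `s`, the program halts after at most `B` steps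
in a state that satisfies `Q`. -/
def Exec (c : Cmd) (s : State) (B : ℕ) (Q : State → Prop) : Prop :=
  ∃ T s', Run c s T s' ∧ T ≤ B ∧ Q s'

theorem Exec.of_loopFree {c : Cmd} {s : State} {Q : State → Prop} (hc : c.LoopFree)
    (hQ : Q (c.sem s)) : Exec c s c.bound Q := by
  obtain ⟨T, h, hT⟩ := hc.run s
  exact ⟨T, _, h, hT, hQ⟩

theorem Exec.mono {c : Cmd} {s : State} {B B' : ℕ} {Q Q' : State → Prop} (h : Exec c s B Q)
    (hB : B ≤ B') (hQ : ∀ s', Q s' → Q' s') : Exec c s B' Q' := by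
  obtain ⟨T, s', h, hT, hq⟩ := h
  exact ⟨T, s', h, hT.trans hB, hQ _ hq⟩

theorem Exec.seq {c d : Cmd} {s : State} {B₁ B₂ : ℕ} {Q₁ Q₂ : State → Prop} (h₁ : Exec c s B₁ Q₁)
    (h₂ : ∀ s₁, Q₁ s₁ → Exec d s₁ B₂ Q₂) : Exec (.seq c d) s (B₁ + B₂) Q₂ := by
  obtain ⟨T₁, s₁, h₁, hT₁, hq₁⟩ := h₁
  obtain ⟨T₂, s₂, h₂, hT₂, hq₂⟩ := h₂ s₁ hq₁
  exact ⟨_, s₂, .seq h₁ h₂, Nat.add_le_add hT₁ hT₂, hq₂⟩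

/-- A loop whose invariant `I` carries a bound for the number of remaining rounds. -/
theorem Exec.loop {b : BExp} {c : Cmd} {B : ℕ} {I : ℕ → State → Prop} {Q : State → Prop}
    (H : ∀ k s, I k s → (¬ b.eval s ∧ Q s) ∨
      ∃ k', k = k' + 1 ∧ b.eval s ∧ Exec c s B (I k')) {k : ℕ} {s : State} (hs : I k s) :
    Exec (.loop b c) s ((b.cost + 1 + B) * (k + 1)) Q := by
  induction k generalizing s with
  | zero =>
    rcases H 0 s hs with ⟨hb, hq⟩ | ⟨k', hk, -⟩
    · exact ⟨_, s, .loopStop hb, by simp, hq⟩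
    · omega
  | succ k ih =>
    rcases H _ s hs with ⟨hb, hq⟩ | ⟨k', hk, hb, T₁, s₁, h₁, hT₁, hq₁⟩
    · exact ⟨_, s, .loopStop hb, by nlinarith, hq⟩
    · obtain rfl : k = k' := by omega
      obtain ⟨T₂, s₂, h₂, hT₂, hq₂⟩ := ih hq₁
      exact ⟨_, s₂, .loopStep hb h₁ h₂, by nlinarith, hq₂⟩

/-- Rounds of a loop: from `s`, the loop passes through a state that satisfies `Q`, after at most
`B` steps. -/
def Rounds (b : BExp) (c : Cmd) (s : State) (B : ℕ) (Q : State → Prop) : Prop :=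
  ∃ T s', (∀ T' s'', Run (.loop b c) s' T' s'' → Run (.loop b c) s (T + T') s'') ∧ T ≤ B ∧ Q s'

theorem Rounds.refl {b : BExp} {c : Cmd} {s : State} {Q : State → Prop} (h : Q s) :
    Rounds b c s 0 Q :=
  ⟨0, s, fun T' s'' h => by rwa [Nat.zero_add], le_rfl, h⟩

theorem Rounds.trans {b : BExp} {c : Cmd} {s : State} {B₁ B₂ : ℕ} {Q₁ Q₂ : State → Prop}
    (h₁ : Rounds b c s B₁ Q₁) (h₂ : ∀ s₁, Q₁ s₁ → Rounds b c s₁ B₂ Q₂) :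
    Rounds b c s (B₁ + B₂) Q₂ := by
  obtain ⟨T₁, s₁, r₁, hT₁, q₁⟩ := h₁
  obtain ⟨T₂, s₂, r₂, hT₂, q₂⟩ := h₂ s₁ q₁
  refine ⟨T₁ + T₂, s₂, fun T' s'' h => ?_, Nat.add_le_add hT₁ hT₂, q₂⟩
  rw [Nat.add_assoc]
  exact r₁ _ _ (r₂ _ _ h)

theorem Rounds.mono {b : BExp} {c : Cmd} {s : State} {B B' : ℕ} {Q Q' : State → Prop}
    (h : Rounds b c s B Q) (hB : B ≤ B') (hQ : ∀ s', Q s' → Q' s') : Rounds b c s B' Q' := by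
  obtain ⟨T, s', r, hT, q⟩ := h
  exact ⟨T, s', r, hT.trans hB, hQ _ q⟩

theorem Exec.rounds {b : BExp} {c : Cmd} {s : State} {B : ℕ} {Q : State → Prop}
    (h : Exec c s B Q) (hb : b.eval s) : Rounds b c s (b.cost + 1 + B) Q := by
  obtain ⟨T, s', r, hT, q⟩ := h
  exact ⟨b.cost + 1 + T, s', fun T' s'' h => .loopStep hb r h, by omega, q⟩

theorem Rounds.exec {b : BExp} {c : Cmd} {s : State} {B : ℕ} {Q : State → Prop}
    (h : Rounds b c s B Q) (hb : ∀ s', Q s' → ¬ b.eval s') :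
    Exec (.loop b c) s (B + (b.cost + 1)) Q := by
  obtain ⟨T, s', r, hT, q⟩ := h
  exact ⟨_, s', r _ _ (.loopStop (hb s' q)), by omega, q⟩

end RealRAM

namespace FVD

open RealRAM

/-! ### Distances and orientations in coordinates -/

section

/-- The squared Euclidean distance, as a polynomial in the coordinates. -/
def dsq (x y : Pt) : ℝ := (x 0 - y 0) ^ 2 + (x 1 - y 1) ^ 2

/-- Twice the signed area of the triangle `abc`. -/
def det (a b c : Pt) : ℝ := (b 0 - a 0) * (c 1 - a 1) - (b 1 - a 1) * (c 0 - a 0)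

theorem pt_ext {x y : Pt} (h0 : x 0 = y 0) (h1 : x 1 = y 1) : x = y := by
  ext i; fin_cases i
  · exact h0
  · exact h1

theorem dsq_nonneg (x y : Pt) : 0 ≤ dsq x y := by unfold dsq; positivity

theorem dist_eq_sqrt_dsq (x y : Pt) : dist x y = √(dsq x y) := by
  rw [EuclideanSpace.dist_eq, Fin.sum_univ_two, Real.dist_eq, Real.dist_eq, sq_abs, sq_abs, dsq]

theorem dist_le_iff {x y x' y' : Pt} : dist x y ≤ dist x' y' ↔ dsq x y ≤ dsq x' y' := by
  rw [dist_eq_sqrt_dsq, dist_eq_sqrt_dsq]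
  exact Real.sqrt_le_sqrt_iff (dsq_nonneg _ _)

theorem dist_lt_iff {x y x' y' : Pt} : dist x y < dist x' y' ↔ dsq x y < dsq x' y' := by
  rw [← not_le, dist_le_iff, not_le]

theorem dist_eq_iff {x y x' y' : Pt} : dist x y = dist x' y' ↔ dsq x y = dsq x' y' := by
  rw [le_antisymm_iff, dist_le_iff, dist_le_iff, ← le_antisymm_iff]

theorem dsq_eq_zero {x y : Pt} (h : dsq x y = 0) : x = y := by
  unfold dsq at h
  apply pt_ext <;> nlinarith [sq_nonneg (x 0 - y 0), sq_nonneg (x 1 - y 1)]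

theorem dsq_pos {x y : Pt} (h : x ≠ y) : 0 < dsq x y :=
  lt_of_le_of_ne (dsq_nonneg _ _) fun h0 => h (dsq_eq_zero h0.symm)

theorem dist_le_dF (x : Pt) {P : Finset Pt} {p : Pt} (hp : p ∈ P) : dist x p ≤ dF x P := by
  have := Finset.le_sup (f := fun p => nndist x p) hp
  exact_mod_cast this

theorem exists_dist_eq_dF (x : Pt) {P : Finset Pt} (hP : P.Nonempty) :
    ∃ p ∈ P, dist x p = dF x P := by
  obtain ⟨p, hp, h⟩ := Finset.exists_mem_eq_sup P hP (fun p => nndist x p)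
  exact ⟨p, hp, by rw [dF, h, coe_nndist]⟩

theorem isOwner_iff {P : Finset Pt} {x p : Pt} :
    IsOwner P x p ↔ p ∈ P ∧ ∀ p' ∈ P, dsq x p' ≤ dsq x p := by
  constructor
  · rintro ⟨hp, h⟩
    exact ⟨hp, fun p' hp' => dist_le_iff.1 (h ▸ dist_le_dF x hp')⟩
  · rintro ⟨hp, h⟩
    obtain ⟨p', hp', e⟩ := exists_dist_eq_dF x ⟨p, hp⟩
    exact ⟨hp, le_antisymm (dist_le_dF x hp) (e ▸ dist_le_iff.2 (h p' hp'))⟩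

theorem exists_isOwner (x : Pt) {P : Finset Pt} (hP : P.Nonempty) : ∃ p, IsOwner P x p := by
  obtain ⟨p, hp, h⟩ := exists_dist_eq_dF x hP
  exact ⟨p, hp, h⟩

theorem IsOwner.dsq_le {P : Finset Pt} {x p p' : Pt} (h : IsOwner P x p) (h' : p' ∈ P) :
    dsq x p' ≤ dsq x p := (isOwner_iff.1 h).2 p' h'

theorem IsOwner.dsq_eq {P : Finset Pt} {x p p' : Pt} (h : IsOwner P x p) (h' : IsOwner P x p') :
    dsq x p = dsq x p' := le_antisymm (h'.dsq_le h.1) (h.dsq_le h'.1)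

theorem IsOwner.of_dsq_eq {P : Finset Pt} {x p p' : Pt} (h : IsOwner P x p) (hp : p' ∈ P)
    (he : dsq x p ≤ dsq x p') : IsOwner P x p' :=
  isOwner_iff.2 ⟨hp, fun _ h' => (h.dsq_le h').trans he⟩

theorem IsOwner.dsq_lt {P : Finset Pt} {x p p' : Pt} (h : IsOwner P x p) (hp : p' ∈ P)
    (hn : ¬ IsOwner P x p') : dsq x p' < dsq x p :=
  lt_of_not_ge fun he => hn (h.of_dsq_eq hp he)

/-- Three distinct points of a circle are not collinear. -/
theorem det_ne_zero {w a b c : Pt} (hab : dsq w a = dsq w b) (hac : dsq w a = dsq w c)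
    (h1 : a ≠ b) (h2 : a ≠ c) (h3 : b ≠ c) : det a b c ≠ 0 := by
  intro h
  have p1 := dsq_pos h1
  have p2 := dsq_pos h2
  have p3 := dsq_pos h3
  -- Heron's formula: the product of the squared side lengths is `4 R² det²`
  have key : dsq a b * dsq a c * dsq b c = 4 * dsq w a * det a b c ^ 2 := by
    have e1 : dsq w b - dsq w a = 0 := by linarith
    have e2 : dsq w c - dsq w a = 0 := by linarith
    unfold dsq det at *
    set f0 := b 0 - a 0 with hf0
    set f1 := b 1 - a 1 with hf1
    set g0 := c 0 - a 0 with hg0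
    set g1 := c 1 - a 1 with hg1
    set u := w 0 - a 0 with hu
    set v := w 1 - a 1 with hv
    have E1 : f0 ^ 2 + f1 ^ 2 = 2 * (u * f0 + v * f1) := by
      rw [hf0, hf1, hu, hv]; linarith
    have E2 : g0 ^ 2 + g1 ^ 2 = 2 * (u * g0 + v * g1) := by
      rw [hg0, hg1, hu, hv]; linarith
    have E3 : (a 0 - b 0) ^ 2 + (a 1 - b 1) ^ 2 = f0 ^ 2 + f1 ^ 2 := by rw [hf0, hf1]; ring
    have E4 : (a 0 - c 0) ^ 2 + (a 1 - c 1) ^ 2 = g0 ^ 2 + g1 ^ 2 := by rw [hg0, hg1]; ring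
    have E5 : (b 0 - c 0) ^ 2 + (b 1 - c 1) ^ 2
        = (f0 ^ 2 + f1 ^ 2) + (g0 ^ 2 + g1 ^ 2) - 2 * (f0 * g0 + f1 * g1) := by
      rw [hf0, hf1, hg0, hg1]; ring
    have U : 2 * u * (f0 * g1 - f1 * g0) = (f0 ^ 2 + f1 ^ 2) * g1 - (g0 ^ 2 + g1 ^ 2) * f1 := by
      rw [E1, E2]; ring
    have V : 2 * v * (f0 * g1 - f1 * g0) = (g0 ^ 2 + g1 ^ 2) * f0 - (f0 ^ 2 + f1 ^ 2) * g0 := by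
      rw [E1, E2]; ring
    rw [E3, E4, E5]
    have : 4 * (u ^ 2 + v ^ 2) * (f0 * g1 - f1 * g0) ^ 2
        = (2 * u * (f0 * g1 - f1 * g0)) ^ 2 + (2 * v * (f0 * g1 - f1 * g0)) ^ 2 := by ring
    rw [this, U, V]; ring
  rw [h] at key
  have : 0 < dsq a b * dsq a c * dsq b c := by positivity
  nlinarith

/-- Two points that are each equidistant from the corners of a triangle coincide. -/
theorem eq_of_equidistant {w x a b c : Pt} (hd : det a b c ≠ 0) (hab : dsq w a = dsq w b)
    (hac : dsq w a = dsq w c) (hab' : dsq x a = dsq x b) (hac' : dsq x a = dsq x c) : w = x := by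
  have e1 : (w 0 - x 0) * (b 0 - a 0) + (w 1 - x 1) * (b 1 - a 1) = 0 := by
    unfold dsq at *; linarith
  have e2 : (w 0 - x 0) * (c 0 - a 0) + (w 1 - x 1) * (c 1 - a 1) = 0 := by
    unfold dsq at *; linarith
  have f0 : (w 0 - x 0) * det a b c = 0 := by
    unfold det; linear_combination (c 1 - a 1) * e1 - (b 1 - a 1) * e2
  have f1 : (w 1 - x 1) * det a b c = 0 := by
    unfold det; linear_combination (b 0 - a 0) * e2 - (c 0 - a 0) * e1
  apply pt_ext
  · exact sub_eq_zero.1 ((mul_eq_zero.1 f0).resolve_right hd)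
  · exact sub_eq_zero.1 ((mul_eq_zero.1 f1).resolve_right hd)

/-! ### Vertices and their owners -/

/-- `p` lists the owners of the vertex `w`. -/
structure Owners (P : Finset Pt) (w : Pt) (p : Fin 3 → Pt) : Prop where
  inj : Function.Injective p
  own : ∀ k, IsOwner P w (p k)

variable {P : Finset Pt} {w x q : Pt} {p : Fin 3 → Pt}

theorem finite_owners (P : Finset Pt) (x : Pt) : {p | IsOwner P x p}.Finite :=
  P.finite_toSet.subset fun _ h => h.1

theorem mem_vertices_of_isOwner {a b c : Pt} (ha : IsOwner P w a) (hb : IsOwner P w b)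
    (hc : IsOwner P w c) (hab : a ≠ b) (hac : a ≠ c) (hbc : b ≠ c) : w ∈ vertices P := by
  rw [vertices, Set.mem_ofPred_eq, Nat.succ_le_iff, Set.two_lt_ncard_iff (finite_owners P w)]
  exact ⟨a, b, c, ha, hb, hc, hab, hac, hbc⟩

theorem mem_vertices_iff : w ∈ vertices P ↔ ∃ p, Owners P w p := by
  rw [vertices, Set.mem_ofPred_eq, Nat.succ_le_iff, Set.two_lt_ncard_iff (finite_owners P w)]
  constructor
  · rintro ⟨a, b, c, ha, hb, hc, hab, hac, hbc⟩
    refine ⟨![a, b, c], ?_, ?_⟩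
    · intro i j h
      fin_cases i <;> fin_cases j <;> simp_all
    · intro k; fin_cases k
      · exact ha
      · exact hb
      · exact hc
  · rintro ⟨p, hp⟩
    rw [← Set.two_lt_ncard_iff (finite_owners P w)]
    exact mem_vertices_of_isOwner (hp.own 0) (hp.own 1) (hp.own 2) (hp.inj.ne (by decide))
      (hp.inj.ne (by decide)) (hp.inj.ne (by decide))

theorem Owners.mem_vertices (h : Owners P w p) : w ∈ vertices P := mem_vertices_iff.2 ⟨p, h⟩

theorem Owners.dsq_eq (h : Owners P w p) (i j : Fin 3) : dsq w (p i) = dsq w (p j) :=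
  (h.own i).dsq_eq (h.own j)

theorem Owners.det_ne_zero (h : Owners P w p) {i j k : Fin 3} (hij : i ≠ j) (hik : i ≠ k)
    (hjk : j ≠ k) : det (p i) (p j) (p k) ≠ 0 :=
  FVD.det_ne_zero (h.dsq_eq i j) (h.dsq_eq i k) (h.inj.ne hij) (h.inj.ne hik) (h.inj.ne hjk)

/-- Without four cocircular points, a vertex has no more than three owners. -/
theorem Owners.eq_of_isOwner (hP : NoFourCocircular P) (h : Owners P w p) {e : Pt}
    (he : IsOwner P w e) : ∃ k, e = p k := by
  by_contra! hne
  have h01 : p 0 ≠ p 1 := h.inj.ne (by decide)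
  have h02 : p 0 ≠ p 2 := h.inj.ne (by decide)
  have h12 : p 1 ≠ p 2 := h.inj.ne (by decide)
  refine hP {e, p 0, p 1, p 2} ?_ ?_ ⟨w, dF w P, ?_⟩
  · intro z hz
    simp only [Finset.mem_insert, Finset.mem_singleton] at hz
    rcases hz with rfl | rfl | rfl | rfl
    exacts [he.1, (h.own 0).1, (h.own 1).1, (h.own 2).1]
  · rw [Finset.card_insert_of_notMem (by simp [hne]), Finset.card_insert_of_notMem (by simp [*]),
      Finset.card_insert_of_notMem (by simp [*]), Finset.card_singleton]
  · intro z hz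
    simp only [Finset.coe_insert, Finset.coe_singleton, Set.mem_insert_iff,
      Set.mem_singleton_iff] at hz
    rw [dist_comm]
    rcases hz with rfl | rfl | rfl | rfl
    exacts [he.2, (h.own 0).2, (h.own 1).2, (h.own 2).2]

/-- Distinct vertices do not have the same owners. -/
theorem exists_not_isOwner (hx : x ∈ vertices P) (hne : x ≠ w) :
    ∃ e, IsOwner P x e ∧ ¬ IsOwner P w e := by
  obtain ⟨o, ho⟩ := mem_vertices_iff.1 hx
  by_contra! hall
  have hw : ∀ k, IsOwner P w (o k) := fun k => hall _ (ho.own k)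
  exact hne (eq_of_equidistant (ho.det_ne_zero (i := 0) (j := 1) (k := 2) (by decide) (by decide)
    (by decide)) (ho.dsq_eq 0 1) (ho.dsq_eq 0 2) ((hw 0).dsq_eq (hw 1)) ((hw 0).dsq_eq (hw 2)))

/-! ### The three sectors at a vertex -/

/-- The sign of `chord p j e` tells on which side of the chord opposite to `p j` the point `e`
lies: it is negative if the chord separates `e` from `p j`. -/
def chord (p : Fin 3 → Pt) (j : Fin 3) (e : Pt) : ℝ :=
  det (p (j + 1)) (p (j + 2)) e * det (p (j + 1)) (p (j + 2)) (p j)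

open Classical in
/-- The index of an owner in `p` farthest from `q`. -/
noncomputable def farIdx (p : Fin 3 → Pt) (q : Pt) : Fin 3 :=
  if dsq q (p 0) < dsq q (p 1) then (if dsq q (p 1) < dsq q (p 2) then 2 else 1)
  else (if dsq q (p 0) < dsq q (p 2) then 2 else 0)

open Classical in
/-- The rays that leave `w` in the directions away from its three owners cut the plane into three
sectors; this is the index of the owner opposite to the sector of `q`.  If `p i` is an owner
farthest from `q`, then `q` lies in one of the two sectors along the `i`-th ray, and an orientation
test against that ray decides in which. -/
noncomputable def sector (w : Pt) (p : Fin 3 → Pt) (q : Pt) : Fin 3 :=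
  if 0 < det (p (farIdx p q)) w q * det (p 0) (p 1) (p 2) then farIdx p q + 2
  else farIdx p q + 1

theorem dsq_le_farIdx (p : Fin 3 → Pt) (q : Pt) (k : Fin 3) :
    dsq q (p k) ≤ dsq q (p (farIdx p q)) := by
  unfold farIdx
  split_ifs <;> fin_cases k <;> simp <;> linarith

/-- Let `a`, `b` lie on a circle around `w` and `e` inside of it.  If, seen from `q`, the point `e`
is at least as far as `a` and `a` at least as far as `b`, then the line `ab` has `e` on the side
that the position of `q` relative to the line `aw` prescribes. -/
theorem det_mul_det_neg {w q a b e : Pt} (hab : a ≠ b) (hb : dsq w a = dsq w b)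
    (he : dsq w e < dsq w a) (hqe : dsq q a ≤ dsq q e) (hqb : dsq q b ≤ dsq q a) :
    det a w q * det a b e < 0 := by
  have hpos := dsq_pos hab
  unfold dsq det at *
  set a0 := w 0 - a 0 with ha0
  set a1 := w 1 - a 1 with ha1
  set m0 := q 0 - w 0 with hm0
  set m1 := q 1 - w 1 with hm1
  set f0 := a 0 - e 0 with hf0
  set f1 := a 1 - e 1 with hf1
  set h0 := a 0 - b 0 with hh0
  set h1 := a 1 - b 1 with hh1
  have r1 : w 0 - e 0 = a0 + f0 := by rw [ha0, hf0]; ring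
  have r2 : w 1 - e 1 = a1 + f1 := by rw [ha1, hf1]; ring
  have r3 : w 0 - b 0 = a0 + h0 := by rw [ha0, hh0]; ring
  have r4 : w 1 - b 1 = a1 + h1 := by rw [ha1, hh1]; ring
  have r5 : q 0 - e 0 = m0 + a0 + f0 := by rw [ha0, hf0, hm0]; ring
  have r6 : q 1 - e 1 = m1 + a1 + f1 := by rw [ha1, hf1, hm1]; ring
  have r7 : q 0 - b 0 = m0 + a0 + h0 := by rw [ha0, hh0, hm0]; ring
  have r8 : q 1 - b 1 = m1 + a1 + h1 := by rw [ha1, hh1, hm1]; ring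
  have r9 : q 0 - a 0 = m0 + a0 := by rw [ha0, hm0]; ring
  have r10 : q 1 - a 1 = m1 + a1 := by rw [ha1, hm1]; ring
  have r11 : b 0 - a 0 = - h0 := by rw [hh0]; ring
  have r12 : b 1 - a 1 = - h1 := by rw [hh1]; ring
  have r13 : e 0 - a 0 = - f0 := by rw [hf0]; ring
  have r14 : e 1 - a 1 = - f1 := by rw [hf1]; ring
  rw [r1, r2] at he
  rw [r3, r4] at hb
  rw [r9, r10, r5, r6] at hqe
  rw [r9, r10, r7, r8] at hqb
  rw [r9, r10, r11, r12, r13, r14]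
  clear_value a0 a1 m0 m1 f0 f1 h0 h1
  have n1 : a0 * f0 + a1 * f1 < 0 := by linarith [sq_nonneg f0, sq_nonneg f1]
  have n2 : 0 < m0 * f0 + m1 * f1 := by linarith
  have n3 : a0 * h0 + a1 * h1 < 0 := by linarith
  have n4 : m0 * h0 + m1 * h1 ≤ 0 := by linarith
  have key : (a0 * (m1 + a1) - a1 * (m0 + a0)) * (-h0 * -f1 - -h1 * -f0)
      = (m0 * f0 + m1 * f1) * (a0 * h0 + a1 * h1) - (a0 * f0 + a1 * f1) * (m0 * h0 + m1 * h1) := by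
    ring
  rw [key]
  linarith [mul_neg_of_pos_of_neg n2 n3, mul_nonneg_of_nonpos_of_nonpos n1.le n4]

theorem chord_neg_of_det {w : Pt} {p : Fin 3 → Pt} {q e : Pt} {i : Fin 3}
    (hd : det (p i) (p (i + 1)) (p (i + 2)) = det (p 0) (p 1) (p 2))
    (h1 : det (p i) w q * det (p i) (p (i + 1)) e < 0)
    (h2 : det (p i) w q * det (p i) (p (i + 2)) e < 0)
    (hD : det (p 0) (p 1) (p 2) ≠ 0) :
    (0 < det (p i) w q * det (p 0) (p 1) (p 2) → chord p (i + 2) e < 0) ∧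
    (¬ 0 < det (p i) w q * det (p 0) (p 1) (p 2) → chord p (i + 1) e < 0) := by
  have i1 : i + 2 + 1 = i := by fin_cases i <;> rfl
  have i2 : i + 2 + 2 = i + 1 := by fin_cases i <;> rfl
  have i3 : i + 1 + 1 = i + 2 := by fin_cases i <;> rfl
  have i4 : i + 1 + 2 = i := by fin_cases i <;> rfl
  have s1 : ∀ a b c : Pt, det a b c = - det b a c := by intros; unfold det; ring
  have s2 : ∀ a b c : Pt, det a b c = det b c a := by intros; unfold det; ring
  unfold chord
  rw [i1, i2, i3, i4, hd, ← s2 (p (i + 1)), ← s2 (p i), hd, s1 (p (i + 2)) (p i) e]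
  generalize det (p i) w q = X at *
  generalize det (p 0) (p 1) (p 2) = D at *
  generalize det (p i) (p (i + 1)) e = E at *
  generalize det (p i) (p (i + 2)) e = F at *
  constructor
  · intro h
    by_contra! hc
    nlinarith [mul_pos h (neg_pos.2 h1), mul_nonneg (sq_nonneg X) hc]
  · intro h
    have hX : X ≠ 0 := by rintro rfl; simp at h1
    have hXD : X * D < 0 := lt_of_le_of_ne (not_lt.1 h) (mul_ne_zero hX hD)
    by_contra! hc
    nlinarith [mul_pos (neg_pos.2 hXD) (neg_pos.2 h2), mul_nonneg (sq_nonneg X) hc]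

/-- A point of `P` that is at least as far from `q` as the three owners of `w` lies beyond the chord
that bounds the sector of `q`. -/
theorem Owners.chord_sector_neg (h : Owners P w p) {e : Pt} (he : e ∈ P) (hne : ¬ IsOwner P w e)
    (hq : ∀ k, dsq q (p k) ≤ dsq q e) : chord p (sector w p q) e < 0 := by
  have hD : det (p 0) (p 1) (p 2) ≠ 0 := h.det_ne_zero (by decide) (by decide) (by decide)
  have hcore : ∀ k, k ≠ farIdx p q → det (p (farIdx p q)) w q * det (p (farIdx p q)) (p k) e < 0 :=
    fun k hk => det_mul_det_neg (h.inj.ne hk.symm) (h.dsq_eq _ _) ((h.own _).dsq_lt he hne) (hq _)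
      (dsq_le_farIdx p q k)
  unfold sector
  generalize farIdx p q = i at *
  have hd : det (p i) (p (i + 1)) (p (i + 2)) = det (p 0) (p 1) (p 2) := by
    fin_cases i
    · rfl
    · change det (p 1) (p 2) (p 0) = _; unfold det; ring
    · change det (p 2) (p 0) (p 1) = _; unfold det; ring
  have := chord_neg_of_det hd (hcore (i + 1) (by fin_cases i <;> decide))
    (hcore (i + 2) (by fin_cases i <;> decide)) hD
  split_ifs with hs
  · exact this.1 hs
  · exact this.2 hs

/-- The parts of a disk beyond two sides of an inscribed triangle are disjoint. -/
theorem not_beyond_two_sides {w a b c e : Pt} (hab : dsq w a = dsq w c) (hbc : dsq w b = dsq w c)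
    (hac : a ≠ c) (he : dsq w e ≤ dsq w c) (h1 : det b c e * det a b c < 0)
    (h2 : det c a e * det a b c < 0) : False := by
  have hpos := dsq_pos hac
  have hbcn := dsq_nonneg b c
  unfold dsq at hab hbc he
  have e1 : det a b c * (e 0 - c 0) = det b c e * (a 0 - c 0) + det c a e * (b 0 - c 0) := by
    unfold det; ring
  have e2 : det a b c * (e 1 - c 1) = det b c e * (a 1 - c 1) + det c a e * (b 1 - c 1) := by
    unfold det; ring
  have f1 : 2 * ((c 0 - w 0) * (a 0 - c 0) + (c 1 - w 1) * (a 1 - c 1)) = - dsq a c := by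
    unfold dsq; linarith
  have f2 : 2 * ((c 0 - w 0) * (b 0 - c 0) + (c 1 - w 1) * (b 1 - c 1)) = - dsq b c := by
    unfold dsq; linarith
  have f3 : 2 * ((c 0 - w 0) * (e 0 - c 0) + (c 1 - w 1) * (e 1 - c 1)) ≤ 0 := by
    nlinarith [sq_nonneg (e 0 - c 0), sq_nonneg (e 1 - c 1)]
  have key : det a b c * (det a b c *
      (2 * ((c 0 - w 0) * (e 0 - c 0) + (c 1 - w 1) * (e 1 - c 1))))
      = - (det b c e * det a b c) * dsq a c - (det c a e * det a b c) * dsq b c := by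
    linear_combination det a b c * 2 * ((c 0 - w 0) * e1 + (c 1 - w 1) * e2) +
      det a b c * det b c e * f1 + det a b c * det c a e * f2
  nlinarith [mul_nonneg (sq_nonneg (det a b c)) (neg_nonneg.2 f3), mul_pos (neg_pos.2 h1) hpos,
    mul_nonneg (neg_pos.2 h2).le hbcn]

theorem Owners.chord_disjoint (h : Owners P w p) {e : Pt} (he : e ∈ P) {i j : Fin 3}
    (hi : chord p i e < 0) (hj : chord p j e < 0) : i = j := by
  have s2 : ∀ a b c : Pt, det a b c = det b c a := by intros; unfold det; ring
  have key : ∀ i : Fin 3, chord p i e < 0 → chord p (i + 1) e < 0 → False := by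
    intro i hi hj
    unfold chord at hi hj
    have i3 : i + 1 + 1 = i + 2 := by fin_cases i <;> rfl
    have i4 : i + 1 + 2 = i := by fin_cases i <;> rfl
    rw [i3, i4, ← s2 (p (i + 1)), ← s2 (p i)] at hj
    rw [← s2 (p i)] at hi
    exact not_beyond_two_sides (h.dsq_eq i (i + 2)) (h.dsq_eq (i + 1) (i + 2))
      (h.inj.ne (by fin_cases i <;> decide)) ((h.own (i + 2)).dsq_le he) hi hj
  have h3 : j = i ∨ j = i + 1 ∨ i = j + 1 := by clear hi hj; revert i j; decide
  rcases h3 with h3 | h3 | h3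
  · exact h3.symm
  · subst h3; exact (key i hi hj).elim
  · subst h3; exact (key j hj hi).elim

end

/-! ### Edges and adjacency -/

section

variable {P : Finset Pt} {w x q : Pt} {p : Fin 3 → Pt}

theorem edge_comm (P : Finset Pt) (a b : Pt) : edge P a b = edge P b a :=
  Set.ext fun _ => And.comm

theorem Owners.mem_edge (h : Owners P w p) (k : Fin 3) : w ∈ edge P (p (k + 1)) (p (k + 2)) :=
  ⟨h.own _, h.own _⟩

/-- Seen from a vertex, the other points of an edge all lie in the same direction. -/
theorem same_side_of_mem_edge {a b y z : Pt} (hw : w ∈ vertices P) (hab : a ≠ b)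
    (hwe : w ∈ edge P a b) (hy : y ∈ edge P a b) (hz : z ∈ edge P a b) :
    0 ≤ ((y 1 - w 1) * (b 0 - a 0) - (y 0 - w 0) * (b 1 - a 1)) *
      ((z 1 - w 1) * (b 0 - a 0) - (z 0 - w 0) * (b 1 - a 1)) := by
  obtain ⟨c, hc, hca, hcb⟩ : ∃ c, IsOwner P w c ∧ c ≠ a ∧ c ≠ b := by
    obtain ⟨o, ho⟩ := mem_vertices_iff.1 hw
    by_contra! hall
    have h0 := hall _ (ho.own 0)
    have h1 := hall _ (ho.own 1)
    have h2 := hall _ (ho.own 2)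
    have n01 : o 0 ≠ o 1 := ho.inj.ne (by decide)
    have n02 : o 0 ≠ o 2 := ho.inj.ne (by decide)
    have n12 : o 1 ≠ o 2 := ho.inj.ne (by decide)
    grind
  have hD := det_ne_zero (hwe.1.dsq_eq hwe.2) (hwe.1.dsq_eq hc) hab hca.symm hcb.symm
  have hL := dsq_pos hab
  have key : ∀ x ∈ edge P a b,
      0 ≤ ((x 1 - w 1) * (b 0 - a 0) - (x 0 - w 0) * (b 1 - a 1)) * det a b c := by
    intro x hx
    have e1 : (x 0 - w 0) * (b 0 - a 0) + (x 1 - w 1) * (b 1 - a 1) = 0 := by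
      have := hx.1.dsq_eq hx.2
      have := hwe.1.dsq_eq hwe.2
      unfold dsq at *; linarith
    have e2 : 0 ≤ (x 0 - w 0) * (c 0 - a 0) + (x 1 - w 1) * (c 1 - a 1) := by
      have := hx.1.dsq_le hc.1
      have := hwe.1.dsq_eq hc
      unfold dsq at *; linarith
    have e3 : ((x 1 - w 1) * (b 0 - a 0) - (x 0 - w 0) * (b 1 - a 1)) * det a b c
        = dsq a b * ((x 0 - w 0) * (c 0 - a 0) + (x 1 - w 1) * (c 1 - a 1)) := by
      unfold dsq det
      linear_combination -((c 0 - a 0) * (b 0 - a 0) + (c 1 - a 1) * (b 1 - a 1)) * e1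
    rw [e3]; positivity
  have h2 : 0 < det a b c ^ 2 := by positivity
  have := mul_nonneg (key y hy) (key z hz)
  by_contra! hneg
  nlinarith [mul_neg_of_pos_of_neg h2 hneg]

theorem ne_along_edge {a b y : Pt} (hab : a ≠ b) (hw : w ∈ edge P a b) (hy : y ∈ edge P a b)
    (hne : y ≠ w) : (y 1 - w 1) * (b 0 - a 0) - (y 0 - w 0) * (b 1 - a 1) ≠ 0 := by
  intro h0
  have e1 : (y 0 - w 0) * (b 0 - a 0) + (y 1 - w 1) * (b 1 - a 1) = 0 := by
    have := hy.1.dsq_eq hy.2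
    have := hw.1.dsq_eq hw.2
    unfold dsq at *; linarith
  have hL := (dsq_pos hab).ne'
  refine hne (pt_ext
    (sub_eq_zero.1 ((mul_eq_zero.1 (?_ : (y 0 - w 0) * dsq a b = 0)).resolve_right hL))
    (sub_eq_zero.1 ((mul_eq_zero.1 (?_ : (y 1 - w 1) * dsq a b = 0)).resolve_right hL)))
  · unfold dsq; linear_combination (b 0 - a 0) * e1 - (b 1 - a 1) * h0
  · unfold dsq; linear_combination (b 1 - a 1) * e1 + (b 0 - a 0) * h0

/-- An edge has at most two vertices. -/
theorem eq_of_mem_edge {a b y z : Pt} (hab : a ≠ b) (hw : w ∈ vertices P) (hy : y ∈ vertices P)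
    (hz : z ∈ vertices P) (hwe : w ∈ edge P a b) (hye : y ∈ edge P a b) (hze : z ∈ edge P a b)
    (hyw : y ≠ w) (hzw : z ≠ w) : y = z := by
  by_contra hne
  have s1 := same_side_of_mem_edge hw hab hwe hye hze
  have s2 := same_side_of_mem_edge hy hab hye hwe hze
  have s3 := same_side_of_mem_edge hz hab hze hwe hye
  have n1 := ne_along_edge hab hwe hye hyw
  have n2 := ne_along_edge hab hwe hze hzw
  have n3 := ne_along_edge hab hye hze (Ne.symm hne)
  set A := (y 1 - w 1) * (b 0 - a 0) - (y 0 - w 0) * (b 1 - a 1) with hA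
  set B := (z 1 - w 1) * (b 0 - a 0) - (z 0 - w 0) * (b 1 - a 1) with hB
  have r1 : (w 1 - y 1) * (b 0 - a 0) - (w 0 - y 0) * (b 1 - a 1) = -A := by rw [hA]; ring
  have r2 : (z 1 - y 1) * (b 0 - a 0) - (z 0 - y 0) * (b 1 - a 1) = B - A := by rw [hA, hB]; ring
  have r3 : (w 1 - z 1) * (b 0 - a 0) - (w 0 - z 0) * (b 1 - a 1) = -B := by rw [hB]; ring
  have r4 : (y 1 - z 1) * (b 0 - a 0) - (y 0 - z 0) * (b 1 - a 1) = A - B := by rw [hA, hB]; ring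
  rw [r1, r2] at s2
  rw [r3, r4] at s3
  rw [r2] at n3
  have h1 : 0 < A * B := lt_of_le_of_ne s1 (mul_ne_zero n1 n2).symm
  have h2 : 0 < (B - A) ^ 2 := by positivity
  linarith [mul_nonneg s2 s3, mul_pos h1 h2]

theorem edge_eq_of_owners (hP : NoFourCocircular P) (h : Owners P w p) {a b : Pt} (hab : a ≠ b)
    (hw : w ∈ edge P a b) : ∃ k, edge P a b = edge P (p (k + 1)) (p (k + 2)) := by
  obtain ⟨i, rfl⟩ := h.eq_of_isOwner hP hw.1
  obtain ⟨j, rfl⟩ := h.eq_of_isOwner hP hw.2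
  have hij : i ≠ j := fun e => hab (by rw [e])
  have : ∃ k, (i = k + 1 ∧ j = k + 2) ∨ (j = k + 1 ∧ i = k + 2) := by
    clear hab hw; revert i j; decide
  obtain ⟨k, ⟨rfl, rfl⟩ | ⟨rfl, rfl⟩⟩ := this
  · exact ⟨k, rfl⟩
  · exact ⟨k, edge_comm _ _ _⟩

theorem Owners.chord_ne (h : Owners P w p) (k : Fin 3) : p (k + 1) ≠ p (k + 2) :=
  h.inj.ne (by revert k; decide)

theorem adj_of_mem_edge (h : Owners P w p) {y : Pt} (hy : y ∈ vertices P) (hne : y ≠ w)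
    {k : Fin 3} (he : y ∈ edge P (p (k + 1)) (p (k + 2))) : (graph P).Adj w y :=
  ⟨hne.symm, h.mem_vertices, hy, _, _, h.chord_ne k, h.mem_edge k, he⟩

theorem exists_mem_edge_of_adj (hP : NoFourCocircular P) (h : Owners P w p) {y : Pt}
    (ha : (graph P).Adj w y) : ∃ k, y ∈ edge P (p (k + 1)) (p (k + 2)) := by
  obtain ⟨_, _, _, a, b, hab, hw, hy⟩ := ha
  obtain ⟨k, hk⟩ := edge_eq_of_owners hP h hab hw
  exact ⟨k, hk ▸ hy⟩

/-- Adjacent vertices different from `w` lie in the same sector at `w`: the diagram falls apart when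
`w` is removed. -/
theorem sector_eq_of_adj (h : Owners P w p) {x y : Pt} (ha : (graph P).Adj x y) (hx : x ≠ w)
    (hy : y ≠ w) : sector w p x = sector w p y := by
  obtain ⟨hxy, hxv, hyv, a, b, hab, hxe, hye⟩ := ha
  have key : ∀ e, IsOwner P x e → IsOwner P y e → ¬ IsOwner P w e →
      sector w p x = sector w p y := by
    intro e hex hey hew
    exact h.chord_disjoint hex.1
      (h.chord_sector_neg hex.1 hew fun k => hex.dsq_le (h.own k).1)
      (h.chord_sector_neg hex.1 hew fun k => hey.dsq_le (h.own k).1)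
  by_cases hwa : IsOwner P w a
  · by_cases hwb : IsOwner P w b
    · exact (hxy (eq_of_mem_edge hab h.mem_vertices hxv hyv ⟨hwa, hwb⟩ hxe hye hx hy)).elim
    · exact key b hxe.2 hye.2 hwb
  · exact key a hxe.1 hye.1 hwa

/-- The vertex at the other end of the edge opposite to the `k`-th owner lies in the `k`-th
sector. -/
theorem sector_of_mem_edge (h : Owners P w p) {y : Pt} (hy : y ∈ vertices P) (hne : y ≠ w)
    {k : Fin 3} (he : y ∈ edge P (p (k + 1)) (p (k + 2))) : sector w p y = k := by
  obtain ⟨e, hey, hew⟩ := exists_not_isOwner hy hne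
  have h1 := h.chord_sector_neg hey.1 hew fun k => hey.dsq_le (h.own k).1
  refine h.chord_disjoint hey.1 h1 ?_
  have hD : det (p (k + 1)) (p (k + 2)) (p k) ≠ 0 :=
    h.det_ne_zero (by clear he; revert k; decide) (by clear he; revert k; decide)
      (by clear he; revert k; decide)
  unfold chord
  have d1 := (h.own (k + 1)).dsq_lt hey.1 hew
  have d2 := he.1.dsq_eq hey
  have d3 := he.1.dsq_eq he.2
  have d4 := h.dsq_eq (k + 1) (k + 2)
  have d5 := h.dsq_eq (k + 1) k
  have d6 := he.1.dsq_le (h.own k).1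
  have hL := dsq_pos (h.chord_ne k)
  generalize p (k + 1) = a at *
  generalize p (k + 2) = b at *
  generalize p k = c at *
  have e1 : (y 0 - w 0) * (b 0 - a 0) + (y 1 - w 1) * (b 1 - a 1) = 0 := by
    unfold dsq at *; linarith
  have e2 : (y 0 - w 0) * (e 0 - a 0) + (y 1 - w 1) * (e 1 - a 1) < 0 := by
    unfold dsq at *; linarith
  have e3 : 0 ≤ (y 0 - w 0) * (c 0 - a 0) + (y 1 - w 1) * (c 1 - a 1) := by
    unfold dsq at *; linarith
  -- `y - w` is a multiple of the normal of the chord; `n` is the factor times `dsq a b`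
  set n := (y 1 - w 1) * (b 0 - a 0) - (y 0 - w 0) * (b 1 - a 1) with hn
  have g : ∀ z : Pt, n * det a b z
      = dsq a b * ((y 0 - w 0) * (z 0 - a 0) + (y 1 - w 1) * (z 1 - a 1)) := by
    intro z
    unfold dsq det
    linear_combination -((z 0 - a 0) * (b 0 - a 0) + (z 1 - a 1) * (b 1 - a 1)) * e1
  have ge : n * det a b e < 0 := by rw [g]; exact mul_neg_of_pos_of_neg hL e2
  have gc : 0 < n * det a b c := by
    refine lt_of_le_of_ne (by rw [g]; positivity) (Ne.symm (mul_ne_zero ?_ hD))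
    rintro h0; rw [h0] at ge; simp at ge
  by_contra! hc
  nlinarith [mul_pos gc (neg_pos.2 ge), mul_nonneg (sq_nonneg n) hc]

/-! ### Walking along an edge to the next vertex -/

/-- Finitely many affine functions that are nonnegative at `0`, one of them decreasing: at some time
the first of them reaches `0`. -/
theorem exists_first_zero {ι : Type*} (I : Finset ι) (c s : ι → ℝ) (hc : ∀ i ∈ I, 0 ≤ c i)
    (hs : ∃ i ∈ I, s i < 0) :
    ∃ t, 0 ≤ t ∧ (∀ i ∈ I, 0 ≤ c i + t * s i) ∧ ∃ i ∈ I, s i < 0 ∧ c i + t * s i = 0 := by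
  obtain ⟨i₀, hi₀, hs₀⟩ := hs
  obtain ⟨i, hi, hmin⟩ := (I.filter fun i => s i < 0).exists_min_image (fun i => c i / -s i)
    ⟨i₀, Finset.mem_filter.2 ⟨hi₀, hs₀⟩⟩
  obtain ⟨hiI, hsi⟩ := Finset.mem_filter.1 hi
  have ht : 0 ≤ c i / -s i := div_nonneg (hc i hiI) (by linarith)
  refine ⟨c i / -s i, ht, fun j hj => ?_, i, hiI, hsi, ?_⟩
  · by_cases hsj : s j < 0
    · have := hmin j (Finset.mem_filter.2 ⟨hj, hsj⟩)
      rw [le_div_iff₀ (by linarith)] at this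
      linarith
    · have := mul_nonneg ht (not_lt.1 hsj)
      linarith [hc j hj]
  · have := hsi.ne
    field_simp; ring

/-- The point `x + t • m`. -/
noncomputable def walk (x : Pt) (m0 m1 t : ℝ) : Pt := !₂[x 0 + t * m0, x 1 + t * m1]

theorem dsq_walk_sub (x a b : Pt) (m0 m1 t : ℝ) :
    dsq (walk x m0 m1 t) a - dsq (walk x m0 m1 t) b
      = (dsq x a - dsq x b) + t * (2 * (m0 * (b 0 - a 0) + m1 * (b 1 - a 1))) := by
  have h0 : (walk x m0 m1 t) 0 = x 0 + t * m0 := rfl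
  have h1 : (walk x m0 m1 t) 1 = x 1 + t * m1 := rfl
  unfold dsq; rw [h0, h1]; ring

/-- Starting from a point owned by `a`, a walk in a direction that is not in favour of `a` ends at
a point that `a` shares with a new owner. -/
theorem exists_walk {a e : Pt} (ha : IsOwner P x a) (m0 m1 : ℝ) (he : e ∈ P)
    (hs : m0 * (e 0 - a 0) + m1 * (e 1 - a 1) < 0) :
    ∃ t, 0 ≤ t ∧ IsOwner P (walk x m0 m1 t) a ∧
      ∃ b, IsOwner P (walk x m0 m1 t) b ∧ m0 * (b 0 - a 0) + m1 * (b 1 - a 1) < 0 := by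
  obtain ⟨t, ht, hall, b, hb, hsb, hb0⟩ := exists_first_zero P (fun b => dsq x a - dsq x b)
    (fun b => 2 * (m0 * (b 0 - a 0) + m1 * (b 1 - a 1)))
    (fun b hb => sub_nonneg.2 (ha.dsq_le hb)) ⟨e, he, by linarith⟩
  have hown : IsOwner P (walk x m0 m1 t) a := isOwner_iff.2 ⟨ha.1, fun b hb => by
    have := hall b hb
    rw [← dsq_walk_sub] at this; linarith⟩
  refine ⟨t, ht, hown, b, hown.of_dsq_eq hb ?_, by linarith⟩
  rw [← dsq_walk_sub] at hb0; linarith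

/-- The height over `w` of the upper envelope of the paraboloids of the points of `P`, measured from
the paraboloid of `o`.  It is piecewise affine along the edges. -/
noncomputable def height (P : Finset Pt) (o w : Pt) : ℝ := dF w P ^ 2 - dsq w o

theorem IsOwner.height_eq {a : Pt} (h : IsOwner P w a) (o : Pt) :
    height P o w = dsq w a - dsq w o := by
  rw [height, ← h.2, dist_eq_sqrt_dsq, Real.sq_sqrt (dsq_nonneg _ _)]

/-- If some point of `P` lies beyond a chord at `w`, then the edge that bisects the chord leads to
another vertex, and the height over every point beyond the chord decreases on the way. -/
theorem Owners.exists_next (hP : NoFourCocircular P) (h : Owners P w p) {e : Pt} (he : e ∈ P)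
    {j : Fin 3}
    (hc : chord p j e < 0) :
    ∃ y, (graph P).Adj w y ∧ ∀ o, chord p j o < 0 → height P o y < height P o w := by
  set a := p (j + 1) with ha
  set b := p (j + 2) with hb
  set D := det a b (p j) with hD
  -- `m` is normal to the chord, pointing away from the half-plane beyond it
  set m0 := -(D * (b 1 - a 1)) with hm0
  set m1 := D * (b 0 - a 0) with hm1
  have hslope : ∀ z : Pt, m0 * (z 0 - a 0) + m1 * (z 1 - a 1) = chord p j z := by
    intro z; rw [hm0, hm1, chord, ← ha, ← hb, ← hD]; unfold det; ring
  obtain ⟨t, ht, hya, c, hyc, hsc⟩ := exists_walk (h.own (j + 1)) m0 m1 he (by rwa [hslope])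
  rw [← ha] at hya
  rw [hslope] at hsc
  set y := walk w m0 m1 t with hy
  have hyo : ∀ z, dsq y a - dsq y z = (dsq w a - dsq w z) + t * (2 * chord p j z) := fun z => by
    rw [hy, dsq_walk_sub, hslope]
  have cb : chord p j b = 0 := by
    have : det a b b = 0 := by unfold det; ring
    rw [chord, ← ha, ← hb, this, zero_mul]
  have ca : chord p j a = 0 := by
    have : det a b a = 0 := by unfold det; ring
    rw [chord, ← ha, ← hb, this, zero_mul]
  have hyb : IsOwner P y b := by
    refine hya.of_dsq_eq (h.own _).1 ?_
    have := hyo b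
    rw [cb, h.dsq_eq (j + 1) (j + 2)] at this; linarith
  have htpos : 0 < t := by
    refine lt_of_le_of_ne ht ?_
    rintro rfl
    -- the new owner `c` would be one of the owners of `w`, none of which is beyond the chord
    have h0 := hyo c
    rw [hyc.dsq_eq hya, sub_self, zero_mul, add_zero] at h0
    obtain ⟨k, rfl⟩ := h.eq_of_isOwner hP
      ((h.own (j + 1)).of_dsq_eq hyc.1 (sub_eq_zero.1 h0.symm).le)
    have hcc : 0 ≤ chord p j (p j) := mul_self_nonneg _
    have hk : k = j ∨ k = j + 1 ∨ k = j + 2 := by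
      clear * -
      revert k j; decide
    rcases hk with rfl | rfl | rfl <;> linarith
  have hyv : y ∈ vertices P :=
    mem_vertices_of_isOwner hya hyb hyc (h.chord_ne j) (by rintro e; rw [← e] at hsc; linarith)
      (by rintro e; rw [← e] at hsc; linarith)
  have hyh : ∀ o, chord p j o < 0 → height P o y < height P o w := by
    intro o ho
    rw [hya.height_eq, (h.own (j + 1)).height_eq, ← ha, hyo]
    nlinarith [mul_pos_of_neg_of_neg (neg_neg_of_pos htpos) ho]
  refine ⟨y, adj_of_mem_edge h hyv (fun e => ?_) (k := j) ⟨hya, hyb⟩, hyh⟩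
  have := hyh _ hc
  rw [e] at this
  exact lt_irrefl _ this

end

/-! ### Connectivity of the diagram -/

section

variable {P : Finset Pt} {w x q : Pt} {p : Fin 3 → Pt}

/-- `y` can be reached from `x` along edges of the diagram between vertices of `S`. -/
def Linked (P : Finset Pt) (S : Set Pt) : Pt → Pt → Prop :=
  Relation.ReflTransGen fun a b => a ∈ S ∧ b ∈ S ∧ (graph P).Adj a b

/-- The vertices in `S` induce a connected (or empty) subgraph of the diagram. -/
def Conn (P : Finset Pt) (S : Set Pt) : Prop := ∀ x ∈ S, ∀ y ∈ S, Linked P S x y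

theorem Linked.symm {S : Set Pt} {x y : Pt} (h : Linked P S x y) : Linked P S y x := by
  induction h with
  | refl => exact Relation.ReflTransGen.refl
  | tail _ h2 ih => exact Relation.ReflTransGen.head ⟨h2.2.1, h2.1, h2.2.2.symm⟩ ih

/-- If the height over `o` can be decreased from every vertex outside of `A`, then every vertex is
linked to one in `A`. -/
theorem exists_linked_of_descent (hfin : (vertices P).Finite) (o : Pt) (A : Set Pt)
    (H : ∀ w ∈ vertices P, w ∉ A → ∃ y, (graph P).Adj w y ∧ height P o y < height P o w)
    (hw : w ∈ vertices P) : ∃ x ∈ A, x ∈ vertices P ∧ Linked P (vertices P) w x := by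
  by_contra hbad
  let B := {w ∈ vertices P | ¬ ∃ x ∈ A, x ∈ vertices P ∧ Linked P (vertices P) w x}
  obtain ⟨v, ⟨hv, hvb⟩, hmin⟩ := Set.exists_min_image B (height P o)
    (hfin.subset fun _ h => h.1) ⟨w, hw, hbad⟩
  have hvA : v ∉ A := fun h => hvb ⟨v, h, hv, Relation.ReflTransGen.refl⟩
  obtain ⟨y, hy, hlt⟩ := H v hv hvA
  have hyv : y ∈ vertices P := hy.2.2.1
  have hyB : y ∉ B := fun h => absurd (hmin y h) (not_le.2 hlt)
  have : ∃ x ∈ A, x ∈ vertices P ∧ Linked P (vertices P) y x := by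
    by_contra hn; exact hyB ⟨hyv, hn⟩
  obtain ⟨x, hx, hxv, hl⟩ := this
  exact hvb ⟨x, hx, hxv, Relation.ReflTransGen.head ⟨hv, hyv, hy⟩ hl⟩

/-- A point with a nonempty closed region owns a vertex, if there are vertices at all. -/
theorem exists_vertex_of_isOwner (hP : NoFourCocircular P) (hfin : (vertices P).Finite)
    (hne : (vertices P).Nonempty) {e : Pt} (he : IsOwner P q e) :
    ∃ x ∈ vertices P, IsOwner P x e := by
  obtain ⟨w, hw⟩ := hne
  obtain ⟨x, hx, hxv, -⟩ := exists_linked_of_descent hfin e {x | IsOwner P x e} (fun w hw hwe => by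
    obtain ⟨p, hp⟩ := mem_vertices_iff.1 hw
    have hc := hp.chord_sector_neg (q := q) he.1 hwe fun k => he.dsq_le (hp.own k).1
    obtain ⟨y, hy, hyh⟩ := hp.exists_next hP he.1 hc
    exact ⟨y, hy, hyh e hc⟩) hw
  exact ⟨x, hxv, hx⟩

/-- The centre of gravity of three points. -/
noncomputable def gravity (a : Fin 3 → Pt) : Pt :=
  !₂[(a 0 0 + a 1 0 + a 2 0) / 3, (a 0 1 + a 1 1 + a 2 1) / 3]

theorem chord_gravity (p a : Fin 3 → Pt) (j : Fin 3) :
    3 * chord p j (gravity a) = chord p j (a 0) + chord p j (a 1) + chord p j (a 2) := by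
  have h0 : gravity a 0 = (a 0 0 + a 1 0 + a 2 0) / 3 := rfl
  have h1 : gravity a 1 = (a 0 1 + a 1 1 + a 2 1) / 3 := rfl
  unfold chord det
  rw [h0, h1]; ring

/-- A vertex `w` whose triangle of owners contains the centre of gravity of the owners of a vertex
`x` is `x`.  Both `w` and `x` would minimize the height over that point. -/
theorem eq_of_chord_gravity_nonneg {a : Fin 3 → Pt} (h : Owners P w p) (hx : Owners P x a)
    (hc : ∀ j, 0 ≤ chord p j (gravity a)) : w = x := by
  set o := gravity a with ho
  have h0 : o 0 = (a 0 0 + a 1 0 + a 2 0) / 3 := rfl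
  have h1 : o 1 = (a 0 1 + a 1 1 + a 2 1) / 3 := rfl
  have hD : det (p 0) (p 1) (p 2) ≠ 0 := h.det_ne_zero (by decide) (by decide) (by decide)
  have hD2 : 0 < det (p 0) (p 1) (p 2) ^ 2 := by positivity
  set D := det (p 0) (p 1) (p 2) with hDdef
  have c0 : chord p 0 o = det (p 1) (p 2) o * D := by
    change det (p 1) (p 2) o * det (p 1) (p 2) (p 0) = _
    rw [hDdef]; unfold det; ring
  have c1 : chord p 1 o = det (p 2) (p 0) o * D := by
    change det (p 2) (p 0) o * det (p 2) (p 0) (p 1) = _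
    rw [hDdef]; unfold det; ring
  have c2 : chord p 2 o = det (p 0) (p 1) o * D := rfl
  -- the barycentric combination of the squared distances differs from `dsq · o` by a constant
  have bary : ∀ y z : Pt, chord p 0 o * dsq y (p 0) + chord p 1 o * dsq y (p 1)
        + chord p 2 o * dsq y (p 2) - D ^ 2 * dsq y o
      = chord p 0 o * dsq z (p 0) + chord p 1 o * dsq z (p 1)
        + chord p 2 o * dsq z (p 2) - D ^ 2 * dsq z o := by
    intro y z
    rw [c0, c1, c2, hDdef]; unfold dsq det; ring
  have csum : chord p 0 o + chord p 1 o + chord p 2 o = D ^ 2 := by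
    rw [c0, c1, c2, hDdef]; unfold det; ring
  have mean : ∀ y z : Pt, (dsq y (a 0) + dsq y (a 1) + dsq y (a 2)) - 3 * dsq y o
      = (dsq z (a 0) + dsq z (a 1) + dsq z (a 2)) - 3 * dsq z o := by
    intro y z; unfold dsq; rw [h0, h1]; ring
  have B := bary w x
  have M := mean w x
  rw [h.dsq_eq 1 0, h.dsq_eq 2 0] at B
  rw [hx.dsq_eq 1 0, hx.dsq_eq 2 0] at M
  have up : ∀ k, dsq x (p k) ≤ dsq x (a 0) := fun k => (hx.own 0).dsq_le (h.own k).1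
  have lo : ∀ k, dsq w (a k) ≤ dsq w (p 0) := fun k => (h.own 0).dsq_le (hx.own k).1
  have B' : D ^ 2 * (dsq w (p 0) - dsq w o) ≤ D ^ 2 * (dsq x (a 0) - dsq x o) := by
    have u0 := mul_le_mul_of_nonneg_left (up 0) (hc 0)
    have u1 := mul_le_mul_of_nonneg_left (up 1) (hc 1)
    have u2 := mul_le_mul_of_nonneg_left (up 2) (hc 2)
    have e1 : chord p 0 o * dsq w (p 0) + chord p 1 o * dsq w (p 0) + chord p 2 o * dsq w (p 0)
      = D ^ 2 * dsq w (p 0) := by rw [← csum]; ring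
    have e2 : chord p 0 o * dsq x (a 0) + chord p 1 o * dsq x (a 0) + chord p 2 o * dsq x (a 0)
      = D ^ 2 * dsq x (a 0) := by rw [← csum]; ring
    linarith
  have B2 := le_of_mul_le_mul_left B' hD2
  have ow : ∀ k, IsOwner P w (a k) := fun k => (h.own 0).of_dsq_eq (hx.own k).1 (by
    fin_cases k
    · simp only [Fin.zero_eta]; linarith [lo 0, lo 1, lo 2]
    · simp only [Fin.mk_one]; linarith [lo 0, lo 1, lo 2]
    · simp only [Fin.reduceFinMk]; linarith [lo 0, lo 1, lo 2])
  exact eq_of_equidistant (hx.det_ne_zero (i := 0) (j := 1) (k := 2) (by decide) (by decide)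
    (by decide)) ((ow 0).dsq_eq (ow 1)) ((ow 0).dsq_eq (ow 2)) (hx.dsq_eq 0 1) (hx.dsq_eq 0 2)

theorem conn_vertices (hP : NoFourCocircular P) (hfin : (vertices P).Finite) :
    Conn P (vertices P) := by
  intro w hw x hx
  obtain ⟨a, ha⟩ := mem_vertices_iff.1 hx
  obtain ⟨y, hy, -, hl⟩ := exists_linked_of_descent hfin (gravity a) {x} (fun w hw hwx => by
    obtain ⟨p, hp⟩ := mem_vertices_iff.1 hw
    obtain ⟨j, hj⟩ : ∃ j, chord p j (gravity a) < 0 := by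
      by_contra! hc
      exact hwx (eq_of_chord_gravity_nonneg hp ha hc)
    -- a half-plane that contains the centre of gravity contains one of the three points
    obtain ⟨k, hk⟩ : ∃ k, chord p j (a k) < 0 := by
      by_contra! hc
      linarith [chord_gravity p a j, hc 0, hc 1, hc 2]
    obtain ⟨y, hy, hyh⟩ := hp.exists_next hP (ha.own k).1 hk
    exact ⟨y, hy, hyh _ hj⟩) hw
  rw [Set.mem_singleton_iff] at hy
  exact hy ▸ hl

/-! ### Components and branches -/

theorem mem_component_iff {S : Set Pt} {y : Pt} : x ∈ component P S w y ↔
    y ∈ S \ {w} ∧ x ∈ S \ {w} ∧ Linked P (S \ {w}) y x := by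
  constructor
  · rintro ⟨hy, hx, h⟩
    refine ⟨hy, hx, ?_⟩
    rw [SimpleGraph.reachable_iff_reflTransGen] at h
    have : ∀ z, Relation.ReflTransGen ((graph P).induce (S \ {w})).Adj ⟨y, hy⟩ z →
        Linked P (S \ {w}) y z := by
      intro z hz
      induction hz with
      | refl => exact Relation.ReflTransGen.refl
      | tail _ h2 ih => exact ih.tail ⟨Subtype.prop _, Subtype.prop _, h2⟩
    exact this _ h
  · rintro ⟨hy, hx, h⟩
    refine ⟨hy, hx, ?_⟩
    have : ∀ z, Linked P (S \ {w}) y z → ∃ hz : z ∈ S \ {w},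
        ((graph P).induce (S \ {w})).Reachable ⟨y, hy⟩ ⟨z, hz⟩ := by
      intro z hz
      induction hz with
      | refl => exact ⟨hy, .refl _⟩
      | tail _ hbc ih =>
        obtain ⟨hb, hr⟩ := ih
        refine ⟨hbc.2.1, hr.trans (SimpleGraph.Adj.reachable ?_)⟩
        exact hbc.2.2
    exact (this x h).2

/-- A set that no edge of `S` avoiding `w` leaves contains the components of its points. -/
theorem component_subset {S A : Set Pt} {y : Pt} (hy : y ∈ A)
    (hA : ∀ a ∈ A, ∀ b ∈ S, a ∈ S → a ≠ w → b ≠ w → (graph P).Adj a b → b ∈ A) :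
    component P S w y ⊆ A := by
  intro x hx
  obtain ⟨-, -, h⟩ := mem_component_iff.1 hx
  induction h with
  | refl => exact hy
  | tail h1 h2 ih =>
    refine hA _ (ih (mem_component_iff.2 ⟨(mem_component_iff.1 hx).1, h2.1, h1⟩)) _ h2.2.1.1
      h2.1.1 h2.1.2 h2.2.1.2 h2.2.2

theorem component_conn {S : Set Pt} {y : Pt} : Conn P (component P S w y) := by
  have key : ∀ x ∈ component P S w y, Linked P (component P S w y) y x := by
    intro x hx
    obtain ⟨hy, -, h⟩ := mem_component_iff.1 hx
    induction h with
    | refl => exact Relation.ReflTransGen.refl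
    | tail h1 h2 ih =>
      have hb := mem_component_iff.2 ⟨hy, h2.1, h1⟩
      exact (ih hb).tail ⟨hb, hx, h2.2.2⟩
  intro a ha b hb
  exact (key a ha).symm.trans (key b hb)

theorem component_closed {S : Set Pt} {y z : Pt} (hx : x ∈ component P S w y) (hz : z ∈ S)
    (hzw : z ≠ w) (h : (graph P).Adj x z) : z ∈ component P S w y := by
  obtain ⟨hy, hxS, hl⟩ := mem_component_iff.1 hx
  exact mem_component_iff.2 ⟨hy, ⟨hz, hzw⟩, hl.tail ⟨hxS, ⟨hz, hzw⟩, h⟩⟩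

theorem self_mem_component {S : Set Pt} {y : Pt} (hy : y ∈ S) (hyw : y ≠ w) :
    y ∈ component P S w y :=
  mem_component_iff.2 ⟨⟨hy, hyw⟩, ⟨hy, hyw⟩, Relation.ReflTransGen.refl⟩

theorem branch_subset {S : Set Pt} {a b : Pt} : branch P S w a b ⊆ S \ {w} := by
  rintro x ⟨y, -, hx⟩
  exact (mem_component_iff.1 hx).2.1

section branch

variable {S : Set Pt}

theorem branch_eq_component (h : Owners P w p) (hS : S ⊆ vertices P) {k : Fin 3} {y : Pt}
    (hy : y ∈ S) (hyw : y ≠ w) (hye : y ∈ edge P (p (k + 1)) (p (k + 2))) :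
    branch P S w (p (k + 1)) (p (k + 2)) = component P S w y := by
  ext x
  constructor
  · rintro ⟨z, hz, hx⟩
    obtain ⟨hzS, -, -⟩ := mem_component_iff.1 hx
    rwa [eq_of_mem_edge (h.chord_ne k) h.mem_vertices (hS hy) (hS hzS.1) (h.mem_edge k) hye hz hyw
      hzS.2]
  · exact fun hx => ⟨y, hye, hx⟩

theorem branch_eq_empty_or (h : Owners P w p) (hS : S ⊆ vertices P) (k : Fin 3) :
    branch P S w (p (k + 1)) (p (k + 2)) = ∅ ∨
      ∃ y ∈ S, y ≠ w ∧ y ∈ edge P (p (k + 1)) (p (k + 2)) ∧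
        branch P S w (p (k + 1)) (p (k + 2)) = component P S w y := by
  rcases (branch P S w (p (k + 1)) (p (k + 2))).eq_empty_or_nonempty with he | ⟨x, y, hy, hx⟩
  · exact .inl he
  · obtain ⟨hyS, -, -⟩ := mem_component_iff.1 hx
    exact .inr ⟨y, hyS.1, hyS.2, hy, branch_eq_component h hS hyS.1 hyS.2 hy⟩

theorem branch_conn (h : Owners P w p) (hS : S ⊆ vertices P) (k : Fin 3) :
    Conn P (branch P S w (p (k + 1)) (p (k + 2))) := by
  rcases branch_eq_empty_or h hS k with he | ⟨y, -, -, -, he⟩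
  · rw [he]; intro x hx; exact hx.elim
  · rw [he]; exact component_conn

theorem two_mul_ncard_branch_le (h : Owners P w p) (hS : S ⊆ vertices P) (hc : IsCentroid P S w)
    (k : Fin 3) : 2 * (branch P S w (p (k + 1)) (p (k + 2))).ncard ≤ S.ncard := by
  rcases branch_eq_empty_or h hS k with he | ⟨y, hy, hyw, -, he⟩
  · rw [he]; simp
  · rw [he]; exact hc.2 y ⟨hy, hyw⟩

theorem sector_of_mem_component (h : Owners P w p) {y : Pt}
    (hx : x ∈ component P S w y) : sector w p x = sector w p y := by
  obtain ⟨hy, hx', hl⟩ := mem_component_iff.1 hx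
  clear hx
  induction hl with
  | refl => rfl
  | tail h1 h2 ih =>
    rw [← ih h2.1, sector_eq_of_adj h h2.2.2 h2.1.2 h2.2.1.2]

theorem sector_of_mem_branch (h : Owners P w p) (hS : S ⊆ vertices P) {k : Fin 3}
    (hx : x ∈ branch P S w (p (k + 1)) (p (k + 2))) : sector w p x = k := by
  obtain ⟨y, hy, hx⟩ := hx
  have hyS := (mem_component_iff.1 hx).1
  rw [sector_of_mem_component h hx, sector_of_mem_edge h (hS hyS.1) hyS.2 hy]

/-- In a connected part of the diagram, every vertex is in the branch of its sector. -/
theorem mem_branch_sector (hP : NoFourCocircular P) (h : Owners P w p) (hS : S ⊆ vertices P)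
    (hconn : Conn P S) (hw : w ∈ S) (hx : x ∈ S) (hxw : x ≠ w) :
    x ∈ branch P S w (p (sector w p x + 1)) (p (sector w p x + 2)) := by
  -- cut the path from `w` to `x` where it leaves `w` for the last time
  have key : ∀ a, Linked P S a x → (a ∈ S \ {w} ∧ Linked P (S \ {w}) a x) ∨
      ∃ y ∈ S \ {w}, (graph P).Adj w y ∧ Linked P (S \ {w}) y x := by
    intro a ha
    induction ha using Relation.ReflTransGen.head_induction_on with
    | refl => exact .inl ⟨⟨hx, hxw⟩, Relation.ReflTransGen.refl⟩
    | head hab _ ih =>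
      rename_i a b _
      rcases ih with ⟨hb, hl⟩ | ih
      · by_cases haw : a = w
        · exact .inr ⟨b, hb, haw ▸ hab.2.2, hl⟩
        · exact .inl ⟨⟨hab.1, haw⟩, Relation.ReflTransGen.head ⟨⟨hab.1, haw⟩, hb, hab.2.2⟩ hl⟩
      · exact .inr ih
  obtain ⟨y, hy, hadj, hl⟩ : ∃ y ∈ S \ {w}, (graph P).Adj w y ∧ Linked P (S \ {w}) y x := by
    rcases key w (hconn w hw x hx) with ⟨h, -⟩ | h
    · exact (h.2 rfl).elim
    · exact h
  obtain ⟨k, hk⟩ := exists_mem_edge_of_adj hP h hadj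
  have hb : x ∈ branch P S w (p (k + 1)) (p (k + 2)) :=
    ⟨y, hk, mem_component_iff.2 ⟨hy, ⟨hx, hxw⟩, hl⟩⟩
  rw [sector_of_mem_branch h hS hb]
  exact hb

/-- The step of a search: if a point `e` of `P` is at least as far from `q` as the owners of `w`,
and owns a vertex of `S`, then it is an owner of `w`, or owns a vertex in the branch of the sector
of `q`. -/
theorem search_step (hP : NoFourCocircular P) (h : Owners P w p) (hS : S ⊆ vertices P)
    (hconn : Conn P S) (hw : w ∈ S) {e : Pt} (hx : x ∈ S) (he : IsOwner P x e)
    (hq : ∀ k, dsq q (p k) ≤ dsq q e) (hne : ∀ k, p k ≠ e) :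
    ∃ y ∈ branch P S w (p (sector w p q + 1)) (p (sector w p q + 2)), IsOwner P y e := by
  have hwe : ¬ IsOwner P w e := fun hwe => by
    obtain ⟨k, hk⟩ := h.eq_of_isOwner hP hwe
    exact hne k hk.symm
  have hxw : x ≠ w := by rintro rfl; exact hwe he
  have hs : sector w p x = sector w p q := h.chord_disjoint he.1
    (h.chord_sector_neg he.1 hwe fun k => he.dsq_le (h.own k).1) (h.chord_sector_neg he.1 hwe hq)
  have := mem_branch_sector hP h hS hconn hw hx hxw
  rw [hs] at this
  exact ⟨x, this, he⟩

end branch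

/-! ### Regions -/

theorem isOwner_of_mem_freg (hp : q ∈ P) (hx : x ∈ freg P q) : IsOwner P x q :=
  isOwner_iff.2 ⟨hp, fun p' hp' => by
    by_cases h : p' = q
    · rw [h]
    · exact (dist_lt_iff.1 (hx p' hp' h)).le⟩

/-- Moving away from a farthest point of `P` leads into its region. -/
theorem IsOwner.walk_mem_freg {a : Pt} (h : IsOwner P x a) {t : ℝ} (ht : 0 < t) :
    walk x (x 0 - a 0) (x 1 - a 1) t ∈ freg P a := by
  intro b hb hne
  rw [dist_lt_iff, ← sub_pos, dsq_walk_sub]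
  have h1 := h.dsq_le hb
  have h2 := dsq_pos hne
  have : 0 < 2 * ((x 0 - a 0) * (b 0 - a 0) + (x 1 - a 1) * (b 1 - a 1)) := by
    unfold dsq at *; linarith
  have := mul_pos ht this
  linarith

theorem IsOwner.mem_closure_freg {a : Pt} (h : IsOwner P x a) : x ∈ closure (freg P a) := by
  have hcont : Continuous fun t : ℝ => walk x (x 0 - a 0) (x 1 - a 1) t := by
    unfold walk
    refine (PiLp.continuous_toLp 2 _).comp (continuous_pi fun i => ?_)
    fin_cases i <;> simp <;> fun_prop
  have h0 : walk x (x 0 - a 0) (x 1 - a 1) 0 = x :=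
    pt_ext (by simp [walk]) (by simp [walk])
  have ht : Filter.Tendsto (fun t : ℝ => walk x (x 0 - a 0) (x 1 - a 1) t)
      (nhdsWithin 0 (Set.Ioi 0)) (nhds x) := by
    have := hcont.tendsto 0
    rw [h0] at this
    exact this.mono_left nhdsWithin_le_nhds
  exact mem_closure_of_tendsto ht (Filter.eventually_of_mem self_mem_nhdsWithin
    fun t ht => h.walk_mem_freg ht)

theorem IsOwner.freg_nonempty {a : Pt} (h : IsOwner P x a) : (freg P a).Nonempty :=
  ⟨_, h.walk_mem_freg one_pos⟩

/-- The owners of three regions are not collinear: none of them lies between the other two. -/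
theorem det_ne_zero_of_freg {a b c : Pt} (ha : a ∈ P) (hb : b ∈ P) (hc : c ∈ P)
    (hab : a ≠ b) (hac : a ≠ c) (hbc : b ≠ c) (hfa : (freg P a).Nonempty)
    (hfb : (freg P b).Nonempty) (hfc : (freg P c).Nonempty) : det a b c ≠ 0 := by
  intro hD
  have hL := dsq_pos hab
  obtain ⟨r, hr0, hr1⟩ : ∃ r : ℝ, c 0 = a 0 + r * (b 0 - a 0) ∧ c 1 = a 1 + r * (b 1 - a 1) := by
    refine ⟨((c 0 - a 0) * (b 0 - a 0) + (c 1 - a 1) * (b 1 - a 1)) / dsq a b, ?_, ?_⟩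
    · field_simp
      unfold det at hD; unfold dsq; linear_combination -(b 1 - a 1) * hD
    · field_simp
      unfold det at hD; unfold dsq; linear_combination (b 0 - a 0) * hD
  have key : ∀ x : Pt, dsq x c = (1 - r) * dsq x a + r * dsq x b - r * (1 - r) * dsq a b := by
    intro x; unfold dsq; rw [hr0, hr1]; ring
  rcases le_total r 0 with hr | hr
  · obtain ⟨x, hx⟩ := hfa
    have h1 := dist_lt_iff.1 (hx b hb hab.symm)
    have h2 := dist_lt_iff.1 (hx c hc hac.symm)
    have := key x
    nlinarith [mul_nonneg (mul_nonneg (neg_nonneg.2 hr) (by linarith : 0 ≤ 1 - r)) hL.le,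
      mul_nonneg (neg_nonneg.2 hr) (sub_pos.2 h1).le]
  · rcases le_total r 1 with hr' | hr'
    · obtain ⟨x, hx⟩ := hfc
      have h1 := dist_lt_iff.1 (hx b hb hbc)
      have h2 := dist_lt_iff.1 (hx a ha hac)
      have := key x
      nlinarith [mul_nonneg (mul_nonneg hr (by linarith : 0 ≤ 1 - r)) hL.le,
        mul_nonneg hr (sub_pos.2 h1).le, mul_nonneg (sub_nonneg.2 hr') (sub_pos.2 h2).le]
    · obtain ⟨x, hx⟩ := hfb
      have h1 := dist_lt_iff.1 (hx a ha hab)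
      have h2 := dist_lt_iff.1 (hx c hc hbc.symm)
      have := key x
      nlinarith [mul_nonneg (mul_nonneg hr (sub_nonneg.2 hr')) hL.le,
        mul_nonneg (sub_nonneg.2 hr') (sub_pos.2 h1).le]

/-- A diagram with three regions has a vertex. -/
theorem vertices_nonempty_of_freg {a b c : Pt} (ha : a ∈ P) (hb : b ∈ P) (hc : c ∈ P)
    (hab : a ≠ b) (hac : a ≠ c) (hbc : b ≠ c) (hfa : (freg P a).Nonempty)
    (hfb : (freg P b).Nonempty) (hfc : (freg P c).Nonempty) : (vertices P).Nonempty := by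
  have hD := det_ne_zero_of_freg ha hb hc hab hac hbc hfa hfb hfc
  obtain ⟨x, hx⟩ := hfa
  have hxa := isOwner_of_mem_freg ha hx
  -- first walk to an edge of the region of `a`, towards the disadvantage of `a`
  obtain ⟨t, -, hya, d, hyd, hds⟩ := exists_walk hxa (a 0 - b 0) (a 1 - b 1) hb (by
    have := dsq_pos hab; unfold dsq at this; linarith)
  set y := walk x (a 0 - b 0) (a 1 - b 1) t
  have had : a ≠ d := by rintro rfl; simp at hds
  obtain ⟨e, he, hDe⟩ : ∃ e ∈ P, det a d e ≠ 0 := by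
    by_contra! hall
    have hb0 := hall b hb
    have hc0 := hall c hc
    unfold det at hb0 hc0 hD
    refine hD ?_
    have e0 : (d 0 - a 0) * ((b 0 - a 0) * (c 1 - a 1) - (b 1 - a 1) * (c 0 - a 0)) = 0 := by
      linear_combination (b 0 - a 0) * hc0 - (c 0 - a 0) * hb0
    have e1 : (d 1 - a 1) * ((b 0 - a 0) * (c 1 - a 1) - (b 1 - a 1) * (c 0 - a 0)) = 0 := by
      linear_combination (b 1 - a 1) * hc0 - (c 1 - a 1) * hb0
    by_contra hne
    exact had (pt_ext (sub_eq_zero.1 ((mul_eq_zero.1 e0).resolve_right hne)).symm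
      (sub_eq_zero.1 ((mul_eq_zero.1 e1).resolve_right hne)).symm)
  -- then walk along that edge
  set D := det a d e with hDdef
  have hslope : ∀ z : Pt, D * (d 1 - a 1) * (z 0 - a 0) + -(D * (d 0 - a 0)) * (z 1 - a 1)
      = -(D * det a d z) := by
    intro z; unfold det; ring
  obtain ⟨t', -, hza, f, hzf, hfs⟩ := exists_walk hya (D * (d 1 - a 1)) (-(D * (d 0 - a 0))) he (by
    rw [hslope, ← hDdef]
    have : 0 < D * D := mul_self_pos.2 hDe
    linarith)
  rw [hslope] at hfs
  have da : det a d a = 0 := by unfold det; ring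
  have dd : det a d d = 0 := by unfold det; ring
  set z := walk y (D * (d 1 - a 1)) (-(D * (d 0 - a 0))) t' with hz
  have hzd : IsOwner P z d := by
    refine hza.of_dsq_eq hyd.1 ?_
    have := dsq_walk_sub y a d (D * (d 1 - a 1)) (-(D * (d 0 - a 0))) t'
    rw [hslope, dd, hya.dsq_eq hyd, ← hz] at this
    linarith
  refine ⟨z, mem_vertices_of_isOwner hza hzd hzf had ?_ ?_⟩
  · rintro rfl; rw [da] at hfs; simp at hfs
  · rintro rfl; rw [dd] at hfs; simp at hfs

end

/-! ### The part of the memory that a query leaves intact -/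

section

variable {P : Finset Pt} {w x q : Pt} {p : Fin 3 → Pt}

/-- `s'` holds the same diagram as `s`: same sizes, coordinates and owners. -/
structure SameFeatures (s s' : State) : Prop where
  nv0 : s'.nv 0 = s.nv 0
  nv1 : s'.nv 1 = s.nv 1
  na0 : s'.na 0 = s.na 0
  ra : s'.ra = s.ra

theorem SameFeatures.numVertices {s s' : State} (h : SameFeatures s s') :
    numVertices s' = numVertices s := h.nv0

theorem SameFeatures.numSites {s s' : State} (h : SameFeatures s s') :
    numSites s' = numSites s := h.nv1

theorem SameFeatures.site {s s' : State} (h : SameFeatures s s') : site s' = site s := by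
  unfold FVD.site; rw [h.ra]

theorem SameFeatures.vertex {s s' : State} (h : SameFeatures s s') : vertex s' = vertex s := by
  unfold FVD.vertex; rw [h.ra]

theorem SameFeatures.own {s s' : State} (h : SameFeatures s s') : own s' = own s := by
  unfold FVD.own; rw [h.na0]

theorem SameFeatures.stores {s s' : State} (h : SameFeatures s s') (hs : StoresFeatures P s) :
    StoresFeatures P s' := by
  constructor
  · rw [h.site, h.numSites]; exact hs.site_inj
  · rw [h.site, h.numSites]; exact hs.site_range
  · rw [h.vertex, h.numVertices]; exact hs.vertex_inj
  · rw [h.vertex, h.numVertices]; exact hs.vertex_range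
  · rw [h.numVertices, h.own, h.numSites]; exact hs.own_lt
  · rw [h.numVertices, h.own]; exact hs.own_inj
  · rw [h.numVertices, h.vertex, h.site, h.own]; exact hs.own_spec

/-- `s'` differs from `s` in scratch registers only. -/
structure Kept (s s' : State) : Prop where
  nv : ∀ j < 3, s'.nv j = s.nv j
  na : s'.na = s.na
  ra : s'.ra = s.ra

theorem Kept.refl (s : State) : Kept s s := ⟨fun _ _ => rfl, rfl, rfl⟩

theorem Kept.trans {s s' s'' : State} (h : Kept s s') (h' : Kept s' s'') : Kept s s'' :=
  ⟨fun j hj => (h'.nv j hj).trans (h.nv j hj), h'.na.trans h.na, h'.ra.trans h.ra⟩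

theorem Kept.sameFeatures {s s' : State} (h : Kept s s') : SameFeatures s s' :=
  ⟨h.nv 0 (by norm_num), h.nv 1 (by norm_num), by rw [h.na], h.ra⟩

theorem Kept.storesTree {s s' : State} (h : Kept s s') {t : SepTree} {r : ℕ}
    (ht : StoresTree s t r) : StoresTree s' t r := by
  induction t generalizing r with
  | nil => exact ht
  | node w p ch ih =>
    obtain ⟨i, hr, hi, hw, hp, hc⟩ := ht
    have hf := h.sameFeatures
    refine ⟨i, hr, by rwa [hf.numVertices], by rwa [hf.vertex], by rwa [hf.site, hf.own],
      fun k => ?_⟩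
    have : child s' i k = child s i k := by unfold child; rw [h.na]
    rw [this]
    exact ih k (hc k)

theorem Kept.storesSD {s s' : State} (h : Kept s s') {t : SepTree} (hs : StoresSD P t s) :
    StoresSD P t s' := by
  refine ⟨h.sameFeatures.stores hs.1, hs.2.1, ?_⟩
  have : root s' = root s := h.nv 2 (by norm_num)
  rw [this]
  exact h.storesTree hs.2.2

/-! ### Facts about a stored diagram -/

theorem StoresFeatures.owners {s : State} (h : StoresFeatures P s) {i : ℕ}
    (hi : i < numVertices s) :
    Owners P (vertex s i) fun k => site s (own s i k) :=
  ⟨fun a b hab => h.own_inj i hi (h.site_inj (h.own_lt i hi a) (h.own_lt i hi b) hab),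
    h.own_spec i hi⟩

theorem StoresFeatures.finite {s : State} (h : StoresFeatures P s) : (vertices P).Finite := by
  rw [← h.vertex_range]; exact (Set.finite_Iio _).image _

theorem StoresFeatures.ncard {s : State} (h : StoresFeatures P s) :
    (vertices P).ncard = numVertices s := by
  rw [← h.vertex_range, h.vertex_inj.ncard_image, Set.ncard_eq_toFinset_card']
  simp

theorem StoresFeatures.exists_site {s : State} (h : StoresFeatures P s) {e : Pt}
    (he : IsOwner P x e) : ∃ j < numSites s, site s j = e := by
  have : e ∈ site s '' Set.Iio (numSites s) := by
    rw [h.site_range]; exact ⟨he.1, he.freg_nonempty⟩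
  exact this

theorem StoresFeatures.site_mem {s : State} (h : StoresFeatures P s) {j : ℕ} (hj : j < numSites s) :
    site s j ∈ P ∧ (freg P (site s j)).Nonempty := by
  have : site s j ∈ site s '' Set.Iio (numSites s) := ⟨j, hj, rfl⟩
  rwa [h.site_range] at this

theorem StoresFeatures.numSites_le_two {s : State} (h : StoresFeatures P s)
    (hv : vertices P = ∅) : numSites s ≤ 2 := by
  by_contra! hn
  have inj : ∀ i < 3, ∀ j < 3, i ≠ j → site s i ≠ site s j := fun i hi j hj hij he =>
    hij (h.site_inj (show i < numSites s by omega) (show j < numSites s by omega) he)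
  have m := fun i (hi : i < 3) => h.site_mem (show i < numSites s by omega)
  have := vertices_nonempty_of_freg (m 0 (by omega)).1 (m 1 (by omega)).1 (m 2 (by omega)).1
    (inj 0 (by omega) 1 (by omega) (by omega)) (inj 0 (by omega) 2 (by omega) (by omega))
    (inj 1 (by omega) 2 (by omega) (by omega)) (m 0 (by omega)).2 (m 1 (by omega)).2
    (m 2 (by omega)).2
  rw [hv] at this
  exact Set.not_nonempty_empty this

/-- Every farthest point owns a vertex, or is the first or the last of the stored sites. -/
theorem StoresFeatures.exists_vertex_or_extreme (hP : NoFourCocircular P) {s : State}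
    (h : StoresFeatures P s) {e : Pt} (he : IsOwner P q e) :
    (∃ x ∈ vertices P, IsOwner P x e) ∨ e = site s 0 ∨ e = site s (numSites s - 1) := by
  rcases (vertices P).eq_empty_or_nonempty with hv | hv
  · obtain ⟨j, hj, rfl⟩ := h.exists_site he
    have := h.numSites_le_two hv
    have : j = 0 ∨ j = numSites s - 1 := by omega
    rcases this with rfl | rfl
    · exact .inr (.inl rfl)
    · exact .inr (.inr rfl)
  · exact .inl (exists_vertex_of_isOwner hP h.finite hv he)

/-! ### Program parts shared by the two queries

Real registers: `8`, `9` hold the query point, `10` to `15` the three owners of the current vertex,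
`16`, `17` the vertex.  Register `4` points to the current vertex and register `5` holds three times
its index. -/

/-- The program text of `dsq`. -/
def dsqE (x0 x1 y0 y1 : RExp) : RExp :=
  .add (.mul (.sub x0 y0) (.sub x0 y0)) (.mul (.sub x1 y1) (.sub x1 y1))

/-- The program text of `det`. -/
def detE (a0 a1 b0 b1 c0 c1 : RExp) : RExp :=
  .sub (.mul (.sub b0 a0) (.sub c1 a1)) (.mul (.sub b1 a1) (.sub c0 a0))

/-- The squared distance between two points in registers. -/
def dsqR (i j : ℕ) : RExp := dsqE (.var i) (.var (i + 1)) (.var j) (.var (j + 1))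

/-- The orientation of three points in registers. -/
def detR (i j k : ℕ) : RExp :=
  detE (.var i) (.var (i + 1)) (.var j) (.var (j + 1)) (.var k) (.var (k + 1))

/-- The point in the real registers `i` and `i + 1`. -/
noncomputable def ptAt (s : State) (i : ℕ) : Pt := !₂[s.rv i, s.rv (i + 1)]

theorem ptAt_zero (s : State) (i : ℕ) : ptAt s i 0 = s.rv i := rfl

theorem ptAt_one (s : State) (i : ℕ) : ptAt s i 1 = s.rv (i + 1) := rfl

theorem dsqR_eval (s : State) (i j : ℕ) : (dsqR i j).eval s = dsq (ptAt s i) (ptAt s j) := by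
  simp only [dsqR, dsqE, RExp.eval, dsq, ptAt_zero, ptAt_one]; ring

theorem detR_eval (s : State) (i j k : ℕ) :
    (detR i j k).eval s = det (ptAt s i) (ptAt s j) (ptAt s k) := by
  simp only [detR, detE, RExp.eval, det, ptAt_zero, ptAt_one]

/-- Copy the site with the given index to real registers `x` and `x + 1`. -/
def loadSite (x : ℕ) (j : NExp) : Cmd := .seq (.rset x (.get 0 j)) (.rset (x + 1) (.get 1 j))

/-- Copy the coordinates and the owners of the current vertex to registers. -/
def loadVertex : Cmd :=
  .seq (.nset 5 (.add (.sub (.var 4) (.lit 1)) (.add (.sub (.var 4) (.lit 1))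
    (.sub (.var 4) (.lit 1)))))
  (.seq (loadSite 10 (.get 0 (.var 5)))
  (.seq (loadSite 12 (.get 0 (.add (.var 5) (.lit 1))))
  (.seq (loadSite 14 (.get 0 (.add (.var 5) (.lit 2))))
  (.seq (.rset 16 (.get 2 (.sub (.var 4) (.lit 1))))
    (.rset 17 (.get 3 (.sub (.var 4) (.lit 1))))))))

/-- The registers hold the vertex `w` with index `i` and its owners `p`. -/
structure Loaded (s : State) (i : ℕ) (w : Pt) (p : Fin 3 → Pt) : Prop where
  base : s.nv 5 = 3 * i
  own0 : ptAt s 10 = p 0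
  own1 : ptAt s 12 = p 1
  own2 : ptAt s 14 = p 2
  pt : ptAt s 16 = w

theorem loadVertex_sem {s : State} {i : ℕ} (hi : s.nv 4 = i + 1) :
    Loaded (loadVertex.sem s) i (vertex s i) (fun k => site s (own s i k)) ∧
      Kept s (loadVertex.sem s) ∧ (loadVertex.sem s).nv 3 = s.nv 3 ∧
      ∀ j < 10, (loadVertex.sem s).rv j = s.rv j := by
  have e3 : i + (i + i) = 3 * i := by ring
  refine ⟨⟨?_, ?_, ?_, ?_, ?_⟩, ⟨?_, ?_, ?_⟩, ?_, ?_⟩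
  · simp [loadVertex, loadSite, Cmd.sem, NExp.eval, RExp.eval, hi, e3]
  · simp [loadVertex, loadSite, Cmd.sem, NExp.eval, RExp.eval, hi, e3, ptAt, site, own]
  · simp [loadVertex, loadSite, Cmd.sem, NExp.eval, RExp.eval, hi, e3, ptAt, site, own]
  · simp [loadVertex, loadSite, Cmd.sem, NExp.eval, RExp.eval, hi, e3, ptAt, site, own]
  · simp [loadVertex, loadSite, Cmd.sem, NExp.eval, RExp.eval, hi, e3, ptAt, vertex]
  · intro j hj
    have : j ≠ 5 := by omega
    simp [loadVertex, loadSite, Cmd.sem, this]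
  · simp [loadVertex, loadSite, Cmd.sem]
  · simp [loadVertex, loadSite, Cmd.sem]
  · simp [loadVertex, loadSite, Cmd.sem]
  · intro j hj
    have : j ≠ 10 ∧ j ≠ 11 ∧ j ≠ 12 ∧ j ≠ 13 ∧ j ≠ 14 ∧ j ≠ 15 ∧ j ≠ 16 ∧ j ≠ 17 := by omega
    simp [loadVertex, loadSite, Cmd.sem, this]

/-- Move to the child in one of the two sectors along the ray of the `i`-th owner. -/
def enterBeside (i : ℕ) : Cmd :=
  .ite (.rlt (.lit 0) (.mul (detR (10 + 2 * i) 16 8) (detR 10 12 14)))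
    (.nset 4 (.get 2 (.add (.var 5) (.lit ((i + 2) % 3)))))
    (.nset 4 (.get 2 (.add (.var 5) (.lit ((i + 1) % 3)))))

/-- Move to the child in the sector of the query point. -/
def enterSector : Cmd :=
  .ite (.rlt (dsqR 8 10) (dsqR 8 12))
    (.ite (.rlt (dsqR 8 12) (dsqR 8 14)) (enterBeside 2) (enterBeside 1))
    (.ite (.rlt (dsqR 8 10) (dsqR 8 14)) (enterBeside 2) (enterBeside 0))

theorem enterSector_sem {s : State} {i : ℕ} (h : Loaded s i w p) :
    enterSector.sem s =
      { s with nv := Function.update s.nv 4 (child s i (sector w p (ptAt s 8))) } := by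
  have hb : ∀ k : Fin 3, farIdx p (ptAt s 8) = k → ptAt s (10 + 2 * k) = p k →
      (enterBeside k).sem s =
        { s with nv := Function.update s.nv 4 (child s i (sector w p (ptAt s 8))) } := by
    intro k hk hp
    have e2 : ((k + 2 : Fin 3) : ℕ) = ((k : ℕ) + 2) % 3 := by fin_cases k <;> rfl
    have e1 : ((k + 1 : Fin 3) : ℕ) = ((k : ℕ) + 1) % 3 := by fin_cases k <;> rfl
    simp only [enterBeside, Cmd.sem, BExp.eval, RExp.eval, detR_eval, NExp.eval, sector, hk, hp,
      h.own0, h.own1, h.own2, h.pt, h.base, child, Int.cast_zero]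
    split_ifs
    · rw [e2]
    · rw [e1]
  have h0 := hb 0
  have h1 := hb 1
  have h2 := hb 2
  simp only [farIdx, Fin.val_zero, Fin.val_one, Fin.val_two, mul_zero, add_zero, mul_one,
    Nat.reduceMul, Nat.reduceAdd] at h0 h1 h2
  simp only [enterSector, Cmd.sem, BExp.eval, dsqR_eval, h.own0, h.own1, h.own2]
  split_ifs with c1 c2 c3
  · exact h2 (by simp [c1, c2]) h.own2
  · exact h1 (by simp [c1, c2]) h.own1
  · exact h2 (by simp [c1, c3]) h.own2
  · exact h0 (by simp [c1, c3]) h.own0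

end

/-! ### Descending in a separator decomposition -/

section

variable {P : Finset Pt} {w x q : Pt} {p : Fin 3 → Pt}

/-- The pointer `r` leads to a separator decomposition of the connected part `S` of the diagram. -/
def LeadsTo (P : Finset Pt) (s : State) (S : Set Pt) (r : ℕ) : Prop :=
  S ⊆ vertices P ∧ Conn P S ∧ ∃ t, IsSepDecomp P t S ∧ StoresTree s t r

theorem StoresSD.leadsTo (hP : NoFourCocircular P) {t : SepTree} {s : State}
    (h : StoresSD P t s) : LeadsTo P s (vertices P) (root s) :=
  ⟨subset_rfl, conn_vertices hP h.1.finite, t, h.2.1, h.2.2⟩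

theorem size_add_one_le {m n : ℕ} (hn : 0 < n) (h : 2 * m ≤ n) : Nat.size m + 1 ≤ Nat.size n := by
  rw [Nat.succ_le_iff, Nat.lt_size]
  rcases Nat.eq_zero_or_pos m with rfl | h0
  · rwa [Nat.size_zero, pow_zero]
  · obtain ⟨l, hl⟩ := Nat.exists_eq_succ_of_ne_zero (Nat.size_pos.2 h0).ne'
    have := Nat.lt_size.1 (show l < Nat.size m by omega)
    rw [hl, Nat.succ_eq_add_one, pow_succ]
    omega

theorem LeadsTo.cases {s : State} (hs : StoresFeatures P s) {S : Set Pt}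
    {r : ℕ} (h : LeadsTo P s S r) : (r = 0 ∧ S = ∅) ∨ ∃ i, r = i + 1 ∧ i < numVertices s ∧
      vertex s i ∈ S ∧ ∀ k : Fin 3, ∀ B, B = branch P S (vertex s i) (site s (own s i (k + 1)))
        (site s (own s i (k + 2))) →
        LeadsTo P s B (child s i k) ∧ Nat.size B.ncard + 1 ≤ Nat.size S.ncard := by
  obtain ⟨hS, -, t, ht, hr⟩ := h
  cases t with
  | nil => exact .inl ⟨hr, ht⟩
  | node w p ch =>
    obtain ⟨i, rfl, hi, rfl, hp, hch⟩ := hr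
    obtain ⟨hcen, -, -, hrec⟩ := ht
    have ho := hs.owners hi
    refine .inr ⟨i, rfl, hi, hcen.1, fun k B hB => ?_⟩
    have hbS : B ⊆ S := by rw [hB]; exact branch_subset.trans Set.sdiff_subset
    have hr := hrec k
    rw [← hp, ← hp, ← hB] at hr
    refine ⟨⟨hbS.trans hS, hB ▸ branch_conn ho hS k, ch k, hr, hch k⟩, ?_⟩
    have h2 : 2 * B.ncard ≤ S.ncard := hB ▸ two_mul_ncard_branch_le ho hS hcen k
    have hpos : 0 < S.ncard := (Set.ncard_pos (hs.finite.subset hS)).2 ⟨_, hcen.1⟩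
    exact size_add_one_le hpos h2

/-! ### Point location -/

/-- The squared distance of the query point from the best site so far. -/
def bestDsq : RExp := dsqE (.var 8) (.var 9) (.get 0 (.var 3)) (.get 1 (.var 3))

theorem bestDsq_eval (s : State) : bestDsq.eval s = dsq (ptAt s 8) (site s (s.nv 3)) := by
  change (s.rv 8 - s.ra 0 (s.nv 3)) * (s.rv 8 - s.ra 0 (s.nv 3)) +
    (s.rv 9 - s.ra 1 (s.nv 3)) * (s.rv 9 - s.ra 1 (s.nv 3)) = 
    (s.rv 8 - s.ra 0 (s.nv 3)) ^ 2 + (s.rv 9 - s.ra 1 (s.nv 3)) ^ 2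
  ring

/-- Replace the best site so far by the site with index `j`, whose coordinates are in the registers
`x` and `x + 1`, if that is farther. -/
def improve (x : ℕ) (j : NExp) : Cmd := .ite (.rlt bestDsq (dsqR 8 x)) (.nset 3 j) .skip

/-- One round of point location. -/
def locateStep : Cmd :=
  .seq loadVertex
  (.seq (improve 10 (.get 0 (.add (.var 5) (.lit 0))))
  (.seq (improve 12 (.get 0 (.add (.var 5) (.lit 1))))
  (.seq (improve 14 (.get 0 (.add (.var 5) (.lit 2))))
  enterSector)))

/-- Preparation of point location: the best of the first and the last site. -/
def locateInit : Cmd :=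
  .seq (.rset 8 (.var 0))
  (.seq (.rset 9 (.var 1))
  (.seq (.nset 3 (.lit 0))
  (.seq (loadSite 10 (.sub (.var 1) (.lit 1)))
  (.seq (improve 10 (.sub (.var 1) (.lit 1)))
  (.nset 4 (.var 2))))))

/-- Descend while the pointer in register `4` is not null. -/
def descend (c : Cmd) : Cmd := .loop (.not (.neq (.var 4) (.lit 0))) c

/-- Point location. -/
def locate : Cmd := .seq locateInit (descend locateStep)

/-- The effect of `improve`: register `3` has a new value, and is at least as good as before and
as good as the candidate. -/
structure Improved (s s' : State) (y : Pt) : Prop where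
  kept : Kept s s'
  rv : s'.rv = s.rv
  nv : ∀ j, j ≠ 3 → s'.nv j = s.nv j
  lt : s'.nv 3 < numSites s
  old : dsq (ptAt s 8) (site s (s.nv 3)) ≤ dsq (ptAt s 8) (site s (s'.nv 3))
  new : dsq (ptAt s 8) y ≤ dsq (ptAt s 8) (site s (s'.nv 3))

theorem improve_sem {s : State} {r : ℕ} {j : NExp} (h3 : s.nv 3 < numSites s)
    (hj : j.eval s < numSites s) (hr : ptAt s r = site s (j.eval s)) :
    Improved s ((improve r j).sem s) (ptAt s r) := by
  by_cases hc : dsq (ptAt s 8) (site s (s.nv 3)) < dsq (ptAt s 8) (ptAt s r)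
  · have e : (improve r j).sem s = { s with nv := Function.update s.nv 3 (j.eval s) } := by
      simp only [improve, Cmd.sem, BExp.eval, bestDsq_eval, dsqR_eval, if_pos hc]
    rw [e]
    refine ⟨⟨fun i hi => ?_, rfl, rfl⟩, rfl, fun i hi => ?_, ?_, ?_, ?_⟩
    · exact Function.update_of_ne (by omega) _ _
    · exact Function.update_of_ne hi _ _
    · simpa using hj
    · rw [hr] at hc; simpa using hc.le
    · simp [hr]
  · have e : (improve r j).sem s = s := by
      simp only [improve, Cmd.sem, BExp.eval, bestDsq_eval, dsqR_eval, if_neg hc]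
    rw [e]
    exact ⟨Kept.refl s, rfl, fun _ _ => rfl, h3, le_rfl, not_lt.1 hc⟩

theorem Loaded.of_eq {s s' : State} {i : ℕ} (h : Loaded s i w p) (h5 : s'.nv 5 = s.nv 5)
    (hr : ∀ j, 10 ≤ j → j < 18 → s'.rv j = s.rv j) : Loaded s' i w p := by
  have e : ∀ j, 10 ≤ j → j < 17 → ptAt s' j = ptAt s j := fun j h1 h2 => by
    rw [ptAt, ptAt, hr j h1 (by omega), hr (j + 1) (by omega) (by omega)]
  exact ⟨h5.trans h.base, (e 10 (by omega) (by omega)).trans h.own0,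
    (e 12 (by omega) (by omega)).trans h.own1, (e 14 (by omega) (by omega)).trans h.own2,
    (e 16 (by omega) (by omega)).trans h.pt⟩

theorem Kept.site {s s' : State} (h : Kept s s') : site s' = site s := h.sameFeatures.site

theorem Kept.numSites {s s' : State} (h : Kept s s') : numSites s' = numSites s :=
  h.sameFeatures.numSites

theorem locateStep_sem {s : State} (hs : StoresFeatures P s) {i : ℕ} (hi : s.nv 4 = i + 1)
    (hin : i < numVertices s) (h3 : s.nv 3 < numSites s) :
    ∃ s', locateStep.sem s = s' ∧ Kept s s' ∧ ptAt s' 8 = ptAt s 8 ∧ s'.nv 3 < numSites s ∧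
      s'.nv 4 = child s i (sector (vertex s i) (fun k => site s (own s i k)) (ptAt s 8)) ∧
      dsq (ptAt s 8) (site s (s.nv 3)) ≤ dsq (ptAt s 8) (site s (s'.nv 3)) ∧
      ∀ k, dsq (ptAt s 8) (site s (own s i k)) ≤ dsq (ptAt s 8) (site s (s'.nv 3)) := by
  obtain ⟨L0, K0, h03, h0r⟩ := loadVertex_sem hi
  set s0 := loadVertex.sem s with hs0
  have q0 : ptAt s0 8 = ptAt s 8 := by
    rw [ptAt, ptAt, h0r 8 (by norm_num), h0r 9 (by norm_num)]
  have idx : ∀ (s' : State) (k : Fin 3), s'.na = s.na → s'.nv 5 = 3 * i →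
      (NExp.get 0 (.add (.var 5) (.lit k))).eval s' = own s i k := by
    intro s' k hna h5
    simp only [NExp.eval, own, hna, h5]
  have i0 := improve_sem (s := s0) (r := 10) (j := .get 0 (.add (.var 5) (.lit (0 : Fin 3))))
    (by rw [h03, K0.numSites]; exact h3)
    (by rw [idx s0 0 K0.na L0.base, K0.numSites]; exact hs.own_lt i hin 0)
    (by rw [idx s0 0 K0.na L0.base, K0.site]; exact L0.own0)
  set s1 := (improve 10 (.get 0 (.add (.var 5) (.lit (0 : Fin 3))))).sem s0 with hs1
  have L1 := L0.of_eq (s' := s1) (i0.nv 5 (by norm_num)) (fun j _ _ => by rw [i0.rv])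
  have K1 := K0.trans i0.kept
  have q1 : ptAt s1 8 = ptAt s 8 := by rw [← q0, ptAt, ptAt, i0.rv]
  have i1 := improve_sem (s := s1) (r := 12) (j := .get 0 (.add (.var 5) (.lit (1 : Fin 3))))
    (by rw [K1.numSites, ← K0.numSites]; exact i0.lt)
    (by rw [idx s1 1 K1.na L1.base, K1.numSites]; exact hs.own_lt i hin 1)
    (by rw [idx s1 1 K1.na L1.base, K1.site]; exact L1.own1)
  set s2 := (improve 12 (.get 0 (.add (.var 5) (.lit (1 : Fin 3))))).sem s1 with hs2
  have L2 := L1.of_eq (s' := s2) (i1.nv 5 (by norm_num)) (fun j _ _ => by rw [i1.rv])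
  have K2 := K1.trans i1.kept
  have q2 : ptAt s2 8 = ptAt s 8 := by rw [← q1, ptAt, ptAt, i1.rv]
  have i2 := improve_sem (s := s2) (r := 14) (j := .get 0 (.add (.var 5) (.lit (2 : Fin 3))))
    (by rw [K2.numSites, ← K1.numSites]; exact i1.lt)
    (by rw [idx s2 2 K2.na L2.base, K2.numSites]; exact hs.own_lt i hin 2)
    (by rw [idx s2 2 K2.na L2.base, K2.site]; exact L2.own2)
  set s3 := (improve 14 (.get 0 (.add (.var 5) (.lit (2 : Fin 3))))).sem s2 with hs3
  have L3 := L2.of_eq (s' := s3) (i2.nv 5 (by norm_num)) (fun j _ _ => by rw [i2.rv])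
  have K3 := K2.trans i2.kept
  have q3 : ptAt s3 8 = ptAt s 8 := by rw [← q2, ptAt, ptAt, i2.rv]
  have e4 := enterSector_sem L3
  have o0 := i0.old
  have o1 := i1.old
  have o2 := i2.old
  have n0 := i0.new
  have n1 := i1.new
  have n2 := i2.new
  rw [q0, K0.site] at o0 n0
  rw [q1, K1.site] at o1 n1
  rw [q2, K2.site] at o2 n2
  rw [L0.own0] at n0
  rw [L1.own1] at n1
  rw [L2.own2] at n2
  rw [h03] at o0
  refine ⟨_, rfl, ?_⟩
  have e : locateStep.sem s = enterSector.sem s3 := rfl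
  rw [e, e4, q3]
  refine ⟨K3.trans ⟨fun j hj => Function.update_of_ne (by omega) _ _, rfl, rfl⟩, q3, ?_, ?_, ?_, ?_⟩
  · have := i2.lt
    rw [K2.numSites] at this
    simpa using this
  · have : child s3 i = child s i := by unfold child; rw [K3.na]
    simp [this]
  · simpa using o0.trans (o1.trans o2)
  · intro k
    have : dsq (ptAt s 8) (site s (own s i k)) ≤ dsq (ptAt s 8) (site s (s3.nv 3)) := by
      fin_cases k
      · exact n0.trans (o1.trans o2)
      · exact n1.trans o2
      · exact n2
    simpa using this

theorem locateInit_sem {s : State} (hn : 0 < numSites s) :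
    ∃ s', locateInit.sem s = s' ∧ Kept s s' ∧ ptAt s' 8 = ptAt s 0 ∧ s'.nv 3 < numSites s ∧
      s'.nv 4 = root s ∧ dsq (ptAt s 0) (site s 0) ≤ dsq (ptAt s 0) (site s (s'.nv 3)) ∧
      dsq (ptAt s 0) (site s (numSites s - 1)) ≤ dsq (ptAt s 0) (site s (s'.nv 3)) := by
  set s0 := (loadSite 10 (.sub (.var 1) (.lit 1))).sem ((Cmd.nset 3 (.lit 0)).sem
    ((Cmd.rset 9 (.var 1)).sem ((Cmd.rset 8 (.var 0)).sem s))) with hs0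
  have K0 : Kept s s0 := by
    refine ⟨fun j hj => ?_, rfl, rfl⟩
    have : j ≠ 3 := by omega
    simp [hs0, loadSite, Cmd.sem, this]
  have q0 : ptAt s0 8 = ptAt s 0 := by simp [hs0, ptAt, loadSite, Cmd.sem, RExp.eval]
  have h3 : s0.nv 3 = 0 := by simp [hs0, loadSite, Cmd.sem, NExp.eval]
  have hlast : (NExp.sub (.var 1) (.lit 1)).eval s0 = numSites s - 1 := by
    simp [hs0, loadSite, Cmd.sem, NExp.eval, numSites]
  have hpt : ptAt s0 10 = site s (numSites s - 1) := by
    simp [hs0, ptAt, site, loadSite, Cmd.sem, NExp.eval, RExp.eval, numSites]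
  have i0 := improve_sem (s := s0) (r := 10) (j := .sub (.var 1) (.lit 1))
    (by rw [h3, K0.numSites]; exact hn) (by rw [hlast, K0.numSites]; omega)
    (by rw [hlast, hpt, K0.site])
  set s1 := (improve 10 (.sub (.var 1) (.lit 1))).sem s0 with hs1
  have K1 := K0.trans i0.kept
  have o0 := i0.old
  have n0 := i0.new
  have l0 := i0.lt
  rw [q0, K0.site] at o0 n0
  rw [h3] at o0
  rw [hpt] at n0
  rw [K0.numSites] at l0
  refine ⟨_, rfl, ?_⟩
  have e : locateInit.sem s = { s1 with nv := Function.update s1.nv 4 (s1.nv 2) } := rfl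
  rw [e]
  refine ⟨K1.trans ⟨fun j hj => Function.update_of_ne (by omega) _ _, rfl, rfl⟩, ?_, ?_, ?_, ?_, ?_⟩
  · rw [← q0, ptAt, ptAt, ← i0.rv]
  · simpa using l0
  · simpa [root] using K1.nv 2 (by norm_num)
  · simpa using o0
  · simpa using n0

theorem locate_exec (hP : NoFourCocircular P) (hne : P.Nonempty) {t : SepTree} {s : State}
    (hs : StoresSD P t s) : Exec locate s
      (locateInit.bound + ((BExp.not (.neq (.var 4) (.lit 0))).cost + 1 + locateStep.bound) *
        (Nat.size (vertices P).ncard + 1))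
      fun s' => StoresSD P t s' ∧ answer s' < numSites s' ∧
        ptAt s 0 ∈ closure (freg P (site s' (answer s'))) := by
  set q := ptAt s 0 with hq
  obtain ⟨e, he⟩ := exists_isOwner q hne
  have hF := hs.1
  have hn : 0 < numSites s := by
    obtain ⟨j, hj, -⟩ := hF.exists_site he
    omega
  refine Exec.seq (Exec.of_loopFree (by simp [locateInit, loadSite, improve, Cmd.LoopFree])
    (Q := fun s' => s' = locateInit.sem s) rfl) ?_
  rintro s₁ rfl
  obtain ⟨s₁, hs₁, K1, q1, l1, r1, g0, g1⟩ := locateInit_sem hn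
  rw [hs₁]
  -- unless the best site so far is as far as `e`, the remaining part has a vertex owned by `e`
  let I : ℕ → State → Prop := fun k s' => Kept s s' ∧ ptAt s' 8 = q ∧ s'.nv 3 < numSites s ∧
    ∃ S, LeadsTo P s S (s'.nv 4) ∧ Nat.size S.ncard ≤ k ∧
      (dsq q e ≤ dsq q (site s (s'.nv 3)) ∨ ∃ x ∈ S, IsOwner P x e)
  refine Exec.loop (I := I) ?_ ?_
  · rintro k s' ⟨K, hq', l, S, hS, hk, hor⟩
    rcases hS.cases hF with ⟨h0, rfl⟩ | ⟨i, hi, hin, hwS, hch⟩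
    · refine .inl ⟨by simp [BExp.eval, NExp.eval, h0], K.storesSD hs,
        by rw [K.numSites]; exact l, ?_⟩
      rcases hor with hor | ⟨x, hx, -⟩
      · rw [K.site]
        exact (he.of_dsq_eq (hF.site_mem l).1 hor).mem_closure_freg
      · exact hx.elim
    · have hF' := K.sameFeatures.stores hF
      obtain ⟨s'', hs'', K', hq'', l', r', o', n'⟩ := locateStep_sem hF' hi
        (by rw [K.sameFeatures.numVertices]; exact hin) (by rw [K.numSites]; exact l)
      have hchild : child s' = child s := by unfold child; rw [K.na]
      rw [K.sameFeatures.vertex, K.site, K.sameFeatures.own, hq', hchild] at r'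
      rw [K.site, hq'] at o' n'
      rw [K.sameFeatures.own] at n'
      rw [K.numSites] at l'
      obtain ⟨hL, hsz⟩ := hch (sector (vertex s i) (fun k => site s (own s i k)) q) _ rfl
      refine .inr ⟨k - 1, by omega, by simp [BExp.eval, NExp.eval, hi], Exec.of_loopFree
        (by simp [locateStep, loadVertex, loadSite, improve, enterSector, enterBeside,
          Cmd.LoopFree]) ?_⟩
      rw [hs'']
      refine ⟨K.trans K', hq''.trans hq', l', _, by rw [r']; exact hL, by omega, ?_⟩
      rcases hor with hor | ⟨x, hx, hxe⟩
      · exact .inl (hor.trans o')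
      · by_cases hex : ∃ k, site s (own s i k) = e
        · obtain ⟨k, rfl⟩ := hex
          exact .inl (n' k)
        · push Not at hex
          exact .inr (search_step hP (hF.owners hin) hS.1 hS.2.1 hwS hx hxe
            (fun k => he.dsq_le (hF.site_mem (hF.own_lt i hin k)).1) hex)
  · refine ⟨K1, q1, l1, vertices P, r1 ▸ hs.leadsTo hP, le_rfl, ?_⟩
    rcases hF.exists_vertex_or_extreme hP he with h | rfl | rfl
    · exact .inr h
    · exact .inl g0
    · exact .inl g1

end

/-! ### Segment queries: the target point -/

section

variable {P : Finset Pt} {w x q : Pt} {p : Fin 3 → Pt}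

/-- The gap at `x` between the squared distances of `c` and of `p`: nonnegative if `p` is not
farther than `c`.  It is an affine function of `x`. -/
def gap (c p x : Pt) : ℝ := dsq x c - dsq x p

theorem gap_walk (c p x y : Pt) (t : ℝ) : gap c p (walk x (y 0 - x 0) (y 1 - x 1) t)
    = gap c p x + t * (gap c p y - gap c p x) := by
  rw [gap, dsq_walk_sub]; unfold gap dsq; ring

/-- The point `x` of a segment with endpoint `v` that is the target of the query: the gaps of all
points of `P` are nonnegative there, the one of `e` vanishes, and at `v` they are all positive. -/
structure Target (P : Finset Pt) (c v x e : Pt) : Prop where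
  mem : e ∈ P
  gap_end : ∀ p ∈ P, 0 < gap c p v
  gap_nonneg : ∀ p ∈ P, 0 ≤ gap c p x
  gap_zero : gap c e x = 0

theorem Target.isOwner {c v e : Pt} (h : Target P c v x e) : IsOwner P x e :=
  isOwner_iff.2 ⟨h.mem, fun p hp => by
    have h1 := h.gap_nonneg p hp
    have h2 := h.gap_zero
    unfold gap at h1 h2; linarith⟩

/-- The point `q` lies on the line from the target `x` to `v`, on the other side of `x` than `v`. -/
def Before (x v q : Pt) : Prop := ∃ τ, 0 ≤ τ ∧ q = walk x (v 0 - x 0) (v 1 - x 1) (-τ)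

theorem mem_segment_iff_walk {u v y : Pt} : y ∈ segment ℝ u v ↔
    ∃ t, 0 ≤ t ∧ t ≤ 1 ∧ y = walk v (u 0 - v 0) (u 1 - v 1) t := by
  rw [segment_symm, segment_eq_image']
  constructor
  · rintro ⟨t, ⟨h0, h1⟩, rfl⟩
    exact ⟨t, h0, h1, pt_ext (by simp [walk]) (by simp [walk])⟩
  · rintro ⟨t, h0, h1, rfl⟩
    exact ⟨t, ⟨h0, h1⟩, pt_ext (by simp [walk]) (by simp [walk])⟩

theorem dF_eq_iff_gap (hne : P.Nonempty) {c y : Pt} :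
    dist y c = dF y P ↔ (∀ p ∈ P, 0 ≤ gap c p y) ∧ ∃ p ∈ P, gap c p y = 0 := by
  constructor
  · intro h
    obtain ⟨p, hp⟩ := exists_isOwner y hne
    have e : dsq y c = dsq y p := dist_eq_iff.1 (h.trans hp.2.symm)
    exact ⟨fun p' hp' => by have := hp.dsq_le hp'; unfold gap; linarith,
      p, hp.1, by unfold gap; linarith⟩
  · rintro ⟨hall, p, hp, h0⟩
    have ho : IsOwner P y p := isOwner_iff.2 ⟨hp, fun p' hp' => by
      have := hall p' hp'; unfold gap at this h0; linarith⟩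
    rw [← ho.2, dist_eq_iff]
    unfold gap at h0; linarith

/-- The farthest distance from `P` is the maximum of the distances, so the gaps decide about it: the
first of them to vanish on the way from `v` to `u` determines the only point of the segment with
equal distances. -/
theorem SegmentInput.exists_target (hne : P.Nonempty) {C : Finset Pt} {u v c₁ c₂ : Pt}
    (h : SegmentInput P C u v c₁ c₂) : ∃ x e, x ∈ segment ℝ u v ∧ Target P c₁ v x e ∧
      Before x v u ∧ ∀ y ∈ segment ℝ u v, dF y C = dF y P ↔ y = x := by
  have hC : ∀ y ∈ segment ℝ u v, dF y C = dist y c₁ := fun y hy => (h.subset_edge hy).1.2.symm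
  have hv : ∀ p ∈ P, 0 < gap c₁ p v := by
    intro p hp
    have := h.right
    rw [hC v (right_mem_segment ℝ u v)] at this
    have := dist_lt_iff.1 ((dist_le_dF v hp).trans_lt this)
    unfold gap; linarith
  obtain ⟨e₀, he₀, hu⟩ : ∃ e ∈ P, gap c₁ e u < 0 := by
    obtain ⟨e, he⟩ := exists_isOwner u hne
    have := h.left
    rw [hC u (left_mem_segment ℝ u v), ← he.2, dist_lt_iff] at this
    exact ⟨e, he.1, by unfold gap; linarith⟩
  obtain ⟨t, ht, hall, e, he, hse, h0⟩ := exists_first_zero P (fun p => gap c₁ p v)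
    (fun p => gap c₁ p u - gap c₁ p v) (fun p hp => (hv p hp).le)
    ⟨e₀, he₀, by linarith [hv e₀ he₀]⟩
  have ht1 : t < 1 := by
    by_contra! hge
    nlinarith [hall e₀ he₀, hv e₀ he₀]
  have htpos : 0 < t := by
    refine lt_of_le_of_ne ht ?_
    rintro rfl
    linarith [hv e he]
  set x := walk v (u 0 - v 0) (u 1 - v 1) t with hx
  have hxs : x ∈ segment ℝ u v := mem_segment_iff_walk.2 ⟨t, ht, ht1.le, hx⟩
  have hT : Target P c₁ v x e :=
    ⟨he, hv, fun p hp => by rw [hx, gap_walk]; exact hall p hp, by rw [hx, gap_walk]; exact h0⟩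
  refine ⟨x, e, hxs, hT, ⟨(1 - t) / t, div_nonneg (by linarith) ht, ?_⟩, ?_⟩
  · have x0 : x 0 = v 0 + t * (u 0 - v 0) := rfl
    have x1 : x 1 = v 1 + t * (u 1 - v 1) := rfl
    refine pt_ext ?_ ?_
    · change u 0 = x 0 + -((1 - t) / t) * (v 0 - x 0)
      rw [x0]; field_simp; ring
    · change u 1 = x 1 + -((1 - t) / t) * (v 1 - x 1)
      rw [x1]; field_simp; ring
  · intro y hy
    rw [hC y hy, dF_eq_iff_gap hne]
    constructor
    · rintro ⟨hally, p, hp, hpy⟩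
      obtain ⟨t', ht0, ht1', rfl⟩ := mem_segment_iff_walk.1 hy
      have a1 := hally e he
      rw [gap_walk] at a1 hpy
      have a2 := hall p hp
      have a3 := hv p hp
      have le1 : t' ≤ t := by
        by_contra! hlt
        nlinarith
      have le2 : t ≤ t' := by
        by_contra! hlt
        nlinarith
      rw [hx, le_antisymm le1 le2]
    · rintro rfl
      exact ⟨hT.gap_nonneg, e, he, hT.gap_zero⟩

/-- Move `q` towards `v`, to the point where the gap of `p` vanishes, if this gap is negative. -/
noncomputable def pull (c v q p : Pt) : Pt :=
  walk q (v 0 - q 0) (v 1 - q 1)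
    (if gap c p q < 0 then gap c p q / (gap c p q - gap c p v) else 0)

theorem walk_zero (x : Pt) (m0 m1 : ℝ) : walk x m0 m1 0 = x :=
  pt_ext (by simp [walk]) (by simp [walk])

/-- Pulling does not move the current point past the target, and keeps the gaps nonnegative that are
nonnegative already. -/
theorem Before.pull {c v p : Pt} (h : Before x v q) (hx : 0 ≤ gap c p x) (hv : 0 < gap c p v) :
    Before x v (pull c v q p) ∧ 0 ≤ gap c p (pull c v q p) ∧
      ∀ p', 0 < gap c p' v → 0 ≤ gap c p' q → 0 ≤ gap c p' (FVD.pull c v q p) := by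
  by_cases hneg : gap c p q < 0
  · have hden : 0 < gap c p v - gap c p q := by linarith
    have hden' : gap c p q - gap c p v ≠ 0 := by linarith
    obtain ⟨τ, hτ, hq⟩ := h
    have hgq : gap c p q = gap c p x + -τ * (gap c p v - gap c p x) := by rw [hq, gap_walk]
    have hvx : 0 < gap c p v - gap c p x := by
      by_contra! hn
      nlinarith
    have hl : gap c p q / (gap c p q - gap c p v) = -gap c p q / (gap c p v - gap c p q) := by
      rw [← neg_sub (gap c p v), div_neg, neg_div]
    refine ⟨⟨gap c p x / (gap c p v - gap c p x), by positivity, ?_⟩, ?_, ?_⟩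
    · have hq0 : q 0 = x 0 + -τ * (v 0 - x 0) := by rw [hq]; rfl
      have hq1 : q 1 = x 1 + -τ * (v 1 - x 1) := by rw [hq]; rfl
      have hcoef : gap c p q / (gap c p q - gap c p v) * (1 + τ) - τ
          = -(gap c p x / (gap c p v - gap c p x)) := by
        have : gap c p q - gap c p v = -((1 + τ) * (gap c p v - gap c p x)) := by rw [hgq]; ring
        rw [this, hgq]
        have h1 : 1 + τ ≠ 0 := by positivity
        have h2 := hvx.ne'
        field_simp
        ring
      rw [FVD.pull, if_pos hneg]
      refine pt_ext ?_ ?_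
      · change q 0 + gap c p q / (gap c p q - gap c p v) * (v 0 - q 0)
          = x 0 + -(gap c p x / (gap c p v - gap c p x)) * (v 0 - x 0)
        rw [← hcoef, hq0]; ring
      · change q 1 + gap c p q / (gap c p q - gap c p v) * (v 1 - q 1)
          = x 1 + -(gap c p x / (gap c p v - gap c p x)) * (v 1 - x 1)
        rw [← hcoef, hq1]; ring
    · rw [FVD.pull, if_pos hneg, gap_walk]
      apply le_of_eq
      field_simp; ring
    · intro p' hv' hq'
      rw [FVD.pull, if_pos hneg, gap_walk, hl]
      have l0 : 0 ≤ -gap c p q / (gap c p v - gap c p q) := div_nonneg (by linarith) hden.le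
      have l1 : -gap c p q / (gap c p v - gap c p q) ≤ 1 := by
        rw [div_le_one hden]; linarith
      generalize -gap c p q / (gap c p v - gap c p q) = l at l0 l1
      nlinarith [mul_nonneg (sub_nonneg.2 l1) hq', mul_nonneg l0 hv'.le]
  · have : FVD.pull c v q p = q := by rw [FVD.pull, if_neg hneg, walk_zero]
    rw [this]
    exact ⟨h, not_lt.1 hneg, fun _ _ h => h⟩

theorem Before.gap_nonpos {c v e : Pt} (h : Before x v q) (hT : Target P c v x e) :
    gap c e q ≤ 0 := by
  obtain ⟨τ, hτ, rfl⟩ := h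
  rw [gap_walk, hT.gap_zero]
  nlinarith [mul_nonneg hτ (hT.gap_end e hT.mem).le]

theorem Before.eq_target {c v e : Pt} (h : Before x v q) (hT : Target P c v x e)
    (he : 0 ≤ gap c e q) : q = x := by
  obtain ⟨τ, hτ, rfl⟩ := h
  rw [gap_walk, hT.gap_zero] at he
  have := hT.gap_end e hT.mem
  have : τ = 0 := le_antisymm (by by_contra! hlt; nlinarith) hτ
  rw [this, neg_zero, walk_zero]

/-! ### Segment queries: the program -/

/-- The program text of `gap`, for points in registers; `c` is in the registers `4` and `5`. -/
def gapR (x j : ℕ) : RExp := .sub (dsqR x 4) (dsqR x j)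

/-- The program for `pull`, for a site in the registers `j` and `j + 1`. -/
def pullBy (j : ℕ) : Cmd :=
  .ite (.rlt (gapR 8 j) (.lit 0))
    (.seq (.rset 18 (.div (gapR 8 j) (.sub (gapR 8 j) (gapR 2 j))))
    (.seq (.rset 8 (.add (.var 8) (.mul (.var 18) (.sub (.var 2) (.var 8)))))
      (.rset 9 (.add (.var 9) (.mul (.var 18) (.sub (.var 3) (.var 9)))))))
    .skip

/-- One round of a segment query. -/
def segmentStep : Cmd :=
  .seq loadVertex (.seq (pullBy 10) (.seq (pullBy 12) (.seq (pullBy 14) enterSector)))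

/-- Preparation of a segment query: start at `u`, with the first and the last site. -/
def segmentInit : Cmd :=
  .seq (.rset 8 (.var 0))
  (.seq (.rset 9 (.var 1))
  (.seq (loadSite 10 (.lit 0))
  (.seq (loadSite 12 (.sub (.var 1) (.lit 1)))
  (.seq (pullBy 10)
  (.seq (pullBy 12)
  (.nset 4 (.var 2)))))))

/-- The segment query. -/
def segmentQuery : Cmd := .seq segmentInit (descend segmentStep)

theorem gapR_eval (s : State) (x j : ℕ) :
    (gapR x j).eval s = gap (ptAt s 4) (ptAt s j) (ptAt s x) := by
  change (dsqR x 4).eval s - (dsqR x j).eval s = _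
  rw [dsqR_eval, dsqR_eval, gap]

/-- `s'` differs from `s` only in the query point, which is now `y`, and in the real scratch
register `18`. -/
structure Moved (s s' : State) (y : Pt) : Prop where
  nv : s'.nv = s.nv
  na : s'.na = s.na
  ra : s'.ra = s.ra
  rv : ∀ j, j ≠ 8 → j ≠ 9 → j ≠ 18 → s'.rv j = s.rv j
  pt : ptAt s' 8 = y

theorem Moved.kept {s s' : State} {y : Pt} (h : Moved s s' y) : Kept s s' :=
  ⟨fun _ _ => by rw [h.nv], h.na, h.ra⟩

theorem Moved.ptAt_eq {s s' : State} {y : Pt} (h : Moved s s' y) {j : ℕ}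
    (hj : j < 7 ∨ 10 ≤ j ∧ j < 17) : ptAt s' j = ptAt s j := by
  rw [ptAt, ptAt, h.rv j (by omega) (by omega) (by omega),
    h.rv (j + 1) (by omega) (by omega) (by omega)]

theorem Moved.loaded {s s' : State} {y : Pt} (h : Moved s s' y) {i : ℕ} (hl : Loaded s i w p) :
    Loaded s' i w p :=
  hl.of_eq (by rw [h.nv]) fun j _ _ => h.rv j (by omega) (by omega) (by omega)

theorem pullBy_sem (s : State) (j : ℕ) :
    Moved s ((pullBy j).sem s) (pull (ptAt s 4) (ptAt s 2) (ptAt s 8) (ptAt s j)) := by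
  by_cases hneg : gap (ptAt s 4) (ptAt s j) (ptAt s 8) < 0
  · have e : (pullBy j).sem s = (Cmd.seq
        (.rset 18 (.div (gapR 8 j) (.sub (gapR 8 j) (gapR 2 j))))
        (.seq (.rset 8 (.add (.var 8) (.mul (.var 18) (.sub (.var 2) (.var 8)))))
          (.rset 9 (.add (.var 9) (.mul (.var 18) (.sub (.var 3) (.var 9))))))).sem s := by
      rw [pullBy, Cmd.sem_ite_pos]
      simpa only [BExp.eval, gapR_eval, RExp.eval, Int.cast_zero] using hneg
    rw [e]
    refine ⟨rfl, rfl, rfl, fun i h8 h9 h18 => ?_, ?_⟩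
    · simp [Cmd.sem, h8, h9, h18]
    · rw [pull, if_pos hneg]
      refine pt_ext ?_ ?_
      · simp only [ptAt_zero, Cmd.sem, RExp.eval, gapR_eval, walk]
        simp [ptAt]
      · simp only [ptAt_one, Cmd.sem, RExp.eval, gapR_eval, walk]
        simp [ptAt]
  · have e : (pullBy j).sem s = s := by
      rw [pullBy, Cmd.sem_ite_neg]
      · rfl
      · simpa only [BExp.eval, gapR_eval, RExp.eval, Int.cast_zero] using hneg
    rw [e]
    exact ⟨rfl, rfl, rfl, fun _ _ _ _ => rfl, by rw [pull, if_neg hneg, walk_zero]⟩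

/-- The state of a segment query with current point `q`. -/
structure Querying (s s' : State) (q : Pt) : Prop where
  kept : Kept s s'
  ptv : ptAt s' 2 = ptAt s 2
  ptc : ptAt s' 4 = ptAt s 4
  ptq : ptAt s' 8 = q

theorem Querying.pullBy {s s' : State} (h : Querying s s' q) (j : ℕ) :
    Querying s ((pullBy j).sem s') (pull (ptAt s 4) (ptAt s 2) q (ptAt s' j)) := by
  have m := pullBy_sem s' j
  rw [h.ptv, h.ptc, h.ptq] at m
  exact ⟨h.kept.trans m.kept, (m.ptAt_eq (by omega)).trans h.ptv,
    (m.ptAt_eq (by omega)).trans h.ptc, m.pt⟩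

theorem segmentStep_sem {s s' : State} (hq : Querying s s' q) {i : ℕ} (hi : s'.nv 4 = i + 1) :
    ∃ y, y = pull (ptAt s 4) (ptAt s 2) (pull (ptAt s 4) (ptAt s 2) (pull (ptAt s 4) (ptAt s 2) q
        (site s (own s i 0))) (site s (own s i 1))) (site s (own s i 2)) ∧
      Querying s (segmentStep.sem s') y ∧
      (segmentStep.sem s').nv 4
        = child s i (sector (vertex s i) (fun k => site s (own s i k)) y) := by
  obtain ⟨L0, K0, -, h0r⟩ := loadVertex_sem hi
  set s0 := loadVertex.sem s' with hs0
  rw [hq.kept.sameFeatures.vertex, hq.kept.site, hq.kept.sameFeatures.own] at L0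
  have Q0 : Querying s s0 q := by
    refine ⟨hq.kept.trans K0, ?_, ?_, ?_⟩
    · rw [← hq.ptv, ptAt, ptAt, h0r 2 (by norm_num), h0r 3 (by norm_num)]
    · rw [← hq.ptc, ptAt, ptAt, h0r 4 (by norm_num), h0r 5 (by norm_num)]
    · rw [← hq.ptq, ptAt, ptAt, h0r 8 (by norm_num), h0r 9 (by norm_num)]
  have Q1 := Q0.pullBy 10
  have L1 := (pullBy_sem s0 10).loaded L0
  set s1 := (pullBy 10).sem s0 with hs1
  have Q2 := Q1.pullBy 12
  have L2 := (pullBy_sem s1 12).loaded L1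
  set s2 := (pullBy 12).sem s1 with hs2
  have Q3 := Q2.pullBy 14
  have L3 := (pullBy_sem s2 14).loaded L2
  set s3 := (pullBy 14).sem s2 with hs3
  rw [L2.own2, L1.own1, L0.own0] at Q3
  refine ⟨_, rfl, ?_⟩
  have e : segmentStep.sem s' = enterSector.sem s3 := rfl
  rw [e, enterSector_sem L3, Q3.ptq]
  refine ⟨⟨Q3.kept.trans ⟨fun j hj => Function.update_of_ne (by omega) _ _, rfl, rfl⟩,
    Q3.ptv, Q3.ptc, Q3.ptq⟩, ?_⟩
  have : child s3 i = child s i := by unfold child; rw [Q3.kept.na]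
  simp [this]

theorem segmentInit_sem (s : State) : ∃ y, y = pull (ptAt s 4) (ptAt s 2)
      (pull (ptAt s 4) (ptAt s 2) (ptAt s 0) (site s 0)) (site s (numSites s - 1)) ∧
    Querying s (segmentInit.sem s) y ∧ (segmentInit.sem s).nv 4 = root s := by
  set s0 := (loadSite 12 (.sub (.var 1) (.lit 1))).sem ((loadSite 10 (.lit 0)).sem
    ((Cmd.rset 9 (.var 1)).sem ((Cmd.rset 8 (.var 0)).sem s))) with hs0
  have Q0 : Querying s s0 (ptAt s 0) := by
    refine ⟨⟨fun _ _ => rfl, rfl, rfl⟩, ?_, ?_, ?_⟩ <;>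
      simp [hs0, ptAt, loadSite, Cmd.sem, RExp.eval]
  have p0 : ptAt s0 10 = site s 0 := by
    simp [hs0, ptAt, site, loadSite, Cmd.sem, NExp.eval, RExp.eval]
  have p1 : ptAt s0 12 = site s (numSites s - 1) := by
    simp [hs0, ptAt, site, loadSite, Cmd.sem, NExp.eval, RExp.eval, numSites]
  have Q1 := Q0.pullBy 10
  have m1 := pullBy_sem s0 10
  set s1 := (pullBy 10).sem s0 with hs1
  have Q2 := Q1.pullBy 12
  set s2 := (pullBy 12).sem s1 with hs2
  rw [p0, m1.ptAt_eq (by omega), p1] at Q2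
  refine ⟨_, rfl, ?_⟩
  have e : segmentInit.sem s = { s2 with nv := Function.update s2.nv 4 (s2.nv 2) } := rfl
  rw [e]
  refine ⟨⟨Q2.kept.trans ⟨fun j hj => Function.update_of_ne (by omega) _ _, rfl, rfl⟩,
    Q2.ptv, Q2.ptc, Q2.ptq⟩, ?_⟩
  simpa [root] using Q2.kept.nv 2 (by norm_num)

theorem segmentQuery_exec (hP : NoFourCocircular P) {t : SepTree} {s : State}
    (hs : StoresSD P t s) {e : Pt} (hT : Target P (ptAt s 4) (ptAt s 2) x e)
    (hu : Before x (ptAt s 2) (ptAt s 0)) : Exec segmentQuery s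
      (segmentInit.bound + ((BExp.not (.neq (.var 4) (.lit 0))).cost + 1 + segmentStep.bound) *
        (Nat.size (vertices P).ncard + 1))
      fun s' => StoresSD P t s' ∧ ptAt s' 8 = x := by
  have he := hT.isOwner
  have hF := hs.1
  set c := ptAt s 4
  set v := ptAt s 2
  have hn : 0 < numSites s := by
    obtain ⟨j, hj, -⟩ := hF.exists_site he
    omega
  have hpull : ∀ {q : Pt} {j : ℕ}, j < numSites s → Before x v q → _ := fun {q j} hj h =>
    Before.pull (p := site s j) h (hT.gap_nonneg _ (hF.site_mem hj).1)
      (hT.gap_end _ (hF.site_mem hj).1)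
  refine Exec.seq (Exec.of_loopFree (by simp [segmentInit, loadSite, pullBy, Cmd.LoopFree])
    (Q := fun s' => s' = segmentInit.sem s) rfl) ?_
  rintro s₁ rfl
  obtain ⟨y, hy, Q1, r1⟩ := segmentInit_sem s
  -- unless the current point is the target, the remaining part has a vertex owned by `e`
  let I : ℕ → State → Prop := fun k s' => ∃ q, Querying s s' q ∧ Before x v q ∧
    ∃ S, LeadsTo P s S (s'.nv 4) ∧ Nat.size S.ncard ≤ k ∧
      (0 ≤ gap c e q ∨ ∃ x ∈ S, IsOwner P x e)
  refine Exec.loop (I := I) ?_ ?_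
  · rintro k s' ⟨q, hq, hb, S, hS, hk, hor⟩
    rcases hS.cases hF with ⟨h0, rfl⟩ | ⟨i, hi, hin, hwS, hch⟩
    · refine .inl ⟨by simp [BExp.eval, NExp.eval, h0], hq.kept.storesSD hs, ?_⟩
      rcases hor with hor | ⟨x, hx, -⟩
      · rw [hq.ptq, hb.eq_target hT hor]
      · exact hx.elim
    · obtain ⟨y, hy, hQ, hr⟩ := segmentStep_sem hq hi
      have hlt := hF.own_lt i hin
      obtain ⟨b0, g0, m0⟩ := hpull (hlt 0) hb
      obtain ⟨b1, g1, m1⟩ := hpull (hlt 1) b0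
      obtain ⟨b2, g2, m2⟩ := hpull (hlt 2) b1
      rw [← hy] at b2 g2 m2
      have hend := fun k => hT.gap_end _ (hF.site_mem (hlt k)).1
      have gall : ∀ k, 0 ≤ gap c (site s (own s i k)) y := by
        intro k
        fin_cases k
        · exact m2 _ (hend 0) (m1 _ (hend 0) g0)
        · exact m2 _ (hend 1) g1
        · exact g2
      obtain ⟨hL, hsz⟩ := hch (sector (vertex s i) (fun k => site s (own s i k)) y) _ rfl
      refine .inr ⟨k - 1, by omega, by simp [BExp.eval, NExp.eval, hi], Exec.of_loopFree
        (by simp [segmentStep, loadVertex, loadSite, pullBy, enterSector, enterBeside,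
          Cmd.LoopFree]) ⟨y, hQ, b2, _, by rw [hr]; exact hL, by omega, ?_⟩⟩
      rcases hor with hor | ⟨z, hz, hze⟩
      · have hev := hT.gap_end e hT.mem
        exact .inl (m2 _ hev (m1 _ hev (m0 _ hev hor)))
      · by_cases hex : ∃ k, site s (own s i k) = e
        · obtain ⟨k, rfl⟩ := hex
          exact .inl (gall k)
        · push Not at hex
          -- `e` is at least as far from the current point as the owners, for their gaps are
          -- nonnegative there and the gap of `e` is not positive
          refine .inr (search_step hP (hF.owners hin) hS.1 hS.2.1 hwS hz hze (fun k => ?_) hex)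
          have h1 := gall k
          have h2 := b2.gap_nonpos hT
          unfold gap at h1 h2; linarith
  · obtain ⟨b0, g0, -⟩ := hpull (show 0 < numSites s from hn) hu
    obtain ⟨b1, g1, m1⟩ := hpull (show numSites s - 1 < numSites s by omega) b0
    rw [← hy] at b1 g1 m1
    refine ⟨y, Q1, b1, vertices P, r1 ▸ hs.leadsTo hP, le_rfl, ?_⟩
    rcases hF.exists_vertex_or_extreme hP he with h | rfl | rfl
    · exact .inr h
    · exact .inl (m1 _ (hT.gap_end _ hT.mem) g0)
    · exact .inl g1

end

/-! ### Traversing a ternary forest -/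

section

/-- `nb v k` is the `k`-th neighbour of the node `v` of a graph with nodes `1, …, n`, or `0`.  The
neighbours of `v` are in different components after the removal of `v`, namely `nb v k` is in the
one with the label `k`, where `sec v x` is the label of the component of `x`. -/
structure IsForest (n : ℕ) (nb : ℕ → Fin 3 → ℕ) (sec : ℕ → ℕ → Fin 3) : Prop where
  le : ∀ v k, 0 < v → v ≤ n → nb v k ≤ n
  ne : ∀ v k, 0 < v → v ≤ n → nb v k ≠ v
  symm : ∀ v k, 0 < v → v ≤ n → nb v k ≠ 0 → ∃ k', nb (nb v k) k' = v
  sec_nb : ∀ v k, 0 < v → v ≤ n → nb v k ≠ 0 → sec v (nb v k) = k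
  sec_eq : ∀ v x k, 0 < v → v ≤ n → 0 < x → x ≤ n → nb x k ≠ 0 → x ≠ v → nb x k ≠ v →
    sec v (nb x k) = sec v x

/-- The invariant of a breadth-first traversal of the part `U` of a forest from `r`.  The nodes
found so far are `L 0, …, L (m - 1)`, with parents `par`; all neighbours of the first `i` of them
and the first `k` neighbours of `L i` have been inspected. -/
structure Traversal (nb : ℕ → Fin 3 → ℕ) (U : Finset ℕ) (r : ℕ) (L par : ℕ → ℕ) (m i k : ℕ) :
    Prop where
  pos : 0 < m
  first : L 0 = r
  par_first : par r = 0
  mem : ∀ j < m, L j ∈ U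
  inj : ∀ j < m, ∀ j' < m, L j = L j' → j = j'
  parent : ∀ j < m, 0 < j → ∃ j' < j, par (L j) = L j' ∧ (∃ l, nb (L j') l = L j) ∧
    (j' < i ∨ j' = i ∧ ∃ l : Fin 3, l.val < k ∧ nb (L i) l = L j)
  done : ∀ j < m, ∀ l : Fin 3, (j < i ∨ j = i ∧ l.val < k) → nb (L j) l ∈ U →
    nb (L j) l = par (L j) ∨ ∃ j' < m, L j' = nb (L j) l ∧ par (L j') = L j

variable {n : ℕ} {nb : ℕ → Fin 3 → ℕ} {sec : ℕ → ℕ → Fin 3} {U : Finset ℕ} {r : ℕ}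
  {L par : ℕ → ℕ} {m i k : ℕ}

theorem Traversal.init (hL : L 0 = r) (hp : par r = 0) (hr : r ∈ U) :
    Traversal nb U r L par 1 0 0 where
  pos := one_pos
  first := hL
  par_first := hp
  mem j hj := by obtain rfl : j = 0 := by omega
                 rwa [hL]
  inj j hj j' hj' _ := by omega
  parent j hj h0 := by omega
  done j hj l h := by omega

theorem Traversal.next (h : Traversal nb U r L par m i 3) : Traversal nb U r L par m (i + 1) 0 where
  pos := h.pos
  first := h.first
  par_first := h.par_first
  mem := h.mem
  inj := h.inj
  parent j hj h0 := by
    obtain ⟨j', hj', h1, h2, h3⟩ := h.parent j hj h0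
    exact ⟨j', hj', h1, h2, .inl (by omega)⟩
  done j hj l hl := h.done j hj l (by have := l.2; omega)

theorem Traversal.le_card (h : Traversal nb U r L par m i k) : m ≤ U.card := by
  rw [← Finset.card_range m]
  exact Finset.card_le_card_of_injOn L (fun j hj => h.mem j (Finset.mem_range.1 hj))
    fun a ha b hb hab => h.inj a (Finset.mem_range.1 ha) b (Finset.mem_range.1 hb) hab

/-- Seen from `L i`, the nodes found earlier than its own children all have the label of the root,
for they are linked to the root by their ancestors, which precede `L i`. -/
theorem Traversal.sec_eq_root (hF : IsForest n nb sec) (hU : ∀ v ∈ U, 0 < v ∧ v ≤ n)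
    (h : Traversal nb U r L par m i k) (hi : i < m) (j : ℕ) (hj : j < m) (hji : j ≠ i)
    (hc : 0 < j → ∃ j' < j, j' < i ∧ ∃ l, nb (L j') l = L j) :
    sec (L i) (L j) = sec (L i) (L 0) := by
  induction j using Nat.strong_induction_on with
  | _ j ih =>
    rcases Nat.eq_zero_or_pos j with rfl | h0
    · rfl
    · obtain ⟨j', hj', hji', l, hl⟩ := hc h0
      have hj'm : j' < m := by omega
      have hv := hU _ (h.mem i hi)
      have hx := hU _ (h.mem j' hj'm)
      have hy := hU _ (h.mem j hj)
      have e := hF.sec_eq (L i) (L j') l hv.1 hv.2 hx.1 hx.2 (by rw [hl]; omega)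
        (fun e => by have := h.inj _ hj'm _ hi e; omega)
        (fun e => by rw [hl] at e; exact hji (h.inj _ hj _ hi e))
      rw [hl] at e
      rw [e]
      refine ih j' hj' hj'm (by omega) fun hpos => ?_
      obtain ⟨a, ha, -, hl', -⟩ := h.parent j' hj'm hpos
      exact ⟨a, ha, by omega, hl'⟩

/-- In a forest, the traversal finds no node twice. -/
theorem Traversal.not_found (hF : IsForest n nb sec) (hU : ∀ v ∈ U, 0 < v ∧ v ≤ n)
    (h : Traversal nb U r L par m i k) (hi : i < m) {l : Fin 3} (hl : l.val = k)
    (hy : nb (L i) l ∈ U) (hpar : nb (L i) l ≠ par (L i)) : ∀ j < m, L j ≠ nb (L i) l := by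
  intro j hj e
  have hv := hU _ (h.mem i hi)
  have hy0 : nb (L i) l ≠ 0 := (hU _ hy).1.ne'
  have hji : j ≠ i := by
    rintro rfl
    exact hF.ne _ _ hv.1 hv.2 e.symm
  -- `L j` and the parent of `L i` would be two neighbours of `L i` with the same label
  have key : 0 < i → sec (L i) (L j) = sec (L i) (L 0) → False := by
    intro hi0 hs
    obtain ⟨a, ha, hpa, ⟨l', hl'⟩, -⟩ := h.parent i hi hi0
    have ham : a < m := by omega
    have hx := hU _ (h.mem a ham)
    have hsa := h.sec_eq_root hF hU hi a ham (by omega) (fun ha0 => by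
      obtain ⟨b, hb, -, hlb, -⟩ := h.parent a ham ha0
      exact ⟨b, hb, by omega, hlb⟩)
    obtain ⟨l'', hl''⟩ := hF.symm (L a) l' hx.1 hx.2 (by rw [hl']; omega)
    rw [hl'] at hl''
    have s1 := hF.sec_nb (L i) l'' hv.1 hv.2 (by rw [hl'']; omega)
    have s2 := hF.sec_nb (L i) l hv.1 hv.2 hy0
    rw [hl''] at s1
    rw [← e] at s2
    have : l = l'' := by rw [← s1, ← s2, hs, hsa]
    rw [this, hl'', hpa] at hpar
    exact hpar rfl
  rcases Nat.eq_zero_or_pos j with rfl | h0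
  · exact key (by omega) rfl
  · obtain ⟨j', hj', hp, hl', hlt | ⟨rfl, l', hl'k, hl'e⟩⟩ := h.parent j hj h0
    · exact key (by omega) (h.sec_eq_root hF hU hi j hj hji fun _ => ⟨j', hj', hlt, hl'⟩)
    · have s1 := hF.sec_nb (L j') l' hv.1 hv.2 (by rw [hl'e, e]; exact hy0)
      have s2 := hF.sec_nb (L j') l hv.1 hv.2 hy0
      rw [hl'e] at s1
      rw [← e] at s2
      have : l' = l := s1.symm.trans s2
      omega

theorem Traversal.visit (hF : IsForest n nb sec) (hU : ∀ v ∈ U, 0 < v ∧ v ≤ n)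
    (h : Traversal nb U r L par m i k) (hi : i < m) {l : Fin 3} (hl : l.val = k)
    (hy : nb (L i) l ∈ U) (hpar : nb (L i) l ≠ par (L i)) :
    Traversal nb U r (Function.update L m (nb (L i) l))
      (Function.update par (nb (L i) l) (L i)) (m + 1) i (k + 1) := by
  have hnew := h.not_found hF hU hi hl hy hpar
  set y := nb (L i) l with hydef
  set L' := Function.update L m y with hL'
  set par' := Function.update par y (L i) with hpar'
  have eL : ∀ j, j < m → L' j = L j := fun j hj => Function.update_of_ne (by omega) _ _
  have eLm : L' m = y := Function.update_self _ _ _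
  have ep : ∀ j, j < m → par' (L j) = par (L j) :=
    fun j hj => Function.update_of_ne (hnew j hj) _ _
  have epy : par' y = L i := Function.update_self _ _ _
  refine ⟨by omega, ?_, ?_, ?_, ?_, ?_, ?_⟩
  · rw [eL 0 h.pos]; exact h.first
  · have := ep 0 h.pos
    rw [h.first] at this
    rw [this]; exact h.par_first
  · intro j hj
    rcases Nat.lt_succ_iff_lt_or_eq.1 hj with hj | rfl
    · rw [eL j hj]; exact h.mem j hj
    · rw [eLm]; exact hy
  · intro a ha b hb hab
    rcases Nat.lt_succ_iff_lt_or_eq.1 ha with ha | rfl <;>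
      rcases Nat.lt_succ_iff_lt_or_eq.1 hb with hb | rfl
    · rw [eL a ha, eL b hb] at hab; exact h.inj a ha b hb hab
    · rw [eL a ha, eLm] at hab; exact (hnew a ha hab).elim
    · rw [eL b hb, eLm] at hab; exact (hnew b hb hab.symm).elim
    · rfl
  · intro j hj h0
    rcases Nat.lt_succ_iff_lt_or_eq.1 hj with hj | rfl
    · obtain ⟨j', hj', h1, h2, h3⟩ := h.parent j hj h0
      refine ⟨j', hj', ?_, ?_, ?_⟩
      · rw [eL j hj, ep j hj, h1, eL j' (by omega)]
      · rw [eL j hj, eL j' (by omega)]; exact h2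
      · rw [eL i hi, eL j hj]
        rcases h3 with h3 | ⟨h3, l', hl', h4⟩
        · exact .inl h3
        · exact .inr ⟨h3, l', by omega, h4⟩
    · refine ⟨i, hi, ?_, ⟨l, ?_⟩, .inr ⟨rfl, l, by omega, ?_⟩⟩
      · rw [eLm, epy, eL i hi]
      · rw [eLm, eL i hi]
      · rw [eLm, eL i hi]
  · intro j hj l' hl' hU'
    have hjm : j < m := by omega
    rw [eL j hjm] at hU' ⊢
    rw [ep j hjm]
    by_cases hlast : j = i ∧ l' = l
    · obtain ⟨rfl, rfl⟩ := hlast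
      exact .inr ⟨m, by omega, eLm, by rw [eLm, epy]⟩
    · have : j < i ∨ j = i ∧ l'.val < k := by
        rcases hl' with hl' | ⟨rfl, hl'⟩
        · exact .inl hl'
        · refine .inr ⟨rfl, lt_of_le_of_ne (by omega) fun e => hlast ⟨rfl, Fin.ext (by omega)⟩⟩
      rcases h.done j hjm l' this hU' with hd | ⟨j', hj', h1, h2⟩
      · exact .inl hd
      · exact .inr ⟨j', by omega, by rw [eL j' hj', h1], by rw [eL j' hj', ep j' hj', h2]⟩

theorem Traversal.skip (h : Traversal nb U r L par m i k) {l : Fin 3} (hl : l.val = k)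
    (hs : nb (L i) l ∈ U → nb (L i) l = par (L i)) : Traversal nb U r L par m i (k + 1) where
  pos := h.pos
  first := h.first
  par_first := h.par_first
  mem := h.mem
  inj := h.inj
  parent j hj h0 := by
    obtain ⟨j', hj', h1, h2, h3⟩ := h.parent j hj h0
    refine ⟨j', hj', h1, h2, ?_⟩
    rcases h3 with h3 | ⟨h3, l', hl', h4⟩
    · exact .inl h3
    · exact .inr ⟨h3, l', by omega, h4⟩
  done j hj l' hl' hU' := by
    by_cases hlast : j = i ∧ l' = l
    · obtain ⟨rfl, rfl⟩ := hlast
      exact .inl (hs hU')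
    · refine h.done j hj l' ?_ hU'
      rcases hl' with hl' | ⟨rfl, hl'⟩
      · exact .inl hl'
      · exact .inr ⟨rfl, lt_of_le_of_ne (by omega) fun e => hlast ⟨rfl, Fin.ext (by omega)⟩⟩

/-- The outcome of a traversal: `L` enumerates `U`, and the edges of `U` join the nodes to their
parents, which come earlier. -/
structure Enumeration (nb : ℕ → Fin 3 → ℕ) (U : Finset ℕ) (L par pp : ℕ → ℕ) : Prop where
  mem : ∀ j < U.card, L j ∈ U
  inj : ∀ j < U.card, ∀ j' < U.card, L j = L j' → j = j'
  surj : ∀ v ∈ U, ∃ j < U.card, L j = v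
  lt : ∀ j < U.card, 0 < j → pp j < j
  par_eq : ∀ j < U.card, 0 < j → par (L j) = L (pp j)
  edge : ∀ a < U.card, ∀ b < U.card, ∀ l, nb (L a) l = L b →
    (0 < a ∧ pp a = b) ∨ (0 < b ∧ pp b = a)

theorem Traversal.enumeration (hU : ∀ v ∈ U, 0 < v) (h : Traversal nb U r L par m m 0)
    (hconn : ∀ A : Set ℕ, r ∈ A → (∀ v ∈ A, ∀ l, v ∈ U → nb v l ∈ U → nb v l ∈ A) →
      ∀ v ∈ U, v ∈ A) :
    m = U.card ∧ ∃ pp, Enumeration nb U L par pp := by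
  have hsurj : ∀ v ∈ U, ∃ j < m, L j = v := by
    refine hconn {v | ∃ j < m, L j = v} ⟨0, h.pos, h.first⟩ ?_
    rintro v ⟨j, hj, rfl⟩ l - hl
    rcases h.done j hj l (.inl hj) hl with hd | ⟨j', hj', h1, -⟩
    · rcases Nat.eq_zero_or_pos j with rfl | h0
      · rw [h.first] at hl hd
        rw [hd, h.par_first] at hl
        exact absurd (hU 0 hl) (lt_irrefl 0)
      · obtain ⟨j', hj', hp, -⟩ := h.parent j hj h0
        exact ⟨j', by omega, by rw [hd, hp]⟩
    · exact ⟨j', hj', h1⟩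
  have hm : m = U.card := by
    refine le_antisymm h.le_card ?_
    rw [← Finset.card_range m]
    refine Finset.card_le_card_of_surjOn L fun v hv => ?_
    obtain ⟨j, hj, e⟩ := hsurj v hv
    exact ⟨j, by simpa using hj, e⟩
  have hpar : ∀ j, ∃ j', j < m → 0 < j → j' < j ∧ par (L j) = L j' := by
    intro j
    by_cases hj : j < m ∧ 0 < j
    · obtain ⟨j', hj', hp, -⟩ := h.parent j hj.1 hj.2
      exact ⟨j', fun _ _ => ⟨hj', hp⟩⟩
    · exact ⟨0, fun h1 h2 => (hj ⟨h1, h2⟩).elim⟩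
  choose pp hpp using hpar
  refine ⟨hm, pp, ?_⟩
  subst hm
  refine ⟨h.mem, h.inj, hsurj, fun j hj h0 => (hpp j hj h0).1, fun j hj h0 => (hpp j hj h0).2, ?_⟩
  have hroot : ∀ j < U.card, par (L j) ∈ U → 0 < j := by
    intro j hj hp
    by_contra! hj0
    obtain rfl : j = 0 := by omega
    rw [h.first, h.par_first] at hp
    exact absurd (hU 0 hp) (lt_irrefl 0)
  have hup : ∀ a < U.card, ∀ b < U.card, par (L a) = L b → 0 < a ∧ pp a = b := by
    intro a ha b hb e
    have h0 := hroot a ha (e ▸ h.mem b hb)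
    obtain ⟨h1, h2⟩ := hpp a ha h0
    exact ⟨h0, h.inj _ (by omega) _ hb (by rw [← h2, e])⟩
  intro a ha b hb l e
  rcases h.done a ha l (.inl ha) (by rw [e]; exact h.mem b hb) with hd | ⟨j', hj', h1, h2⟩
  · exact .inl (hup a ha b hb (by rw [← hd, e]))
  · obtain rfl : j' = b := h.inj _ hj' _ hb (by rw [h1, e])
    exact .inr (hup j' hb a ha h2)

/-! ### Finding a centroid -/

/-- The invariant of the accumulation of subtree sizes in a tree with nodes `0, …, m - 1` and
parents `pp`.  The nodes after `i` have been merged into their ancestors: `f j` is the node into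
which `j` has been merged, and `sz` counts the nodes merged into a node.  What has been merged into
a node consists of parts with less than half of the nodes that no edge avoiding the node leaves. -/
structure Merging (m : ℕ) (pp sz f : ℕ → ℕ) (i : ℕ) : Prop where
  lt : i < m
  le : ∀ j < m, f j ≤ i
  fix : ∀ a ≤ i, f a = a
  size : ∀ a ≤ i, sz a = ((Finset.range m).filter fun j => f j = a).card
  edge : ∀ j < m, 0 < j → f j = f (pp j) ∨ j ≤ i
  small : ∀ j < m, f j ≠ j → ∃ A ⊆ Finset.range m, j ∈ A ∧ f j ∉ A ∧ 2 * A.card < m ∧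
    ∀ x < m, 0 < x → (x ∈ A → pp x ∈ A ∨ pp x = f j) ∧ (pp x ∈ A → x ∈ A)

theorem Merging.init {m : ℕ} {pp sz : ℕ → ℕ} (hm : 0 < m) (hsz : ∀ j < m, sz j = 1) :
    Merging m pp sz id (m - 1) where
  lt := by omega
  le j hj := by simp only [id]; omega
  fix _ _ := rfl
  size a ha := by
    rw [hsz a (by omega)]
    symm
    rw [Finset.card_eq_one]
    refine ⟨a, ?_⟩
    ext j
    simp only [id, Finset.mem_filter, Finset.mem_range, Finset.mem_singleton]
    omega
  edge j hj _ := .inr (by omega)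
  small j hj h := (h rfl).elim

theorem Merging.pos {m : ℕ} {pp sz f : ℕ → ℕ} (h : Merging m pp sz f i) (hlt : 2 * sz i < m) :
    0 < i := by
  by_contra! h0
  obtain rfl : i = 0 := by omega
  rw [h.size 0 le_rfl, Finset.filter_true_of_mem, Finset.card_range] at hlt
  · omega
  · intro j hj
    have := h.le j (Finset.mem_range.1 hj)
    omega

theorem Merging.step {m : ℕ} {pp sz f : ℕ → ℕ} (hpp : ∀ j < m, 0 < j → pp j < j)
    (h : Merging m pp sz f i) (hlt : 2 * sz i < m) {sz' : ℕ → ℕ}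
    (hsz : sz' (pp i) = sz (pp i) + sz i) (hsz' : ∀ a < i, a ≠ pp i → sz' a = sz a) :
    Merging m pp sz' (fun j => if f j = i then pp i else f j) (i - 1) := by
  have hi := h.pos hlt
  have hpi := hpp i h.lt hi
  have hfp : f (pp i) = pp i := h.fix _ (by omega)
  refine ⟨by have := h.lt; omega, ?_, ?_, ?_, ?_, ?_⟩
  · intro j hj
    have := h.le j hj
    split_ifs <;> omega
  · intro a ha
    have := h.fix a (by omega)
    rw [this, if_neg (by omega)]
  · intro a ha
    by_cases hai : a = pp i
    · subst hai
      rw [hsz, h.size _ (by omega), h.size i le_rfl, ← Finset.card_union_of_disjoint]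
      · congr 1
        ext j
        simp only [Finset.mem_union, Finset.mem_filter, Finset.mem_range]
        split_ifs <;> omega
      · rw [Finset.disjoint_left]
        intro j h1 h2
        rw [Finset.mem_filter] at h1 h2
        omega
    · rw [hsz' a (by omega) hai, h.size a (by omega)]
      congr 1
      ext j
      simp only [Finset.mem_filter, Finset.mem_range]
      split_ifs <;> omega
  · intro j hj h0
    rcases h.edge j hj h0 with he | he
    · exact .inl (by rw [he])
    · by_cases hji : j = i
      · subst hji
        left
        rw [if_pos (h.fix j le_rfl), hfp, if_neg (by omega)]
      · exact .inr (by omega)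
  · intro j hj hne
    by_cases hfi : f j = i
    · rw [if_pos hfi] at hne ⊢
      refine ⟨(Finset.range m).filter fun x => f x = i, Finset.filter_subset _ _,
        Finset.mem_filter.2 ⟨Finset.mem_range.2 hj, hfi⟩, fun hc => ?_, ?_, fun x hx h0 => ?_⟩
      · have := (Finset.mem_filter.1 hc).2
        omega
      · rw [← h.size i le_rfl]; exact hlt
      · simp only [Finset.mem_filter, Finset.mem_range]
        have hlt' := hpp x hx h0
        rcases h.edge x hx h0 with he | he
        · rw [he]
          exact ⟨fun hx' => .inl ⟨by omega, hx'.2⟩, fun hx' => ⟨hx, hx'.2⟩⟩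
        · rw [h.fix x he, h.fix (pp x) (by omega)]
          refine ⟨fun hx' => .inr (by rw [hx'.2]), fun hx' => by omega⟩
    · rw [if_neg hfi] at hne ⊢
      exact h.small j hj hne

/-- When the last node with at least half of the nodes merged into it is found, its removal leaves
only parts with at most half of the nodes. -/
theorem Merging.centroid {m : ℕ} {pp sz f : ℕ → ℕ} (hpp : ∀ j < m, 0 < j → pp j < j)
    (h : Merging m pp sz f i) (hge : ¬ 2 * sz i < m) (j : ℕ) (hj : j < m) (hji : j ≠ i) :
    ∃ A ⊆ Finset.range m, j ∈ A ∧ i ∉ A ∧ 2 * A.card ≤ m ∧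
      ∀ x < m, 0 < x → x ≠ i → pp x ≠ i → (x ∈ A ↔ pp x ∈ A) := by
  by_cases hfi : f j = i
  · obtain ⟨A, hA, hjA, hiA, hcard, hcl⟩ := h.small j hj (by omega)
    rw [hfi] at hiA hcl
    exact ⟨A, hA, hjA, hiA, hcard.le, fun x hx h0 _ hpx =>
      ⟨fun hxA => ((hcl x hx h0).1 hxA).resolve_right hpx, (hcl x hx h0).2⟩⟩
  · refine ⟨(Finset.range m).filter fun x => ¬ f x = i, Finset.filter_subset _ _,
      Finset.mem_filter.2 ⟨Finset.mem_range.2 hj, hfi⟩, fun hc => ?_, ?_, fun x hx h0 hxi hpx => ?_⟩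
    · exact (Finset.mem_filter.1 hc).2 (h.fix i le_rfl)
    · have := Finset.card_filter_add_card_filter_not (s := Finset.range m) (fun x => f x = i)
      rw [← h.size i le_rfl, Finset.card_range] at this
      omega
    · simp only [Finset.mem_filter, Finset.mem_range]
      have hlt' := hpp x hx h0
      rcases h.edge x hx h0 with he | he
      · rw [he]
        exact ⟨fun hx' => ⟨by omega, hx'.2⟩, fun hx' => ⟨hx, hx'.2⟩⟩
      · rw [h.fix x he, h.fix (pp x) (by omega)]
        exact ⟨fun _ => ⟨by omega, hpx⟩, fun _ => ⟨hx, hxi⟩⟩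

end

/-! ### The stored diagram as a forest of pointers -/

section

variable {P : Finset Pt} {w x q : Pt} {p : Fin 3 → Pt}

/-- The vertex to which the pointer `v` leads. -/
noncomputable def ptr (s : State) (v : ℕ) : Pt := vertex s (v - 1)

/-- The owners of the vertex to which the pointer `v` leads. -/
noncomputable def ptrOwners (s : State) (v : ℕ) (k : Fin 3) : Pt := site s (own s (v - 1) k)

/-- The neighbours, as pointers, of the vertex to which the pointer `v` leads. -/
def ptrNbr (s : State) (v : ℕ) (k : Fin 3) : ℕ := nbr s (v - 1) k

/-- The set of vertices to which the pointers in `U` lead. -/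
def ptrs (s : State) (U : Finset ℕ) : Set Pt := ptr s '' U

section forest

variable {s : State} {v y : ℕ}

theorem StoresFVD.owners (h : StoresFVD P s) (hv : 0 < v) (hn : v ≤ numVertices s) :
    Owners P (ptr s v) (ptrOwners s v) :=
  h.1.owners (by omega)

theorem StoresFVD.ptr_inj (h : StoresFVD P s) (hv : 0 < v) (hn : v ≤ numVertices s) (hy : 0 < y)
    (hyn : y ≤ numVertices s) (e : ptr s v = ptr s y) : v = y := by
  have := h.1.vertex_inj (show v - 1 < numVertices s by omega)
    (show y - 1 < numVertices s by omega) e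
  omega

theorem StoresFVD.ptrNbr_eq_iff (h : StoresFVD P s) (hv : 0 < v) (hn : v ≤ numVertices s)
    (hy : 0 < y) {k : Fin 3} : ptrNbr s v k = y ↔ y ≤ numVertices s ∧ y ≠ v ∧
      ptr s y ∈ edge P (ptrOwners s v (k + 1)) (ptrOwners s v (k + 2)) := by
  have := h.2 (v - 1) (by omega) k (y - 1)
  rw [show y - 1 + 1 = y by omega] at this
  rw [ptrNbr, this, ptr, ptrOwners, ptrOwners]
  have e1 : y - 1 < numVertices s ↔ y ≤ numVertices s := by omega
  have e2 : y - 1 ≠ v - 1 ↔ y ≠ v := by omega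
  rw [e1, e2]

theorem StoresFVD.adj_iff (hP : NoFourCocircular P) (h : StoresFVD P s) (hv : 0 < v)
    (hn : v ≤ numVertices s) (hy : 0 < y) (hyn : y ≤ numVertices s) :
    (graph P).Adj (ptr s v) (ptr s y) ↔ ∃ k, ptrNbr s v k = y := by
  constructor
  · intro ha
    obtain ⟨k, hk⟩ := exists_mem_edge_of_adj hP (h.owners hv hn) ha
    exact ⟨k, (h.ptrNbr_eq_iff hv hn hy).2 ⟨hyn, by rintro rfl; exact ha.1 rfl, hk⟩⟩
  · rintro ⟨k, hk⟩
    obtain ⟨-, hne, he⟩ := (h.ptrNbr_eq_iff hv hn hy).1 hk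
    exact adj_of_mem_edge (h.owners hv hn) (h.owners hy hyn).mem_vertices
      (fun e => hne (h.ptr_inj hy hyn hv hn e)) he

theorem StoresFVD.isForest (hP : NoFourCocircular P) (h : StoresFVD P s) :
    IsForest (numVertices s) (ptrNbr s) fun v x => sector (ptr s v) (ptrOwners s v) (ptr s x) := by
  have hle : ∀ v k, 0 < v → v ≤ numVertices s → ptrNbr s v k ≤ numVertices s := by
    intro v k hv hn
    rcases Nat.eq_zero_or_pos (ptrNbr s v k) with h0 | h0
    · omega
    · exact ((h.ptrNbr_eq_iff hv hn h0).1 rfl).1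
  refine ⟨hle, ?_, ?_, ?_, ?_⟩
  · intro v k hv hn e
    exact ((h.ptrNbr_eq_iff hv hn hv).1 e).2.1 rfl
  · intro v k hv hn h0
    have h0 := Nat.pos_of_ne_zero h0
    exact (h.adj_iff hP h0 (hle v k hv hn) hv hn).1
      ((h.adj_iff hP hv hn h0 (hle v k hv hn)).2 ⟨k, rfl⟩).symm
  · intro v k hv hn h0
    have h0 := Nat.pos_of_ne_zero h0
    obtain ⟨hyn, hne, he⟩ := (h.ptrNbr_eq_iff hv hn h0).1 rfl
    exact sector_of_mem_edge (h.owners hv hn) (h.owners h0 hyn).mem_vertices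
      (fun e => hne (h.ptr_inj h0 hyn hv hn e)) he
  · intro v x k hv hn hx hxn h0 hxv hyv
    have h0 := Nat.pos_of_ne_zero h0
    have hyn := hle x k hx hxn
    exact (sector_eq_of_adj (h.owners hv hn) ((h.adj_iff hP hx hxn h0 hyn).2 ⟨k, rfl⟩)
      (fun e => hxv (h.ptr_inj hx hxn hv hn e)) (fun e => hyv (h.ptr_inj h0 hyn hv hn e))).symm

end forest

/-- A connected part of the diagram, given by its set `U` of pointers. -/
structure Part (P : Finset Pt) (s : State) (U : Finset ℕ) : Prop where
  pos : ∀ v ∈ U, 0 < v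
  le : ∀ v ∈ U, v ≤ numVertices s
  conn : Conn P (ptrs s U)

section part

variable {s : State} {U : Finset ℕ}

theorem Part.subset (hs : StoresFVD P s) (h : Part P s U) : ptrs s U ⊆ vertices P := by
  rintro _ ⟨v, hv, rfl⟩
  exact (hs.owners (h.pos v hv) (h.le v hv)).mem_vertices

theorem Part.ncard (hs : StoresFVD P s) (h : Part P s U) : (ptrs s U).ncard = U.card := by
  rw [ptrs, Set.InjOn.ncard_image, Set.ncard_coe_finset]
  intro v hv y hy e
  exact hs.ptr_inj (h.pos v hv) (h.le v hv) (h.pos y hy) (h.le y hy) e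

theorem Part.closed (hP : NoFourCocircular P) (hs : StoresFVD P s) (h : Part P s U) {r : ℕ}
    (hr : r ∈ U) (A : Set ℕ) (hrA : r ∈ A)
    (hA : ∀ v ∈ A, ∀ l, v ∈ U → ptrNbr s v l ∈ U → ptrNbr s v l ∈ A) : ∀ v ∈ U, v ∈ A := by
  have key : ∀ y, Linked P (ptrs s U) (ptr s r) y → ∃ v ∈ U, v ∈ A ∧ ptr s v = y := by
    intro y hy
    induction hy with
    | refl => exact ⟨r, hr, hrA, rfl⟩
    | tail _ hbc ih =>
      obtain ⟨v, hv, hvA, rfl⟩ := ih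
      obtain ⟨-, ⟨y, hy, rfl⟩, hadj⟩ := hbc
      obtain ⟨k, rfl⟩ := (hs.adj_iff hP (h.pos v hv) (h.le v hv) (h.pos y hy) (h.le y hy)).1 hadj
      exact ⟨_, hy, hA v hvA k hv hy, rfl⟩
  intro v hv
  obtain ⟨y, hy, hyA, e⟩ := key _ (h.conn _ ⟨r, hr, rfl⟩ _ ⟨v, hv, rfl⟩)
  rwa [← hs.ptr_inj (h.pos y hy) (h.le y hy) (h.pos v hv) (h.le v hv) e]

theorem Part.isCentroid (hP : NoFourCocircular P) (hs : StoresFVD P s) (h : Part P s U)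
    {L par pp sz f : ℕ → ℕ} {i : ℕ} (hE : Enumeration (ptrNbr s) U L par pp)
    (hM : Merging U.card pp sz f i) (hge : ¬ 2 * sz i < U.card) :
    IsCentroid P (ptrs s U) (ptr s (L i)) := by
  refine ⟨⟨_, hE.mem i hM.lt, rfl⟩, ?_⟩
  rintro _ ⟨⟨v, hv, rfl⟩, hvw⟩
  obtain ⟨j, hj, rfl⟩ := hE.surj v hv
  have hji : j ≠ i := by rintro rfl; exact hvw rfl
  obtain ⟨A, hA, hjA, -, hcard, hcl⟩ := hM.centroid hE.lt hge j hj hji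
  have hsub : component P (ptrs s U) (ptr s (L i)) (ptr s (L j)) ⊆ (fun j => ptr s (L j)) '' A := by
    refine component_subset ⟨j, hjA, rfl⟩ ?_
    rintro _ ⟨a, ha, rfl⟩ _ ⟨y, hy, rfl⟩ - hai hbi hadj
    obtain ⟨b, hb, rfl⟩ := hE.surj y hy
    have ham : a < U.card := Finset.mem_range.1 (hA ha)
    have hLa := hE.mem a ham
    obtain ⟨l, hl⟩ := (hs.adj_iff hP (h.pos _ hLa) (h.le _ hLa) (h.pos _ hy) (h.le _ hy)).1 hadj
    have hai' : a ≠ i := by rintro rfl; exact hai rfl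
    have hbi' : b ≠ i := by rintro rfl; exact hbi rfl
    refine ⟨b, ?_, rfl⟩
    rcases hE.edge a ham b hb l hl with ⟨h0, rfl⟩ | ⟨h0, rfl⟩
    · exact (hcl a ham h0 hai' hbi').1 ha
    · exact (hcl b hb h0 hbi' hai').2 ha
  rw [h.ncard hs]
  have h1 := Set.ncard_le_ncard hsub (A.finite_toSet.image _)
  have h2 := Set.ncard_image_le (f := fun j => ptr s (L j)) A.finite_toSet
  rw [Set.ncard_coe_finset] at h2
  omega

open Classical in
/-- The pointers to the vertices in the branch opposite to the `k`-th owner of `w`. -/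
noncomputable def subPart (P : Finset Pt) (s : State) (U : Finset ℕ) (w : ℕ) (k : Fin 3) :
    Finset ℕ :=
  U.filter fun v =>
    ptr s v ∈ branch P (ptrs s U) (ptr s w) (ptrOwners s w (k + 1)) (ptrOwners s w (k + 2))

variable {w v : ℕ} {k : Fin 3}

theorem mem_subPart : v ∈ subPart P s U w k ↔ v ∈ U ∧ ptr s v ∈
    branch P (ptrs s U) (ptr s w) (ptrOwners s w (k + 1)) (ptrOwners s w (k + 2)) := by
  classical exact Finset.mem_filter

theorem subPart_subset : subPart P s U w k ⊆ U := fun _ h => (mem_subPart.1 h).1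

theorem not_mem_subPart : w ∉ subPart P s U w k := fun h =>
  (branch_subset (mem_subPart.1 h).2).2 rfl

theorem ptrs_subPart : ptrs s (subPart P s U w k)
    = branch P (ptrs s U) (ptr s w) (ptrOwners s w (k + 1)) (ptrOwners s w (k + 2)) := by
  ext x
  constructor
  · rintro ⟨v, hv, rfl⟩
    exact (mem_subPart.1 hv).2
  · intro hx
    obtain ⟨v, hv, rfl⟩ := (branch_subset hx).1
    exact ⟨v, mem_subPart.2 ⟨hv, hx⟩, rfl⟩

theorem Part.subPart (hs : StoresFVD P s) (h : Part P s U) (hw : w ∈ U) (k : Fin 3) :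
    Part P s (subPart P s U w k) where
  pos v hv := h.pos v (subPart_subset hv)
  le v hv := h.le v (subPart_subset hv)
  conn := by
    rw [ptrs_subPart]
    exact branch_conn (hs.owners (h.pos w hw) (h.le w hw)) (h.subset hs) k

theorem Part.subPart_closed (hP : NoFourCocircular P) (hs : StoresFVD P s) (h : Part P s U)
    (hv : v ∈ FVD.subPart P s U w k) {l : Fin 3} (hy : ptrNbr s v l ∈ U)
    (hyw : ptr s (ptrNbr s v l) ≠ ptr s w) : ptrNbr s v l ∈ FVD.subPart P s U w k := by
  obtain ⟨hvU, z, hz, hvz⟩ := mem_subPart.1 hv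
  have hadj := (hs.adj_iff hP (h.pos v hvU) (h.le v hvU) (h.pos _ hy) (h.le _ hy)).2 ⟨l, rfl⟩
  exact mem_subPart.2 ⟨hy, z, hz, component_closed hvz ⟨_, hy, rfl⟩ hyw hadj⟩

theorem Part.subPart_disjoint (hs : StoresFVD P s) (h : Part P s U) (hw : w ∈ U) {k' : Fin 3}
    (hv : v ∈ FVD.subPart P s U w k) (hv' : v ∈ FVD.subPart P s U w k') : k = k' := by
  have ho := hs.owners (h.pos w hw) (h.le w hw)
  rw [← sector_of_mem_branch ho (h.subset hs) (mem_subPart.1 hv).2,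
    ← sector_of_mem_branch ho (h.subset hs) (mem_subPart.1 hv').2]

theorem Part.ptrNbr_mem_subPart (hs : StoresFVD P s) (h : Part P s U) (hw : w ∈ U)
    (hy : ptrNbr s w k ∈ U) : ptrNbr s w k ∈ FVD.subPart P s U w k := by
  obtain ⟨hyn, hne, he⟩ :=
    (hs.ptrNbr_eq_iff (h.pos w hw) (h.le w hw) (h.pos _ hy) (k := k)).1 rfl
  exact mem_subPart.2 ⟨hy, _, he, self_mem_component ⟨_, hy, rfl⟩
    fun e => hne (hs.ptr_inj (h.pos _ hy) hyn (h.pos w hw) (h.le w hw) e)⟩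

theorem Part.subPart_eq_empty (hs : StoresFVD P s) (h : Part P s U) (hw : w ∈ U)
    (hy : ptrNbr s w k ∉ U) : FVD.subPart P s U w k = ∅ := by
  have ho := hs.owners (h.pos w hw) (h.le w hw)
  rcases branch_eq_empty_or ho (h.subset hs) k with he | ⟨_, ⟨y, hyU, rfl⟩, hyw, hye, -⟩
  · have := ptrs_subPart (P := P) (s := s) (U := U) (w := w) (k := k)
    rw [he, ptrs, Set.image_eq_empty, Finset.coe_eq_empty] at this
    exact this
  · refine (hy ?_).elim
    rw [(hs.ptrNbr_eq_iff (h.pos w hw) (h.le w hw) (h.pos y hyU)).2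
      ⟨h.le y hyU, fun e => hyw (by rw [e]), hye⟩]
    exact hyU

theorem Part.two_mul_card_subPart_le (hs : StoresFVD P s) (h : Part P s U) (hw : w ∈ U)
    (hc : IsCentroid P (ptrs s U) (ptr s w)) (k : Fin 3) :
    2 * (FVD.subPart P s U w k).card ≤ U.card := by
  rw [← h.ncard hs, ← (h.subPart hs hw k).ncard hs, ptrs_subPart]
  exact two_mul_ncard_branch_le (hs.owners (h.pos w hw) (h.le w hw)) (h.subset hs) hc k

theorem Part.sum_card_subPart_le (hs : StoresFVD P s) (h : Part P s U) (hw : w ∈ U) :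
    (FVD.subPart P s U w 0).card + (FVD.subPart P s U w 1).card + (FVD.subPart P s U w 2).card
      ≤ U.card := by
  have hd : ∀ k k' : Fin 3, k ≠ k' →
      Disjoint (FVD.subPart P s U w k) (FVD.subPart P s U w k') := fun k k' hne =>
    Finset.disjoint_left.2 fun v hv hv' => hne (h.subPart_disjoint hs hw hv hv')
  rw [← Finset.card_union_of_disjoint (hd 0 1 (by decide)), ← Finset.card_union_of_disjoint
    (Finset.disjoint_union_left.2 ⟨hd 0 2 (by decide), hd 1 2 (by decide)⟩)]
  exact Finset.card_le_card (Finset.union_subset (Finset.union_subset subPart_subset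
    subPart_subset) subPart_subset)

end part

end

/-! ### The construction: finding a centroid of a part

Arrays: `3` flags the pointers of vertices that have already been placed (and the null pointer);
`4` is the list of a traversal; `5` and `6` hold the parents and the subtree sizes; `7` and `8` form
a stack of parts that remain to be decomposed, each given by one of its pointers and the address of
the child pointer to be set.  Registers: `4` height of the stack, `5` length of the list, `6`
position in the list, `7` current pointer, `8` address of the child pointer, `10` three times the
index of the current vertex. -/

section

/-- Set register `10` to three times the index of the vertex to which register `7` points. -/
def setBase : Cmd :=
  .nset 10 (.add (.sub (.var 7) (.lit 1)) (.add (.sub (.var 7) (.lit 1)) (.sub (.var 7) (.lit 1))))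

/-- Append the `k`-th neighbour of the current vertex to the list, unless it has been placed or is
the parent. -/
def visit (k : ℕ) : Cmd :=
  .seq (.nset 9 (.get 1 (.add (.var 10) (.lit k))))
    (.ite (.and (.neq (.get 3 (.var 9)) (.lit 0)) (.not (.neq (.var 9) (.get 5 (.var 7)))))
      (.seq (.nput 4 (.var 5) (.var 9))
      (.seq (.nput 5 (.var 9) (.var 7))
      (.seq (.nput 6 (.var 9) (.lit 1))
        (.nset 5 (.add (.var 5) (.lit 1))))))
      .skip)

/-- One round of the traversal. -/
def traverseStep : Cmd :=
  .seq (.nset 7 (.get 4 (.var 6)))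
  (.seq setBase
  (.seq (visit 0) (.seq (visit 1) (.seq (visit 2) (.nset 6 (.add (.var 6) (.lit 1)))))))

/-- Pop a part from the stack and prepare its traversal. -/
def popPart : Cmd :=
  .seq (.nset 4 (.sub (.var 4) (.lit 1)))
  (.seq (.nset 7 (.get 7 (.var 4)))
  (.seq (.nset 8 (.get 8 (.var 4)))
  (.seq (.nput 4 (.lit 0) (.var 7))
  (.seq (.nput 5 (.var 7) (.lit 0))
  (.seq (.nput 6 (.var 7) (.lit 1))
  (.seq (.nset 5 (.lit 1)) (.nset 6 (.lit 0))))))))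

/-- Twice the size of the current subtree is less than the size of the part. -/
def isSmall : BExp :=
  .nlt (.add (.get 6 (.get 4 (.var 6))) (.get 6 (.get 4 (.var 6)))) (.var 5)

/-- Add the size of the current subtree to that of the parent, and go to the previous vertex. -/
def mergeStep : Cmd :=
  .seq (.nset 9 (.get 4 (.var 6)))
  (.seq (.nset 10 (.get 5 (.var 9)))
  (.seq (.nput 6 (.var 10) (.add (.get 6 (.var 10)) (.get 6 (.var 9))))
    (.nset 6 (.sub (.var 6) (.lit 1)))))

/-- Pop a part from the stack and find a centroid. -/
def findCentroid : Cmd :=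
  .seq popPart
  (.seq (.loop (.nlt (.var 6) (.var 5)) traverseStep)
  (.seq (.nset 6 (.sub (.var 5) (.lit 1)))
    (.loop isSmall mergeStep)))

/-- `s'` differs from `s` only in the natural-number registers in `N`, the natural-number arrays
in `A`, and the real registers. -/
structure Frame (N A : List ℕ) (s s' : State) : Prop where
  nv : ∀ j, j ∉ N → s'.nv j = s.nv j
  na : ∀ a, a ∉ A → s'.na a = s.na a
  ra : s'.ra = s.ra

theorem Frame.refl (N A : List ℕ) (s : State) : Frame N A s s :=
  ⟨fun _ _ => rfl, fun _ _ => rfl, rfl⟩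

theorem Frame.trans {N A : List ℕ} {s s' s'' : State} (h : Frame N A s s')
    (h' : Frame N A s' s'') : Frame N A s s'' :=
  ⟨fun j hj => (h'.nv j hj).trans (h.nv j hj), fun a ha => (h'.na a ha).trans (h.na a ha),
    h'.ra.trans h.ra⟩

theorem Frame.mono {N A N' A' : List ℕ} {s s' : State} (h : Frame N A s s') (hN : N ⊆ N')
    (hA : A ⊆ A') : Frame N' A' s s' :=
  ⟨fun j hj => h.nv j fun h => hj (hN h), fun a ha => h.na a fun h => ha (hA h), h.ra⟩

/-- The state of a traversal of `U` from `r` that began in the state `s₁`. -/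
structure Traversing (nb : ℕ → Fin 3 → ℕ) (U : Finset ℕ) (r : ℕ) (s₁ s : State) (i k : ℕ) :
    Prop where
  frame : Frame [5, 6, 7, 9, 10] [4, 5, 6] s₁ s
  trav : Traversal nb U r (s.na 4) (s.na 5) (s.nv 5) i k
  size : ∀ j < s.nv 5, s.na 6 (s.na 4 j) = 1
  idx : s.nv 6 = i

variable {P : Finset Pt} {s₀ s₁ s : State} {U : Finset ℕ} {r i : ℕ}

theorem visit_sem (hP : NoFourCocircular P) (h₀ : StoresFVD P s₀) (hU : Part P s₀ U)
    (hnb : s₁.na 1 = s₀.na 1)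
    (hfree : ∀ v ∈ U, ∀ l, s₁.na 3 (ptrNbr s₀ v l) = 0 ↔ ptrNbr s₀ v l ∈ U) {l : Fin 3}
    (h : Traversing (ptrNbr s₀) U r s₁ s i l) (hi : i < s.nv 5) (h7 : s.nv 7 = s.na 4 i)
    (h10 : s.nv 10 = 3 * (s.na 4 i - 1)) :
    Traversing (ptrNbr s₀) U r s₁ ((visit l).sem s) i (l + 1) ∧ i < ((visit l).sem s).nv 5 ∧
      ((visit l).sem s).nv 7 = ((visit l).sem s).na 4 i ∧
      ((visit l).sem s).nv 10 = 3 * (((visit l).sem s).na 4 i - 1) := by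
  have hv := h.trav.mem i hi
  have e1 : s.na 1 = s₀.na 1 := (h.frame.na 1 (by decide)).trans hnb
  have e3 : s.na 3 = s₁.na 3 := h.frame.na 3 (by decide)
  set v := s.na 4 i with hvdef
  set y := ptrNbr s₀ v l with hy
  have ey : s.na 1 (3 * (v - 1) + l) = y := by rw [e1]; rfl
  set s' : State := { s with nv := Function.update s.nv 9 y } with hs'
  have es' : (Cmd.nset 9 (.get 1 (.add (.var 10) (.lit l)))).sem s = s' := by
    simp only [Cmd.sem, NExp.eval, h10, ey, hs']
  have esem : (visit l).sem s = (Cmd.ite (.and (.neq (.get 3 (.var 9)) (.lit 0))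
      (.not (.neq (.var 9) (.get 5 (.var 7))))) (.seq (.nput 4 (.var 5) (.var 9))
      (.seq (.nput 5 (.var 9) (.var 7)) (.seq (.nput 6 (.var 9) (.lit 1))
        (.nset 5 (.add (.var 5) (.lit 1)))))) .skip).sem s' := by
    rw [← es']; rfl
  have hcond : (BExp.and (.neq (.get 3 (.var 9)) (.lit 0))
      (.not (.neq (.var 9) (.get 5 (.var 7))))).eval s' ↔ y ∈ U ∧ y ≠ s.na 5 v := by
    simp only [BExp.eval, NExp.eval, hs', Function.update_self, h7, e3, hfree v hv,
      Function.update_of_ne (show (7 : ℕ) ≠ 9 by decide), hy, ne_eq]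
  rw [esem]
  by_cases hc : y ∈ U ∧ y ≠ s.na 5 v
  · rw [Cmd.sem_ite_pos (hcond.2 hc)]
    have hT := h.trav.visit (h₀.isForest hP) (fun v hv => ⟨hU.pos v hv, hU.le v hv⟩) hi rfl hc.1
      hc.2
    have hnew := h.trav.not_found (h₀.isForest hP) (fun v hv => ⟨hU.pos v hv, hU.le v hv⟩) hi rfl
      hc.1 hc.2
    have eL : Function.update (s.na 4) (s.nv 5) y i = s.na 4 i :=
      Function.update_of_ne (by omega) _ _
    set s'' : State := ⟨Function.update (Function.update s.nv 9 y) 5 (s.nv 5 + 1), s.rv,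
      Function.update (Function.update (Function.update s.na 4
        (Function.update (s.na 4) (s.nv 5) y)) 5 (Function.update (s.na 5) y v)) 6
        (Function.update (s.na 6) y 1), s.ra⟩ with hs''
    have e'' : (Cmd.seq (.nput 4 (.var 5) (.var 9)) (.seq (.nput 5 (.var 9) (.var 7))
        (.seq (.nput 6 (.var 9) (.lit 1)) (.nset 5 (.add (.var 5) (.lit 1)))))).sem s' = s'' := by
      simp [Cmd.sem, NExp.eval, hs', hs'', h7]
    rw [e'']
    have n4 : s''.na 4 = Function.update (s.na 4) (s.nv 5) y := by simp [hs'']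
    have n5 : s''.na 5 = Function.update (s.na 5) y v := by simp [hs'']
    have n6 : s''.na 6 = Function.update (s.na 6) y 1 := by simp [hs'']
    have v5 : s''.nv 5 = s.nv 5 + 1 := by simp [hs'']
    refine ⟨⟨h.frame.trans ⟨fun j hj => ?_, fun a ha => ?_, rfl⟩, ?_, ?_, ?_⟩, ?_, ?_, ?_⟩
    · simp only [List.mem_cons, not_or] at hj
      simp [hs'', hj]
    · simp only [List.mem_cons, not_or] at ha
      simp [hs'', ha]
    · rw [n4, n5, v5]; exact hT
    · intro j hj
      rw [v5] at hj
      rw [n4, n6]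
      rcases Nat.lt_succ_iff_lt_or_eq.1 hj with hj | rfl
      · rw [Function.update_of_ne (show j ≠ s.nv 5 by omega), Function.update_of_ne (hnew j hj)]
        exact h.size j hj
      · simp
    · rw [← h.idx]; simp [hs'']
    · rw [v5]; omega
    · rw [n4, eL, ← hvdef, ← h7]; simp [hs'']
    · rw [n4, eL, ← hvdef, ← h10]; simp [hs'']
  · rw [Cmd.sem_ite_neg fun hh => hc (hcond.1 hh)]
    refine ⟨⟨h.frame.trans ⟨fun j hj => ?_, fun a ha => rfl, rfl⟩, ?_, ?_, ?_⟩, ?_, ?_, ?_⟩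
    · simp only [List.mem_cons, not_or] at hj
      simp [Cmd.sem, hs', hj]
    · have := h.trav.skip (l := l) rfl fun hyU => by
        by_contra hne; exact hc ⟨hyU, hne⟩
      simpa [Cmd.sem, hs'] using this
    · simpa [Cmd.sem, hs'] using h.size
    · simpa [Cmd.sem, hs'] using h.idx
    · simpa [Cmd.sem, hs'] using hi
    · simpa [Cmd.sem, hs'] using h7
    · simpa [Cmd.sem, hs'] using h10

theorem traverseStep_sem (hP : NoFourCocircular P) (h₀ : StoresFVD P s₀) (hU : Part P s₀ U)
    (hnb : s₁.na 1 = s₀.na 1)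
    (hfree : ∀ v ∈ U, ∀ l, s₁.na 3 (ptrNbr s₀ v l) = 0 ↔ ptrNbr s₀ v l ∈ U)
    (h : Traversing (ptrNbr s₀) U r s₁ s i 0) (hi : i < s.nv 5) :
    Traversing (ptrNbr s₀) U r s₁ (traverseStep.sem s) (i + 1) 0 ∧
      i + 1 ≤ (traverseStep.sem s).nv 5 := by
  set t0 := setBase.sem ((Cmd.nset 7 (.get 4 (.var 6))).sem s) with ht0
  have T0 : Traversing (ptrNbr s₀) U r s₁ t0 i 0 := by
    refine ⟨h.frame.trans ⟨fun j hj => ?_, fun a ha => rfl, rfl⟩, ?_, ?_, ?_⟩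
    · simp only [List.mem_cons, not_or] at hj
      simp [ht0, Cmd.sem, setBase, hj]
    · simpa [ht0, Cmd.sem, setBase] using h.trav
    · simpa [ht0, Cmd.sem, setBase] using h.size
    · simpa [ht0, Cmd.sem, setBase] using h.idx
  have i0 : i < t0.nv 5 := by simpa [ht0, Cmd.sem, setBase] using hi
  have v0 : t0.nv 7 = t0.na 4 i := by simp [ht0, Cmd.sem, setBase, NExp.eval, h.idx]
  have b0 : t0.nv 10 = 3 * (t0.na 4 i - 1) := by
    simp only [ht0, Cmd.sem, setBase, NExp.eval, h.idx, Function.update_self]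
    omega
  obtain ⟨T1, i1, v1, b1⟩ := visit_sem (l := 0) hP h₀ hU hnb hfree T0 i0 v0 b0
  obtain ⟨T2, i2, v2, b2⟩ := visit_sem (l := 1) hP h₀ hU hnb hfree T1 i1 v1 b1
  obtain ⟨T3, i3, v3, b3⟩ := visit_sem (l := 2) hP h₀ hU hnb hfree T2 i2 v2 b2
  set t3 := (visit (2 : Fin 3)).sem ((visit (1 : Fin 3)).sem ((visit (0 : Fin 3)).sem t0)) with ht3
  have e : traverseStep.sem s = { t3 with nv := Function.update t3.nv 6 (t3.nv 6 + 1) } := rfl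
  rw [e]
  refine ⟨⟨T3.frame.trans ⟨fun j hj => ?_, fun a ha => rfl, rfl⟩, ?_, ?_, ?_⟩, i3⟩
  · simp only [List.mem_cons, not_or] at hj
    simp [hj]
  · simpa using T3.trav.next
  · simpa using T3.size
  · simp [T3.idx]

theorem popPart_sem {h : ℕ} (h4 : s.nv 4 = h + 1) :
    (popPart.sem s).nv 4 = h ∧ (popPart.sem s).nv 8 = s.na 8 h ∧
      Frame [4, 5, 6, 7, 8, 9, 10] [4, 5, 6] s (popPart.sem s) ∧
      (popPart.sem s).na 4 0 = s.na 7 h ∧ (popPart.sem s).na 5 (s.na 7 h) = 0 ∧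
      (popPart.sem s).na 6 (s.na 7 h) = 1 ∧ (popPart.sem s).nv 5 = 1 ∧
      (popPart.sem s).nv 6 = 0 := by
  refine ⟨?_, ?_, ⟨fun j hj => ?_, fun a ha => ?_, rfl⟩, ?_, ?_, ?_, ?_, ?_⟩
  · simp [popPart, Cmd.sem, NExp.eval, h4]
  · simp [popPart, Cmd.sem, NExp.eval, h4]
  · simp only [List.mem_cons, not_or] at hj
    simp [popPart, Cmd.sem, hj]
  · simp only [List.mem_cons, not_or] at ha
    simp [popPart, Cmd.sem, ha]
  · simp [popPart, Cmd.sem, NExp.eval, h4]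
  · simp [popPart, Cmd.sem, NExp.eval, h4]
  · simp [popPart, Cmd.sem, NExp.eval, h4]
  · simp [popPart, Cmd.sem, NExp.eval]
  · simp [popPart, Cmd.sem, NExp.eval]

theorem mergeStep_sem {par pp f : ℕ → ℕ} {m : ℕ}
    (hE : Enumeration (ptrNbr s₀) U (s.na 4) par pp) (hpar : s.na 5 = par) (hm : U.card = m)
    (hM : Merging m pp (fun j => s.na 6 (s.na 4 j)) f (s.nv 6))
    (hsmall : 2 * s.na 6 (s.na 4 (s.nv 6)) < m) :
    Frame [6, 9, 10] [6] s (mergeStep.sem s) ∧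
      ∃ f', Merging m pp (fun j => (mergeStep.sem s).na 6 ((mergeStep.sem s).na 4 j)) f'
        ((mergeStep.sem s).nv 6) ∧ (mergeStep.sem s).nv 6 + 1 = s.nv 6 := by
  have hpos := hM.pos hsmall
  have hlt := hM.lt
  have hpl := hE.lt _ (by omega) hpos
  have hp := hE.par_eq _ (by omega) hpos
  have e6 : (mergeStep.sem s).na 6 = Function.update (s.na 6) (s.na 4 (pp (s.nv 6)))
      (s.na 6 (s.na 4 (pp (s.nv 6))) + s.na 6 (s.na 4 (s.nv 6))) := by
    simp [mergeStep, Cmd.sem, NExp.eval, hpar, hp]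
  have e4 : (mergeStep.sem s).na 4 = s.na 4 := by simp [mergeStep, Cmd.sem]
  have ei : (mergeStep.sem s).nv 6 = s.nv 6 - 1 := by simp [mergeStep, Cmd.sem, NExp.eval]
  refine ⟨⟨fun j hj => ?_, fun a ha => ?_, rfl⟩,
    fun j => if f j = s.nv 6 then pp (s.nv 6) else f j, ?_, by omega⟩
  · simp only [List.mem_cons, not_or] at hj
    simp [mergeStep, Cmd.sem, hj]
  · simp only [List.mem_cons, not_or] at ha
    simp [mergeStep, Cmd.sem, ha]
  · rw [e6, e4, ei]
    refine hM.step (fun j hj => hE.lt j (by omega)) hsmall (by simp) fun a ha hne => ?_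
    refine Function.update_of_ne (fun e => hne (hE.inj _ (by omega) _ (by omega) e)) _ _

/-- The cost of `findCentroid` for a part with a single vertex, which is also the cost per vertex of
larger parts. -/
def findCost : ℕ :=
  popPart.bound + ((BExp.nlt (.var 6) (.var 5)).cost + 1 + traverseStep.bound) * 2 +
    (Cmd.nset 6 (.sub (.var 5) (.lit 1))).bound + (isSmall.cost + 1 + mergeStep.bound) * 2

theorem findCentroid_exec (hP : NoFourCocircular P) (h₀ : StoresFVD P s₀) (hU : Part P s₀ U)
    (hnb : s.na 1 = s₀.na 1)
    (hfree : ∀ v ∈ U, ∀ l, s.na 3 (ptrNbr s₀ v l) = 0 ↔ ptrNbr s₀ v l ∈ U) {h : ℕ}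
    (h4 : s.nv 4 = h + 1) (hr : s.na 7 h ∈ U) :
    Exec findCentroid s (findCost * U.card) fun s' =>
      s'.nv 4 = h ∧ s'.nv 8 = s.na 8 h ∧ Frame [4, 5, 6, 7, 8, 9, 10] [4, 5, 6] s s' ∧
        s'.na 4 (s'.nv 6) ∈ U ∧ IsCentroid P (ptrs s₀ U) (ptr s₀ (s'.na 4 (s'.nv 6))) := by
  have hcard : 0 < U.card := Finset.card_pos.2 ⟨_, hr⟩
  obtain ⟨p4, p8, pF, pL, pp, ps, p5, p6⟩ := popPart_sem h4
  set s₁ := popPart.sem s with hs₁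
  set r := s.na 7 h
  have hnb₁ : s₁.na 1 = s₀.na 1 := (pF.na 1 (by decide)).trans hnb
  have hfree₁ : ∀ v ∈ U, ∀ l, s₁.na 3 (ptrNbr s₀ v l) = 0 ↔ ptrNbr s₀ v l ∈ U := by
    rw [pF.na 3 (by decide)]; exact hfree
  have T0 : Traversing (ptrNbr s₀) U r s₁ s₁ 0 0 := by
    refine ⟨Frame.refl _ _ _, ?_, ?_, p6⟩
    · rw [p5]; exact Traversal.init pL pp hr
    · intro j hj
      obtain rfl : j = 0 := by omega
      rw [pL, ps]
  -- the traversal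
  have E1 : Exec (.loop (.nlt (.var 6) (.var 5)) traverseStep) s₁
      (((BExp.nlt (.var 6) (.var 5)).cost + 1 + traverseStep.bound) * (U.card + 1))
      fun s' => Traversing (ptrNbr s₀) U r s₁ s' (s'.nv 5) 0 := by
    refine Exec.loop (I := fun k s' => ∃ i, Traversing (ptrNbr s₀) U r s₁ s' i 0 ∧
      i ≤ s'.nv 5 ∧ k + i = U.card) ?_ ⟨0, T0, by omega, by omega⟩
    rintro k s' ⟨i, hT, hi, hk⟩
    have hle := hT.trav.le_card
    by_cases hlt : i < s'.nv 5
    · right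
      refine ⟨k - 1, by omega, by simpa [BExp.eval, NExp.eval, hT.idx] using hlt,
        Exec.of_loopFree (by simp [traverseStep, setBase, visit, Cmd.LoopFree]) ?_⟩
      obtain ⟨hT', hle'⟩ := traverseStep_sem hP h₀ hU hnb₁ hfree₁ hT hlt
      exact ⟨i + 1, hT', hle', by omega⟩
    · left
      obtain rfl : i = s'.nv 5 := by omega
      exact ⟨by simp [BExp.eval, NExp.eval, hT.idx], hT⟩
  have E2 : ∀ s₂, Traversing (ptrNbr s₀) U r s₁ s₂ (s₂.nv 5) 0 →
      Exec (.loop isSmall mergeStep) ((Cmd.nset 6 (.sub (.var 5) (.lit 1))).sem s₂)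
      ((isSmall.cost + 1 + mergeStep.bound) * (U.card + 1)) fun s' =>
      s'.nv 4 = h ∧ s'.nv 8 = s.na 8 h ∧ Frame [4, 5, 6, 7, 8, 9, 10] [4, 5, 6] s s' ∧
        s'.na 4 (s'.nv 6) ∈ U ∧ IsCentroid P (ptrs s₀ U) (ptr s₀ (s'.na 4 (s'.nv 6))) := by
    intro s₂ hT
    obtain ⟨hm, pp, hE⟩ := hT.trav.enumeration hU.pos (hU.closed hP h₀ hr)
    set s₃ := (Cmd.nset 6 (.sub (.var 5) (.lit 1))).sem s₂ with hs₃
    have F₃ : Frame [5, 6, 7, 9, 10] [4, 5, 6] s₁ s₃ := by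
      refine hT.frame.trans ⟨fun j hj => ?_, fun a ha => rfl, rfl⟩
      simp only [List.mem_cons, not_or] at hj
      simp [hs₃, Cmd.sem, hj]
    have e6 : s₃.nv 6 = U.card - 1 := by simp [hs₃, Cmd.sem, NExp.eval, hm]
    have e5 : s₃.nv 5 = U.card := by simp [hs₃, Cmd.sem, hm]
    refine Exec.mono (B := (isSmall.cost + 1 + mergeStep.bound) * (U.card - 1 + 1))
      (Exec.loop (I := fun k s' => Frame [6, 9, 10] [6] s₃ s' ∧
        ∃ f, Merging U.card pp (fun j => s'.na 6 (s'.na 4 j)) f (s'.nv 6) ∧ k = s'.nv 6) ?_ ?_)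
      (Nat.mul_le_mul_left _ (by omega)) (fun _ h => h)
    · rintro k s' ⟨hF, f, hM, rfl⟩
      have a4 : s'.na 4 = s₂.na 4 := hF.na 4 (by decide)
      have a5 : s'.na 5 = s₂.na 5 := hF.na 5 (by decide)
      have v5 : s'.nv 5 = U.card := (hF.nv 5 (by decide)).trans e5
      by_cases hlt : 2 * s'.na 6 (s'.na 4 (s'.nv 6)) < U.card
      · right
        obtain ⟨hF', f', hM', hk⟩ := mergeStep_sem (U := U) (s₀ := s₀) (a4 ▸ hE) a5 rfl hM hlt
        exact ⟨_, hk.symm, by simp only [isSmall, BExp.eval, NExp.eval, v5]; omega,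
          Exec.of_loopFree (by simp [mergeStep, Cmd.LoopFree]) ⟨hF.trans hF', f', hM', rfl⟩⟩
      · left
        have FF : Frame [5, 6, 7, 9, 10] [4, 5, 6] s₁ s' :=
          F₃.trans (hF.mono (by decide) (by decide))
        refine ⟨by simp only [isSmall, BExp.eval, NExp.eval, v5]; omega,
          (FF.nv 4 (by decide)).trans p4, (FF.nv 8 (by decide)).trans p8,
          pF.trans (FF.mono (by decide) (by decide)), ?_, ?_⟩
        · rw [a4]; exact hE.mem _ hM.lt
        · exact hU.isCentroid hP h₀ (a4 ▸ hE) hM hlt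
    · refine ⟨Frame.refl _ _ _, id, ?_, e6.symm⟩
      rw [e6]
      refine Merging.init hcard fun j hj => ?_
      have := hT.size j (by omega)
      simpa [hs₃, Cmd.sem] using this
  have E := Exec.seq (Exec.of_loopFree (c := popPart) (s := s) (Q := fun s' => s' = s₁)
    (by simp [popPart, Cmd.LoopFree]) rfl) (fun s' hs' => hs' ▸ Exec.seq E1 (fun s₂ hs₂ =>
      Exec.seq (Exec.of_loopFree (c := .nset 6 (.sub (.var 5) (.lit 1))) (s := s₂)
        (Q := fun s' => s' = (Cmd.nset 6 (.sub (.var 5) (.lit 1))).sem s₂) trivial rfl)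
        fun s' hs' => hs' ▸ E2 s₂ hs₂))
  refine E.mono ?_ fun _ h => h
  unfold findCost
  nlinarith [Nat.zero_le popPart.bound, Nat.zero_le traverseStep.bound,
    Nat.zero_le mergeStep.bound, Nat.zero_le isSmall.cost]

end

/-! ### The construction: placing the centroid -/

section

variable {P : Finset Pt} {s₀ s : State} {U : Finset ℕ}

/-- Push the part beyond the `k`-th neighbour of the current vertex, or set the child pointer to
null if there is none. -/
def pushPart (k : ℕ) : Cmd :=
  .seq (.nset 9 (.get 1 (.add (.var 10) (.lit k))))
    (.ite (.neq (.get 3 (.var 9)) (.lit 0))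
      (.seq (.nput 7 (.var 4) (.var 9))
      (.seq (.nput 8 (.var 4) (.add (.var 10) (.lit k)))
        (.nset 4 (.add (.var 4) (.lit 1)))))
      (.nput 2 (.add (.var 10) (.lit k)) (.lit 0)))

/-- Make the current list entry a child, and flag it. -/
def markCentroid : Cmd :=
  .seq (.nset 7 (.get 4 (.var 6)))
  (.seq (.nput 2 (.var 8) (.var 7))
  (.seq (.nput 3 (.var 7) (.lit 1))
    setBase))

/-- Place the centroid and push the parts that it separates. -/
def placeCentroid : Cmd :=
  .seq markCentroid (.seq (pushPart 0) (.seq (pushPart 1) (pushPart 2)))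

/-- The address of the `k`-th child pointer of the vertex with pointer `w`. -/
def slot (w k : ℕ) : ℕ := 3 * (w - 1) + k

theorem slot_inj {w w' : ℕ} {k k' : Fin 3} (hw : 0 < w) (hw' : 0 < w')
    (h : slot w k = slot w' k') : w = w' ∧ k = k' := by
  unfold slot at h
  have := k.2
  have := k'.2
  exact ⟨by omega, Fin.ext (by omega)⟩

/-- The effect of the first `k` calls of `pushPart` for the vertex `w`, begun in the state `s₁` with
a stack of height `h`. -/
structure Pushed (s₀ s₁ s : State) (w h k : ℕ) : Prop where
  frame : Frame [4, 9] [2, 7, 8] s₁ s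
  height : s.nv 4 = h + Nat.count (fun l => s₁.na 3 (s₀.na 1 (slot w l)) = 0) k
  below : ∀ j < h, s.na 7 j = s₁.na 7 j ∧ s.na 8 j = s₁.na 8 j
  child : ∀ a, (∀ l < k, a ≠ slot w l) → s.na 2 a = s₁.na 2 a
  null : ∀ l < k, s₁.na 3 (s₀.na 1 (slot w l)) ≠ 0 → s.na 2 (slot w l) = 0
  entry : ∀ l < k, s₁.na 3 (s₀.na 1 (slot w l)) = 0 →
    s.na 7 (h + Nat.count (fun l => s₁.na 3 (s₀.na 1 (slot w l)) = 0) l) = s₀.na 1 (slot w l) ∧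
    s.na 8 (h + Nat.count (fun l => s₁.na 3 (s₀.na 1 (slot w l)) = 0) l) = slot w l

theorem Pushed.init {s₁ : State} {w h : ℕ} (h4 : s₁.nv 4 = h) : Pushed s₀ s₁ s₁ w h 0 where
  frame := Frame.refl _ _ _
  height := by simpa using h4
  below _ _ := ⟨rfl, rfl⟩
  child _ _ := rfl
  null l hl := by omega
  entry l hl := by omega

theorem Pushed.step {s₁ : State} {w h k : ℕ} (hp : Pushed s₀ s₁ s w h k)
    (hnb : s₁.na 1 = s₀.na 1) (h10 : s₁.nv 10 = 3 * (w - 1)) :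
    Pushed s₀ s₁ ((pushPart k).sem s) w h (k + 1) := by
  have e1 : s.na 1 = s₀.na 1 := (hp.frame.na 1 (by decide)).trans hnb
  have e3 : s.na 3 = s₁.na 3 := hp.frame.na 3 (by decide)
  have e10 : s.nv 10 = 3 * (w - 1) := (hp.frame.nv 10 (by decide)).trans h10
  have slot_ne : ∀ {l : ℕ}, l < k → slot w l ≠ slot w k := fun hl => by unfold slot; omega
  set y := s₀.na 1 (slot w k) with hy
  set C := fun l => Nat.count (fun l => s₁.na 3 (s₀.na 1 (slot w l)) = 0) l with hC
  have hCmono : ∀ l < k, s₁.na 3 (s₀.na 1 (slot w l)) = 0 → C l < C k := fun l hl h0 =>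
    Nat.count_strict_mono h0 hl
  have ey : s.na 1 (3 * (w - 1) + k) = y := by rw [e1]; rfl
  have hsl : 3 * (w - 1) + k = slot w k := rfl
  have hcond : ∀ s' : State, s'.na = s.na → s'.nv 9 = y →
      ((BExp.neq (.get 3 (.var 9)) (.lit 0)).eval s' ↔ s₁.na 3 y = 0) := by
    intro s' h1 h2
    simp only [BExp.eval, NExp.eval, h1, h2, e3]
  set s' : State := { s with nv := Function.update s.nv 9 y } with hs'
  have es' : (Cmd.nset 9 (.get 1 (.add (.var 10) (.lit k)))).sem s = s' := by
    simp only [Cmd.sem, NExp.eval, e10, ey, hs']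
  have esem : (pushPart k).sem s = (Cmd.ite (.neq (.get 3 (.var 9)) (.lit 0))
      (.seq (.nput 7 (.var 4) (.var 9)) (.seq (.nput 8 (.var 4) (.add (.var 10) (.lit k)))
        (.nset 4 (.add (.var 4) (.lit 1)))))
      (.nput 2 (.add (.var 10) (.lit k)) (.lit 0))).sem s' := by
    rw [← es']; rfl
  rw [esem]
  by_cases hc : s₁.na 3 y = 0
  · rw [Cmd.sem_ite_pos ((hcond s' rfl (by simp [hs'])).2 hc)]
    set s'' : State := ⟨Function.update (Function.update s.nv 9 y) 4 (s.nv 4 + 1), s.rv,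
      Function.update (Function.update s.na 7 (Function.update (s.na 7) (s.nv 4) y)) 8
        (Function.update (s.na 8) (s.nv 4) (slot w k)), s.ra⟩ with hs''
    have e'' : (Cmd.seq (.nput 7 (.var 4) (.var 9)) (.seq (.nput 8 (.var 4)
        (.add (.var 10) (.lit k))) (.nset 4 (.add (.var 4) (.lit 1))))).sem s' = s'' := by
      simp [Cmd.sem, NExp.eval, hs', hs'', e10, hsl]
    rw [e'']
    have n2 : s''.na 2 = s.na 2 := by simp [hs'']
    have n7 : s''.na 7 = Function.update (s.na 7) (h + C k) y := by simp [hs'', hp.height, hC]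
    have n8 : s''.na 8 = Function.update (s.na 8) (h + C k) (slot w k) := by
      simp [hs'', hp.height, hC]
    have old : ∀ j, j ≠ h + C k → s''.na 7 j = s.na 7 j ∧ s''.na 8 j = s.na 8 j := fun j hj => by
      rw [n7, n8, Function.update_of_ne hj, Function.update_of_ne hj]; exact ⟨rfl, rfl⟩
    refine ⟨hp.frame.trans ⟨fun j hj => ?_, fun a ha => ?_, rfl⟩, ?_, ?_, ?_, ?_, ?_⟩
    · simp only [List.mem_cons, not_or] at hj
      simp [hs'', hj]
    · simp only [List.mem_cons, not_or] at ha
      simp [hs'', ha]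
    · rw [Nat.count_succ, if_pos hc]
      simp [hs'', hp.height, add_assoc]
    · intro j hj
      rw [(old j (by omega)).1, (old j (by omega)).2]
      exact hp.below j hj
    · intro a ha
      rw [n2]; exact hp.child a fun l hl => ha l (by omega)
    · intro l hl h0
      rw [n2]
      rcases Nat.lt_succ_iff_lt_or_eq.1 hl with hl | rfl
      · exact hp.null l hl h0
      · exact (h0 hc).elim
    · intro l hl h0
      rcases Nat.lt_succ_iff_lt_or_eq.1 hl with hl | rfl
      · have hlt := hCmono l hl h0
        obtain ⟨o7, o8⟩ := old (h + C l) (by omega)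
        obtain ⟨q7, q8⟩ := hp.entry l hl h0
        exact ⟨o7.trans q7, o8.trans q8⟩
      · constructor
        · rw [n7]; exact Function.update_self _ _ _
        · rw [n8]; exact Function.update_self _ _ _
  · rw [Cmd.sem_ite_neg fun hh => hc ((hcond s' rfl (by simp [hs'])).1 hh)]
    set s'' : State := ⟨Function.update s.nv 9 y, s.rv,
      Function.update s.na 2 (Function.update (s.na 2) (slot w k) 0), s.ra⟩ with hs''
    have e'' : (Cmd.nput 2 (.add (.var 10) (.lit k)) (.lit 0)).sem s' = s'' := by
      simp [Cmd.sem, NExp.eval, hs', hs'', e10, hsl]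
    rw [e'']
    have n2 : s''.na 2 = Function.update (s.na 2) (slot w k) 0 := by simp [hs'']
    have n7 : s''.na 7 = s.na 7 := by simp [hs'']
    have n8 : s''.na 8 = s.na 8 := by simp [hs'']
    refine ⟨hp.frame.trans ⟨fun j hj => ?_, fun a ha => ?_, rfl⟩, ?_, ?_, ?_, ?_, ?_⟩
    · simp only [List.mem_cons, not_or] at hj
      simp [hs'', hj]
    · simp only [List.mem_cons, not_or] at ha
      simp [hs'', ha]
    · rw [Nat.count_succ, if_neg hc]
      simp [hs'', hp.height]
    · rw [n7, n8]; exact hp.below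
    · intro a ha
      rw [n2, Function.update_of_ne (ha k (by omega))]
      exact hp.child a fun l hl => ha l (by omega)
    · intro l hl h0
      rw [n2]
      rcases Nat.lt_succ_iff_lt_or_eq.1 hl with hl | rfl
      · rw [Function.update_of_ne (slot_ne hl)]
        exact hp.null l hl h0
      · exact Function.update_self _ _ _
    · intro l hl h0
      rw [n7, n8]
      rcases Nat.lt_succ_iff_lt_or_eq.1 hl with hl | rfl
      · exact hp.entry l hl h0
      · exact (hc h0).elim

theorem placeCentroid_sem {w h : ℕ} (hnb : s.na 1 = s₀.na 1) (hw : s.na 4 (s.nv 6) = w)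
    (h4 : s.nv 4 = h) :
    ∃ s₁, Pushed s₀ s₁ (placeCentroid.sem s) w h 3 ∧ Frame [7, 10] [2, 3] s s₁ ∧
      s₁.na 2 = Function.update (s.na 2) (s.nv 8) w ∧ s₁.na 3 = Function.update (s.na 3) w 1 := by
  set s₁ := markCentroid.sem s with hs₁
  have e10 : s₁.nv 10 = 3 * (w - 1) := by
    simp only [hs₁, markCentroid, setBase, Cmd.sem, NExp.eval, Function.update_self, hw]
    omega
  have F : Frame [7, 10] [2, 3] s s₁ := by
    refine ⟨fun j hj => ?_, fun a ha => ?_, rfl⟩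
    · simp only [List.mem_cons, not_or] at hj
      simp [hs₁, markCentroid, setBase, Cmd.sem, hj]
    · simp only [List.mem_cons, not_or] at ha
      simp [hs₁, markCentroid, setBase, Cmd.sem, ha]
  have hnb₁ : s₁.na 1 = s₀.na 1 := (F.na 1 (by decide)).trans hnb
  refine ⟨s₁, ?_, F, ?_, ?_⟩
  · have p0 : Pushed s₀ s₁ s₁ w h 0 := Pushed.init ((F.nv 4 (by decide)).trans h4)
    exact ((p0.step hnb₁ e10).step hnb₁ e10).step hnb₁ e10
  · simp [hs₁, markCentroid, setBase, Cmd.sem, NExp.eval, hw]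
  · simp [hs₁, markCentroid, setBase, Cmd.sem, NExp.eval, hw]

/-! ### The construction: the whole decomposition -/

/-- One round of the construction. -/
def buildStep : Cmd := .seq findCentroid placeCentroid

/-- There are parts left. -/
def pending : BExp := .nlt (.lit 0) (.var 4)

/-- What never changes during the construction. -/
structure Steady (s₀ s : State) : Prop where
  feat : SameFeatures s₀ s
  nb : s.na 1 = s₀.na 1
  null : s.na 3 0 ≠ 0

/-- The cell `a` holds a pointer to a separator decomposition of the part `U`, all of whose child
pointers are in the cells of `U`. -/
def Built (P : Finset Pt) (s₀ : State) (U : Finset ℕ) (s : State) (a : ℕ) : Prop :=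
  ∃ t, IsSepDecomp P t (ptrs s₀ U) ∧ ∀ s', SameFeatures s₀ s' →
    (∀ v ∈ U, ∀ k : Fin 3, s'.na 2 (slot v k) = s.na 2 (slot v k)) → StoresTree s' t (s.na 2 a)

theorem Built.congr {s' : State} {a : ℕ} (h : Built P s₀ U s a) (ha : s'.na 2 a = s.na 2 a)
    (hU : ∀ v ∈ U, ∀ k : Fin 3, s'.na 2 (slot v k) = s.na 2 (slot v k)) : Built P s₀ U s' a := by
  obtain ⟨t, ht, h⟩ := h
  refine ⟨t, ht, fun s'' hf hs'' => ?_⟩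
  rw [ha]
  exact h s'' hf fun v hv k => (hs'' v hv k).trans (hU v hv k)

/-- The top of the stack, at height `h`, is the part `U`, none of whose vertices has been placed. -/
structure Ready (P : Finset Pt) (s₀ : State) (U : Finset ℕ) (h : ℕ) (s : State) : Prop where
  steady : Steady s₀ s
  part : Part P s₀ U
  free : ∀ v ∈ U, s.na 3 v = 0
  closed : ∀ v ∈ U, ∀ l, ptrNbr s₀ v l ∈ U ∨ s.na 3 (ptrNbr s₀ v l) ≠ 0
  height : s.nv 4 = h + 1
  top : s.na 7 h ∈ U
  fresh : ∀ v ∈ U, ∀ k : Fin 3, s.na 8 h ≠ slot v k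

/-- The part `U` at the top of the stack has been decomposed, and nothing else has changed. -/
structure Finished (P : Finset Pt) (s₀ : State) (U : Finset ℕ) (h : ℕ) (s s' : State) : Prop where
  steady : Steady s₀ s'
  height : s'.nv 4 = h
  below : ∀ j < h, s'.na 7 j = s.na 7 j ∧ s'.na 8 j = s.na 8 j
  flags : ∀ v, v ∉ U → s'.na 3 v = s.na 3 v
  child : ∀ a, a ≠ s.na 8 h → (∀ v ∈ U, ∀ k : Fin 3, a ≠ slot v k) → s'.na 2 a = s.na 2 a
  built : Built P s₀ U s' (s.na 8 h)

/-- The cost per vertex and level of the construction. -/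
def levelCost : ℕ := pending.cost + 1 + findCost + placeCentroid.bound

/-- The centroid `w` of `U` has been placed in the state `s`; of the parts that it separates, those
with number `k` and higher have been decomposed in the state `s'`. -/
structure Partial (P : Finset Pt) (s₀ : State) (U : Finset ℕ) (w h : ℕ) (C : ℕ → ℕ) (s : State)
    (k : ℕ) (s' : State) : Prop where
  steady : Steady s₀ s'
  height : s'.nv 4 = h + C k
  below : ∀ j < h + C k, s'.na 7 j = s.na 7 j ∧ s'.na 8 j = s.na 8 j
  flags : ∀ v, (∀ l : Fin 3, k ≤ l → v ∉ subPart P s₀ U w l) → s'.na 3 v = s.na 3 v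
  child : ∀ a, (∀ l : Fin 3, k ≤ l → a ≠ slot w l ∧
    ∀ v ∈ subPart P s₀ U w l, ∀ i : Fin 3, a ≠ slot v i) → s'.na 2 a = s.na 2 a
  built : ∀ l : Fin 3, k ≤ l → Built P s₀ (subPart P s₀ U w l) s' (slot w l)

/-- What holds after the centroid `w` of `U` has been placed: the parts that it separates are on the
stack, or their child pointers are null. -/
structure Placed (P : Finset Pt) (s₀ : State) (U : Finset ℕ) (w h : ℕ) (C : ℕ → ℕ) (s : State) :
    Prop where
  part : Part P s₀ U
  mem : w ∈ U
  centroid : IsCentroid P (ptrs s₀ U) (ptr s₀ w)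
  steady : Steady s₀ s
  flag : s.na 3 w ≠ 0
  free : ∀ v ∈ U, v ≠ w → s.na 3 v = 0
  closed : ∀ v ∈ U, ∀ l, ptrNbr s₀ v l ∈ U ∨ s.na 3 (ptrNbr s₀ v l) ≠ 0
  zero : C 0 = 0
  height : s.nv 4 = h + C 3
  null : ∀ l : Fin 3, ptrNbr s₀ w l ∉ U → C (l + 1) = C l ∧ s.na 2 (slot w l) = 0
  entry : ∀ l : Fin 3, ptrNbr s₀ w l ∈ U → C (l + 1) = C l + 1 ∧
    s.na 7 (h + C l) = ptrNbr s₀ w l ∧ s.na 8 (h + C l) = slot w l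

theorem Placed.step (hP : NoFourCocircular P) (h₀ : StoresFVD P s₀) {w h : ℕ} {C : ℕ → ℕ}
    (hp : Placed P s₀ U w h C s) {s' : State} (k : Fin 3)
    (hM : Partial P s₀ U w h C s (k + 1) s')
    (ih : ∀ h', Ready P s₀ (subPart P s₀ U w k) h' s' → Rounds pending buildStep s'
      (levelCost * (subPart P s₀ U w k).card * Nat.size (subPart P s₀ U w k).card)
      (Finished P s₀ (subPart P s₀ U w k) h' s')) :
    Rounds pending buildStep s'
      (levelCost * (subPart P s₀ U w k).card * Nat.size (subPart P s₀ U w k).card)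
      (Partial P s₀ U w h C s k) := by
  have hw0 := hp.part.pos w hp.mem
  have hdisj : ∀ {l l' : Fin 3} {v : ℕ}, v ∈ subPart P s₀ U w l → v ∈ subPart P s₀ U w l' →
      l = l' :=
    fun h1 h2 => hp.part.subPart_disjoint h₀ hp.mem h1 h2
  have hposS : ∀ {l : Fin 3} {v : ℕ}, v ∈ subPart P s₀ U w l → 0 < v := fun hv =>
    hp.part.pos _ (subPart_subset hv)
  have hslot : ∀ {l l' : Fin 3}, ∀ v ∈ subPart P s₀ U w l, ∀ i : Fin 3, slot w l' ≠ slot v i := by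
    intro l l' v hv i e
    obtain ⟨rfl, -⟩ := slot_inj hw0 (hposS hv) e
    exact not_mem_subPart hv
  have hk_or : ∀ l : Fin 3, (k : ℕ) ≤ l → l = k ∨ (k : ℕ) + 1 ≤ l := fun l hl => by
    rcases Nat.lt_or_ge (k : ℕ) l with h | h
    · exact .inr h
    · exact .inl (Fin.ext (by omega))
  have hout : ∀ l : Fin 3, (k : ℕ) + 1 ≤ l → (l : Fin 3) ≠ k := fun l hl e => by
    rw [e] at hl; omega
  by_cases hy : ptrNbr s₀ w k ∈ U
  · obtain ⟨hC, e7, e8⟩ := hp.entry k hy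
    have hb := hM.below (h + C k) (by omega)
    have hR : Ready P s₀ (subPart P s₀ U w k) (h + C k) s' := by
      refine ⟨hM.steady, hp.part.subPart h₀ hp.mem k, fun v hv => ?_, fun v hv l => ?_, ?_, ?_, ?_⟩
      · rw [hM.flags v fun l hl hvl => hout l hl (hdisj hvl hv)]
        exact hp.free v (subPart_subset hv) (by rintro rfl; exact not_mem_subPart hv)
      · by_cases hin : ptrNbr s₀ v l ∈ subPart P s₀ U w k
        · exact .inl hin
        · right
          -- the neighbour is flagged, hence not in a part that has been decomposed meanwhile
          have hflag : s.na 3 (ptrNbr s₀ v l) ≠ 0 := by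
            rcases hp.closed v (subPart_subset hv) l with hyU | hyf
            · by_cases hyw : ptr s₀ (ptrNbr s₀ v l) = ptr s₀ w
              · rw [h₀.ptr_inj (hp.part.pos _ hyU) (hp.part.le _ hyU) hw0 (hp.part.le w hp.mem) hyw]
                exact hp.flag
              · exact (hin (hp.part.subPart_closed hP h₀ hv hyU hyw)).elim
            · exact hyf
          rw [hM.flags _ fun l' _ hl' => hflag (hp.free _ (subPart_subset hl')
            (by rintro e; rw [e] at hl'; exact not_mem_subPart hl'))]
          exact hflag
      · rw [hM.height, hC]; rfl
      · rw [hb.1, e7]; exact hp.part.ptrNbr_mem_subPart h₀ hp.mem hy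
      · rw [hb.2, e8]; exact hslot
    refine (ih _ hR).mono le_rfl fun s'' hF => ?_
    have hs8 : s'.na 8 (h + C k) = slot w k := hb.2.trans e8
    have hFc := hF.child
    have hFb := hF.built
    rw [hs8] at hFc hFb
    refine ⟨hF.steady, hF.height, fun j hj => ?_, fun v hv => ?_, fun a ha => ?_, fun l hl => ?_⟩
    · obtain ⟨f7, f8⟩ := hF.below j hj
      obtain ⟨g7, g8⟩ := hM.below j (by omega)
      exact ⟨f7.trans g7, f8.trans g8⟩
    · rw [hF.flags v (hv k le_rfl), hM.flags v fun l hl => hv l (by omega)]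
    · rw [hFc a (ha k le_rfl).1 (ha k le_rfl).2, hM.child a fun l hl => ha l (by omega)]
    · rcases hk_or l hl with rfl | hl'
      · exact hFb
      · refine (hM.built l hl').congr (hFc _ ?_ hslot) fun v hv i => hFc _ ?_ ?_
        · intro e; exact hout l hl' (slot_inj hw0 hw0 e).2
        · exact (hslot v hv i).symm
        · intro v' hv' i' e
          obtain ⟨rfl, -⟩ := slot_inj (hposS hv) (hposS hv') e
          exact hout l hl' (hdisj hv hv')
  · obtain ⟨hC, h2⟩ := hp.null k hy
    have hemp := hp.part.subPart_eq_empty h₀ hp.mem hy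
    refine (Rounds.refl (Q := Partial P s₀ U w h C s k) ?_).mono (Nat.zero_le _) fun _ h => h
    refine ⟨hM.steady, by rw [hM.height, hC], fun j hj => hM.below j (by omega),
      fun v hv => hM.flags v fun l hl => hv l (by omega),
      fun a ha => hM.child a fun l hl => ha l (by omega), fun l hl => ?_⟩
    rcases hk_or l hl with rfl | hl'
    · refine ⟨.nil, ?_, fun s'' _ _ => ?_⟩
      · rw [hemp]; simp [ptrs, IsSepDecomp]
      · change s'.na 2 (slot w l) = 0
        rw [hM.child _ fun l' hl' => ⟨fun e => hout l' hl' (slot_inj hw0 hw0 e).2.symm, hslot⟩, h2]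
    · exact hM.built l hl'

theorem buildStep_exec (hP : NoFourCocircular P) (h₀ : StoresFVD P s₀) {h : ℕ}
    (hR : Ready P s₀ U h s) : Exec buildStep s (findCost * U.card + placeCentroid.bound)
      fun s' => ∃ w C, Placed P s₀ U w h C s' ∧
        (∀ j < h, s'.na 7 j = s.na 7 j ∧ s'.na 8 j = s.na 8 j) ∧
        (∀ v, v ∉ U → s'.na 3 v = s.na 3 v) ∧
        (∀ a, a ≠ s.na 8 h → (∀ v ∈ U, ∀ k : Fin 3, a ≠ slot v k) → s'.na 2 a = s.na 2 a) ∧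
        s'.na 2 (s.na 8 h) = w := by
  have hfree : ∀ v ∈ U, ∀ l, s.na 3 (ptrNbr s₀ v l) = 0 ↔ ptrNbr s₀ v l ∈ U := fun v hv l =>
    ⟨fun h0 => (hR.closed v hv l).resolve_right fun hne => hne h0, fun hy => hR.free _ hy⟩
  refine Exec.seq (findCentroid_exec hP h₀ hR.part hR.steady.nb hfree hR.height hR.top) ?_
  rintro s₁ ⟨h4, h8, hF, hw, hcen⟩
  obtain ⟨s₂, hpush, hF₂, c2, c3⟩ := placeCentroid_sem (s₀ := s₀)
    ((hF.na 1 (by decide)).trans hR.steady.nb) rfl h4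
  refine Exec.of_loopFree
    (by simp [placeCentroid, markCentroid, setBase, pushPart, Cmd.LoopFree]) ?_
  set w := s₁.na 4 (s₁.nv 6)
  set s₃ := placeCentroid.sem s₁
  have hw0 := hR.part.pos w hw
  rw [h8] at c2
  have e2 : s₂.na 2 = Function.update (s.na 2) (s.na 8 h) w := by
    rw [c2, hF.na 2 (by decide)]
  have e3 : s₂.na 3 = Function.update (s.na 3) w 1 := by rw [c3, hF.na 3 (by decide)]
  have e3' : s₃.na 3 = Function.update (s.na 3) w 1 := (hpush.frame.na 3 (by decide)).trans e3
  have fw : s₃.na 3 w ≠ 0 := by rw [e3']; simp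
  have fo : ∀ v, v ≠ w → s₃.na 3 v = s.na 3 v := fun v hv => by
    rw [e3']; exact Function.update_of_ne hv _ _
  have hopen : ∀ l : Fin 3, s₂.na 3 (s₀.na 1 (slot w l)) = 0 ↔ ptrNbr s₀ w l ∈ U := by
    intro l
    have hne : ptrNbr s₀ w l ≠ w := (h₀.isForest hP).ne w l hw0 (hR.part.le w hw)
    rw [← hfree w hw l, e3]
    change Function.update (s.na 3) w 1 (ptrNbr s₀ w l) = 0 ↔ _
    rw [Function.update_of_ne hne]
  have hslotU : ∀ l < 3, ∃ k : Fin 3, slot w l = slot w k := fun l hl => ⟨⟨l, hl⟩, rfl⟩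
  refine ⟨w, fun k => Nat.count (fun l => s₂.na 3 (s₀.na 1 (slot w l)) = 0) k,
    ⟨hR.part, hw, hcen, ⟨⟨?_, ?_, ?_, ?_⟩, ?_, ?_⟩, fw, ?_, ?_, ?_, hpush.height, ?_, ?_⟩,
    ?_, ?_, ?_, ?_⟩
  · rw [hpush.frame.nv 0 (by decide), hF₂.nv 0 (by decide), hF.nv 0 (by decide)]
    exact hR.steady.feat.nv0
  · rw [hpush.frame.nv 1 (by decide), hF₂.nv 1 (by decide), hF.nv 1 (by decide)]
    exact hR.steady.feat.nv1
  · rw [hpush.frame.na 0 (by decide), hF₂.na 0 (by decide), hF.na 0 (by decide)]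
    exact hR.steady.feat.na0
  · rw [hpush.frame.ra, hF₂.ra, hF.ra]
    exact hR.steady.feat.ra
  · rw [hpush.frame.na 1 (by decide), hF₂.na 1 (by decide), hF.na 1 (by decide)]
    exact hR.steady.nb
  · rw [fo 0 (by omega)]; exact hR.steady.null
  · intro v hv hvw
    rw [fo v hvw]; exact hR.free v hv
  · intro v hv l
    rcases hR.closed v hv l with hl | hl
    · exact .inl hl
    · right
      by_cases hvw : ptrNbr s₀ v l = w
      · rw [hvw]; exact fw
      · rw [fo _ hvw]; exact hl
  · exact Nat.count_zero _
  · intro l hl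
    have := (hopen l).not.2 hl
    exact ⟨by rw [Nat.count_succ, if_neg this]; rfl, hpush.null l l.2 this⟩
  · intro l hl
    have := (hopen l).2 hl
    exact ⟨by rw [Nat.count_succ, if_pos this], hpush.entry l l.2 this⟩
  · intro j hj
    obtain ⟨b7, b8⟩ := hpush.below j hj
    rw [b7, b8, hF₂.na 7 (by decide), hF.na 7 (by decide), hF₂.na 8 (by decide),
      hF.na 8 (by decide)]
    exact ⟨rfl, rfl⟩
  · intro v hv
    exact fo v (by rintro rfl; exact hv hw)
  · intro a ha haU
    rw [hpush.child a fun l hl e => ?_, e2, Function.update_of_ne ha]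
    obtain ⟨k, hk⟩ := hslotU l hl
    exact haU w hw k (e.trans hk)
  · rw [hpush.child _ fun l hl e => ?_, e2, Function.update_self]
    obtain ⟨k, hk⟩ := hslotU l hl
    exact hR.fresh w hw k (e.trans hk)

/-- Decomposing the part at the top of the stack.  Its cost satisfies the recurrence of
divide and conquer: the parts separated by the centroid have at most half of the vertices each, and
at most all of them in total. -/
theorem rounds_finished (hP : NoFourCocircular P) (h₀ : StoresFVD P s₀) {h : ℕ}
    (hR : Ready P s₀ U h s) : Rounds pending buildStep s (levelCost * U.card * Nat.size U.card)
      (Finished P s₀ U h s) := by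
  induction hn : U.card using Nat.strong_induction_on generalizing U s h with
  | _ n ih =>
    subst hn
    have hcard : 0 < U.card := Finset.card_pos.2 ⟨_, hR.top⟩
    have hstep := (buildStep_exec hP h₀ hR).rounds (b := pending) (by
      simp [pending, BExp.eval, NExp.eval, hR.height])
    set u : Fin 3 → ℕ → ℕ := fun k w => (subPart P s₀ U w k).card with hu
    have hsizes : ∀ w C s', Placed P s₀ U w h C s' →
        (∀ k, Nat.size (u k w) + 1 ≤ Nat.size U.card) ∧ (∀ k, u k w < U.card) ∧
          u 0 w + u 1 w + u 2 w ≤ U.card := by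
      intro w C s' hp
      have h2 := hp.part.two_mul_card_subPart_le h₀ hp.mem hp.centroid
      refine ⟨fun k => size_add_one_le hcard (h2 k), fun k => ?_,
        hp.part.sum_card_subPart_le h₀ hp.mem⟩
      have := h2 k
      change 2 * u k w ≤ _ at this
      omega
    -- the cost of the parts is bounded independently of the choice of the centroid
    have hrest : ∀ s', (∃ w C, Placed P s₀ U w h C s' ∧
        (∀ j < h, s'.na 7 j = s.na 7 j ∧ s'.na 8 j = s.na 8 j) ∧
        (∀ v, v ∉ U → s'.na 3 v = s.na 3 v) ∧
        (∀ a, a ≠ s.na 8 h → (∀ v ∈ U, ∀ k : Fin 3, a ≠ slot v k) → s'.na 2 a = s.na 2 a) ∧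
        s'.na 2 (s.na 8 h) = w) →
        Rounds pending buildStep s' (levelCost * U.card * (Nat.size U.card - 1))
          (Finished P s₀ U h s) := by
      rintro s₁ ⟨w, C, hp, hb, hf, hc, hsw⟩
      obtain ⟨hsz, hlt, hsum⟩ := hsizes w C s₁ hp
      have M3 : Partial P s₀ U w h C s₁ 3 s₁ :=
        ⟨hp.steady, hp.height, fun _ _ => ⟨rfl, rfl⟩, fun _ _ => rfl, fun _ _ => rfl,
          fun l hl => absurd l.2 (by omega)⟩
      have R2 := hp.step hP h₀ 2 M3 fun h' hR' => ih _ (hlt 2) hR' rfl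
      have R1 := R2.trans fun s₂ M2 => hp.step hP h₀ 1 M2 fun h' hR' => ih _ (hlt 1) hR' rfl
      have R0 := R1.trans fun s₃ M1 => hp.step hP h₀ 0 M1 fun h' hR' => ih _ (hlt 0) hR' rfl
      refine R0.mono ?_ fun s' M => ?_
      · have hk : ∀ k, levelCost * u k w * Nat.size (u k w)
            ≤ levelCost * u k w * (Nat.size U.card - 1) := fun k =>
          Nat.mul_le_mul_left _ (by have := hsz k; omega)
        calc _ ≤ levelCost * u 2 w * (Nat.size U.card - 1) + levelCost * u 1 w *
              (Nat.size U.card - 1) + levelCost * u 0 w * (Nat.size U.card - 1) :=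
            Nat.add_le_add (Nat.add_le_add (hk 2) (hk 1)) (hk 0)
          _ = levelCost * (u 0 w + u 1 w + u 2 w) * (Nat.size U.card - 1) := by ring
          _ ≤ _ := Nat.mul_le_mul_right _ (Nat.mul_le_mul_left _ hsum)
      · have hw0 := hp.part.pos w hp.mem
        have hwn := hp.part.le w hp.mem
        have ho := h₀.owners hw0 hwn
        have hz : (((0 : Fin 3) : ℕ)) = 0 := rfl
        have hle : ∀ l : Fin 3, ((0 : Fin 3) : ℕ) ≤ l := fun l => Nat.zero_le _
        have hslot : s'.na 2 (s.na 8 h) = w := by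
          rw [M.child _ fun l _ => ⟨hR.fresh w hp.mem l, fun v hv i =>
            hR.fresh v (subPart_subset hv) i⟩, hsw]
        refine ⟨M.steady, by rw [M.height, hz, hp.zero]; rfl, fun j hj => ?_, fun v hv => ?_,
          fun a ha haU => ?_, ?_⟩
        · obtain ⟨m7, m8⟩ := M.below j (by omega)
          rw [m7, m8]; exact hb j hj
        · rw [M.flags v fun l _ hl => hv (subPart_subset hl), hf v hv]
        · rw [M.child a fun l _ => ⟨haU w hp.mem l, fun v hv i => haU v (subPart_subset hv) i⟩,
            hc a ha haU]
        · choose t ht hst using fun l => M.built l (hle l)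
          refine ⟨.node (ptr s₀ w) (ptrOwners s₀ w) t, ⟨hp.centroid, ho.inj, ho.own, fun k => ?_⟩,
            fun s'' hf'' hag => ?_⟩
          · have := ht k
            rwa [ptrs_subPart] at this
          · refine ⟨w - 1, by rw [hslot]; omega, by rw [hf''.numVertices]; omega,
              by rw [hf''.vertex]; rfl, fun k => by rw [hf''.site, hf''.own]; rfl, fun k => ?_⟩
            have e : child s'' (w - 1) k = s'.na 2 (slot w k) := hag w hp.mem k
            rw [e]
            exact hst k s'' hf'' fun v hv i => hag v (subPart_subset hv) i
    refine (hstep.trans hrest).mono ?_ fun _ h => h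
    have hspos : 0 < Nat.size U.card := Nat.size_pos.2 hcard
    obtain ⟨z, hz⟩ := Nat.exists_eq_succ_of_ne_zero hspos.ne'
    have hl : pending.cost + 1 + (findCost * U.card + placeCentroid.bound) ≤
        levelCost * U.card := by
      unfold levelCost
      nlinarith
    rw [hz, Nat.succ_sub_one, Nat.succ_eq_add_one, mul_add, mul_one]
    omega

end

/-! ### The construction: the program -/

section

variable {P : Finset Pt} {s₀ s : State} {U : Finset ℕ}

/-- The address of a cell beyond all child pointers, which receives the pointer to the root. -/
def rootCell : NExp := .add (.var 0) (.add (.var 0) (.var 0))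

/-- Clear the flags of all vertices and set the flag of the null pointer. -/
def clearFlags : Cmd :=
  .seq (.seq (.nput 3 (.lit 0) (.lit 1)) (.nset 6 (.var 0)))
    (.loop (.nlt (.lit 0) (.var 6))
      (.seq (.nput 3 (.var 6) (.lit 0)) (.nset 6 (.sub (.var 6) (.lit 1)))))

/-- Push the whole diagram, represented by the pointer `1`, unless it has no vertex. -/
def pushDiagram : Cmd :=
  .seq (.nset 4 (.lit 0))
  (.seq (.nput 2 rootCell (.lit 0))
  (.ite (.nlt (.lit 0) (.var 0))
    (.seq (.nput 7 (.lit 0) (.lit 1)) (.seq (.nput 8 (.lit 0) rootCell) (.nset 4 (.lit 1))))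
    .skip))

/-- The construction of a separator decomposition. -/
def build : Cmd :=
  .seq clearFlags (.seq pushDiagram (.seq (.loop pending buildStep) (.nset 2 (.get 2 rootCell))))

/-- A cost of `build` per vertex and level.  The last summand is for clearing the flags and for the
final assignment. -/
def buildCost : ℕ := levelCost + pushDiagram.bound + 40

theorem clearFlags_exec (s : State) : Exec clearFlags s (20 * (numVertices s + 1)) fun s' =>
    Frame [6] [3] s s' ∧ s'.na 3 0 ≠ 0 ∧ ∀ v, 0 < v → v ≤ numVertices s → s'.na 3 v = 0 := by
  set I : ℕ → State → Prop := fun k s' => Frame [6] [3] s s' ∧ s'.nv 6 = k ∧ s'.na 3 0 ≠ 0 ∧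
    ∀ v, k < v → v ≤ numVertices s → s'.na 3 v = 0 with hI
  have hinit : Exec (.seq (.nput 3 (.lit 0) (.lit 1)) (.nset 6 (.var 0))) s
      (Cmd.seq (.nput 3 (.lit 0) (.lit 1)) (.nset 6 (.var 0))).bound (I (numVertices s)) := by
    refine Exec.of_loopFree (by simp [Cmd.LoopFree]) ⟨⟨fun j hj => ?_, fun a ha => ?_, rfl⟩, ?_⟩
    · simp only [List.mem_cons, not_or] at hj
      simp [Cmd.sem, hj]
    · simp only [List.mem_cons, not_or] at ha
      simp [Cmd.sem, ha]
    · refine ⟨by simp [Cmd.sem, NExp.eval, numVertices], by simp [Cmd.sem, NExp.eval], ?_⟩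
      intro v h1 h2
      omega
  refine (Exec.seq hinit fun s₁ h₁ => Exec.loop (I := I) (B := (Cmd.seq (.nput 3 (.var 6) (.lit 0))
    (.nset 6 (.sub (.var 6) (.lit 1)))).bound) (fun k s' h => ?_) h₁).mono ?_ fun _ h => h
  · obtain ⟨hF, h6, h0, hv⟩ := h
    rcases Nat.eq_zero_or_pos k with rfl | hk
    · exact .inl ⟨by simp [BExp.eval, NExp.eval, h6], hF, h0, hv⟩
    · refine .inr ⟨k - 1, by omega, by simpa [BExp.eval, NExp.eval, h6] using hk, ?_⟩
      refine Exec.of_loopFree (by simp [Cmd.LoopFree])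
        ⟨hF.trans ⟨fun j hj => ?_, fun a ha => ?_, rfl⟩, ?_, ?_, fun v h1 h2 => ?_⟩
      · simp only [List.mem_cons, not_or] at hj
        simp [Cmd.sem, hj]
      · simp only [List.mem_cons, not_or] at ha
        simp [Cmd.sem, ha]
      · simp [Cmd.sem, NExp.eval, h6]
      · simpa [Cmd.sem, NExp.eval, h6, Function.update_of_ne hk.ne] using h0
      · by_cases hvk : v = k
        · simp [Cmd.sem, NExp.eval, h6, hvk]
        · simpa [Cmd.sem, NExp.eval, h6, Function.update_of_ne hvk] using hv v (by omega) h2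
  · simp only [Cmd.bound, NExp.cost, BExp.cost]
    omega

theorem Frame.sameFeatures {N A : List ℕ} {s s' : State} (h : Frame N A s s') (h0 : 0 ∉ N)
    (h1 : 1 ∉ N) (hA : 0 ∉ A) : SameFeatures s s' :=
  ⟨h.nv 0 h0, h.nv 1 h1, h.na 0 hA, h.ra⟩

/-- What holds before the main loop: nothing is on the stack if there is no vertex, and the whole
diagram otherwise. -/
theorem pushDiagram_sem (s : State) :
    Frame [4] [2, 7, 8] s (pushDiagram.sem s) ∧
    (numVertices s = 0 → (pushDiagram.sem s).nv 4 = 0 ∧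
      (pushDiagram.sem s).na 2 (3 * numVertices s) = 0) ∧
    (0 < numVertices s → (pushDiagram.sem s).nv 4 = 1 ∧ (pushDiagram.sem s).na 7 0 = 1 ∧
      (pushDiagram.sem s).na 8 0 = 3 * numVertices s) := by
  have e3 : s.nv 0 + (s.nv 0 + s.nv 0) = 3 * s.nv 0 := by ring
  rcases Nat.eq_zero_or_pos (s.nv 0) with h0 | h0
  · have e : pushDiagram.sem s = ⟨Function.update s.nv 4 0, s.rv,
        Function.update s.na 2 (Function.update (s.na 2) (3 * s.nv 0) 0), s.ra⟩ := by
      simp [pushDiagram, rootCell, Cmd.sem, NExp.eval, BExp.eval, h0]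
    rw [e]
    refine ⟨⟨fun j hj => ?_, fun a ha => ?_, rfl⟩, fun _ => ⟨rfl, ?_⟩, fun h => ?_⟩
    · simp only [List.mem_cons, not_or] at hj
      simp [hj]
    · simp only [List.mem_cons, not_or] at ha
      simp [ha]
    · simp [numVertices]
    · exact absurd h0 h.ne'
  · have e : pushDiagram.sem s = ⟨Function.update (Function.update s.nv 4 0) 4 1, s.rv,
        Function.update (Function.update (Function.update s.na 2 (Function.update (s.na 2)
          (3 * s.nv 0) 0)) 7 (Function.update (s.na 7) 0 1)) 8
            (Function.update (s.na 8) 0 (3 * s.nv 0)), s.ra⟩ := by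
      simp [pushDiagram, rootCell, Cmd.sem, NExp.eval, BExp.eval, h0, e3]
    rw [e]
    refine ⟨⟨fun j hj => ?_, fun a ha => ?_, rfl⟩, fun h => ?_, fun _ => ⟨rfl, ?_, ?_⟩⟩
    · simp only [List.mem_cons, not_or] at hj
      simp [hj]
    · simp only [List.mem_cons, not_or] at ha
      simp [ha]
    · exact absurd h h0.ne'
    · simp
    · simp [numVertices]

theorem ptrs_Icc (h : StoresFVD P s) : ptrs s (Finset.Icc 1 (numVertices s)) = vertices P := by
  rw [← h.1.vertex_range]
  ext x
  constructor
  · rintro ⟨v, hv, rfl⟩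
    have := Finset.mem_Icc.1 (Finset.mem_coe.1 hv)
    exact ⟨v - 1, show v - 1 < _ by omega, rfl⟩
  · rintro ⟨i, hi, rfl⟩
    have : i < numVertices s := hi
    exact ⟨i + 1, Finset.mem_coe.2 (Finset.mem_Icc.2 ⟨by omega, by omega⟩), rfl⟩

theorem part_Icc (hP : NoFourCocircular P) (h : StoresFVD P s) :
    Part P s (Finset.Icc 1 (numVertices s)) where
  pos v hv := (Finset.mem_Icc.1 hv).1
  le v hv := (Finset.mem_Icc.1 hv).2
  conn := by rw [ptrs_Icc h]; exact conn_vertices hP h.1.finite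

theorem build_exec (hP : NoFourCocircular P) (h₀ : StoresFVD P s₀) :
    Exec build s₀ (buildCost * ((vertices P).ncard * Nat.size (vertices P).ncard +
      (vertices P).ncard + 1)) fun s' => ∃ t, StoresSD P t s' := by
  rw [h₀.1.ncard]
  set n := numVertices s₀ with hn
  have hcard : (Finset.Icc 1 n).card = n := by simp
  refine (Exec.seq (clearFlags_exec s₀) fun s₁ h₁ => Exec.seq (Exec.of_loopFree (Q := fun s₂ =>
      Frame [4, 6] [2, 3, 7, 8] s₀ s₂ ∧ s₂.na 3 0 ≠ 0 ∧ (∀ v, 0 < v → v ≤ n → s₂.na 3 v = 0) ∧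
      (n = 0 → s₂.nv 4 = 0 ∧ s₂.na 2 (3 * n) = 0) ∧
      (0 < n → s₂.nv 4 = 1 ∧ s₂.na 7 0 = 1 ∧ s₂.na 8 0 = 3 * n))
      (by simp [pushDiagram, Cmd.LoopFree]) ?_) fun s₂ h₂ =>
    Exec.seq (B₁ := levelCost * n * Nat.size n + (pending.cost + 1))
      (Q₁ := fun s' => SameFeatures s₀ s' ∧ ∃ t, IsSepDecomp P t (vertices P) ∧
        ∀ s'', SameFeatures s₀ s'' → s''.na 2 = s'.na 2 → StoresTree s'' t (s'.na 2 (3 * n)))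
      ?_ fun s₃ h₃ => Exec.of_loopFree (c := .nset 2 (.get 2 rootCell)) trivial ?_).mono ?_
    fun _ h => h
  · obtain ⟨hF, hz, hv⟩ := h₁
    obtain ⟨hF', he, hp⟩ := pushDiagram_sem s₁
    have e0 : numVertices s₁ = n := hF.nv 0 (by decide)
    rw [e0] at he hp
    rw [hF'.na 3 (by decide)]
    exact ⟨(hF.mono (by decide) (by decide)).trans (hF'.mono (by decide) (by decide)), hz, hv,
      he, hp⟩
  · obtain ⟨hF, hz, hv, he, hp⟩ := h₂
    have hsf := hF.sameFeatures (by decide) (by decide) (by decide)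
    rcases Nat.eq_zero_or_pos n with h0 | h0
    · obtain ⟨h4, h2⟩ := he h0
      refine ((Rounds.refl (Q := fun s' => s' = s₂) rfl).exec fun s' hs' => ?_).mono (by omega)
        fun s' hs' => ?_
      · subst hs'
        simp [pending, BExp.eval, NExp.eval, h4]
      · subst hs'
        refine ⟨hsf, .nil, ?_, fun s'' _ _ => h2⟩
        change vertices P = ∅
        rw [← ptrs_Icc h₀, ← hn, h0]
        simp [ptrs]
    · obtain ⟨h4, h7, h8⟩ := hp h0
      have hR : Ready P s₀ (Finset.Icc 1 n) 0 s₂ := by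
        refine ⟨⟨hsf, hF.na 1 (by decide), hz⟩, part_Icc hP h₀, fun v hv' => ?_,
          fun v hv' l => ?_, h4, ?_, fun v hv' k => ?_⟩
        · obtain ⟨ha, hb⟩ := Finset.mem_Icc.1 hv'
          exact hv v ha hb
        · obtain ⟨ha, hb⟩ := Finset.mem_Icc.1 hv'
          rcases Nat.eq_zero_or_pos (ptrNbr s₀ v l) with hy | hy
          · right; rw [hy]; exact hz
          · exact .inl (Finset.mem_Icc.2 ⟨hy, (h₀.isForest hP).le v l ha hb⟩)
        · rw [h7]; exact Finset.mem_Icc.2 ⟨le_rfl, h0⟩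
        · obtain ⟨ha, hb⟩ := Finset.mem_Icc.1 hv'
          have := k.2
          rw [h8]; unfold slot; omega
      have hT := rounds_finished hP h₀ hR
      rw [hcard] at hT
      refine (hT.exec fun s' hs' => ?_).mono le_rfl fun s' hs' => ?_
      · simp [pending, BExp.eval, NExp.eval, hs'.height]
      · obtain ⟨t, ht, hst⟩ := hs'.built
        rw [ptrs_Icc h₀] at ht
        rw [h8] at hst
        exact ⟨hs'.steady.feat, t, ht, fun s'' hf e => hst s'' hf fun v _ k => by rw [e]⟩
  · obtain ⟨hsf, t, ht, hst⟩ := h₃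
    have e : (Cmd.nset 2 (.get 2 rootCell)).sem s₃ =
        { s₃ with nv := Function.update s₃.nv 2 (s₃.na 2 (3 * n)) } := by
      have : s₃.nv 0 + (s₃.nv 0 + s₃.nv 0) = 3 * n := by
        have := hsf.nv0
        rw [hn, numVertices]; omega
      simp [Cmd.sem, NExp.eval, rootCell, this]
    rw [e]
    have hsf' : SameFeatures s₀ { s₃ with nv := Function.update s₃.nv 2 (s₃.na 2 (3 * n)) } :=
      ⟨hsf.nv0, hsf.nv1, hsf.na0, hsf.ra⟩
    exact ⟨t, hsf'.stores h₀.1, ht, hst _ hsf' rfl⟩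
  · have e1 : (Cmd.nset 2 (.get 2 rootCell)).bound ≤ 10 := by decide
    have e2 : pending.cost + 1 ≤ 10 := by decide
    have e3 : levelCost * n * Nat.size n = levelCost * (n * Nat.size n) := Nat.mul_assoc _ _ _
    rw [e3]
    unfold buildCost
    nlinarith [Nat.zero_le (n * Nat.size n), Nat.zero_le (levelCost * n),
      Nat.zero_le (pushDiagram.bound * n),
      Nat.zero_le (pushDiagram.bound * (n * Nat.size n))]

end

/-! ### From bit lengths to logarithms -/

theorem size_le_log (n : ℕ) : (Nat.size n : ℝ) ≤ 2 * Real.log n + 1 := by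
  rcases Nat.eq_zero_or_pos n with rfl | hn
  · simp
  have hpow : 2 ^ (Nat.size n - 1) ≤ n := Nat.lt_size.1 (by have := Nat.size_pos.2 hn; omega)
  have hlog : ((Nat.size n - 1 : ℕ) : ℝ) * Real.log 2 ≤ Real.log n := by
    rw [← Real.log_pow]
    exact Real.log_le_log (by positivity) (by exact_mod_cast hpow)
  have h2 := Real.log_two_gt_d9
  have hs : (Nat.size n : ℝ) ≤ (Nat.size n - 1 : ℕ) + 1 := by
    exact_mod_cast (show Nat.size n ≤ Nat.size n - 1 + 1 by omega)
  nlinarith [Nat.cast_nonneg (α := ℝ) (Nat.size n - 1)]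

theorem le_mul_log (n : ℕ) : (n : ℝ) ≤ 2 * (n * Real.log n) + 1 := by
  have h2 := Real.log_two_gt_d9
  rcases Nat.lt_or_ge n 2 with hn | hn
  · interval_cases n <;> simp
  · have : Real.log 2 ≤ Real.log n := Real.log_le_log (by norm_num) (by exact_mod_cast hn)
    nlinarith [Nat.cast_nonneg (α := ℝ) n]

theorem query_cost_le {T a b k n : ℕ} (h : T ≤ a + b * (Nat.size n + 1)) (hk : a + b ≤ k) :
    (T : ℝ) ≤ (8 * k : ℕ) * (Real.log n + 1) := by
  have hT : T ≤ k * (Nat.size n + 1) := h.trans (by nlinarith [Nat.zero_le (a * Nat.size n)])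
  have hT' : (T : ℝ) ≤ k * (Nat.size n + 1) := by exact_mod_cast hT
  refine hT'.trans ?_
  have := size_le_log n
  have := Real.log_natCast_nonneg n
  push_cast
  rw [mul_comm (8 : ℝ), mul_assoc]
  gcongr
  linarith

theorem build_cost_le {T b k n : ℕ} (h : T ≤ b * (n * Nat.size n + n + 1)) (hk : b ≤ k) :
    (T : ℝ) ≤ (8 * k : ℕ) * (n * Real.log n + 1) := by
  have hT' : (T : ℝ) ≤ k * (n * Nat.size n + n + 1) := by
    exact_mod_cast h.trans (Nat.mul_le_mul_right _ hk)
  refine hT'.trans ?_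
  have h1 := mul_le_mul_of_nonneg_left (size_le_log n) (Nat.cast_nonneg (α := ℝ) n)
  have h2 := le_mul_log n
  have h3 := mul_nonneg (Nat.cast_nonneg (α := ℝ) n) (Real.log_natCast_nonneg n)
  push_cast
  rw [mul_comm (8 : ℝ), mul_assoc]
  gcongr
  linarith

/-- A cost of the queries per level of the separator decomposition. -/
def queryCost (init step : Cmd) : ℕ :=
  init.bound + ((BExp.not (.neq (.var 4) (.lit 0))).cost + 1 + step.bound)

end FVD

theorem mainTheorem4 :
    ∃ (build locate segmentQuery : RealRAM.Cmd) (K : ℝ),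
      ∀ P : Finset FVD.Pt, P.Nonempty → FVD.NoFourCocircular P →
        -- construction
        (∀ s : RealRAM.State, FVD.StoresFVD P s →
          ∃ (T : ℕ) (s' : RealRAM.State), RealRAM.Run build s T s' ∧
            (T : ℝ) ≤ K * ((FVD.vertices P).ncard * Real.log (FVD.vertices P).ncard + 1) ∧
            ∃ t, FVD.StoresSD P t s') ∧
        -- point location
        (∀ (t : FVD.SepTree) (s : RealRAM.State) (q : FVD.Pt),
          FVD.StoresSD P t s → FVD.reg s 0 = q →
          ∃ (T : ℕ) (s' : RealRAM.State), RealRAM.Run locate s T s' ∧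
            (T : ℝ) ≤ K * (Real.log (FVD.vertices P).ncard + 1) ∧
            FVD.StoresSD P t s' ∧
            FVD.answer s' < FVD.numSites s' ∧
            q ∈ closure (FVD.freg P (FVD.site s' (FVD.answer s')))) ∧
        -- segment query
        (∀ (t : FVD.SepTree) (s : RealRAM.State) (C : Finset FVD.Pt) (u v c₁ c₂ : FVD.Pt),
          FVD.StoresSD P t s → FVD.SegmentInput P C u v c₁ c₂ →
          FVD.reg s 0 = u → FVD.reg s 1 = v → FVD.reg s 2 = c₁ → FVD.reg s 3 = c₂ →
          ∃ (T : ℕ) (s' : RealRAM.State), RealRAM.Run segmentQuery s T s' ∧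
            (T : ℝ) ≤ K * (Real.log (FVD.vertices P).ncard + 1) ∧
            FVD.StoresSD P t s' ∧
            ∃ x ∈ segment ℝ u v, FVD.reg s' 4 = x ∧
              ∀ y ∈ segment ℝ u v, FVD.dF y C = FVD.dF y P ↔ y = x) := by
  set k := FVD.buildCost + FVD.queryCost FVD.locateInit FVD.locateStep +
    FVD.queryCost FVD.segmentInit FVD.segmentStep with hk
  refine ⟨FVD.build, FVD.locate, FVD.segmentQuery, (8 * k : ℕ), fun P hne hP => ⟨?_, ?_, ?_⟩⟩
  · intro s hs
    obtain ⟨T, s', hrun, hT, hQ⟩ := FVD.build_exec hP hs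
    exact ⟨T, s', hrun, FVD.build_cost_le hT (by omega), hQ⟩
  · rintro t s _ hs rfl
    obtain ⟨T, s', hrun, hT, hQ⟩ := FVD.locate_exec hP hne hs
    refine ⟨T, s', hrun, FVD.query_cost_le hT ?_, hQ⟩
    rw [hk, FVD.queryCost]
    omega
  · rintro t s C _ _ _ _ hs hin rfl rfl rfl rfl
    obtain ⟨x, e, hx, hT, hu, huniq⟩ := hin.exists_target hne
    obtain ⟨T, s', hrun, hT, hs', hx'⟩ := FVD.segmentQuery_exec hP hs hT hu
    refine ⟨T, s', hrun, FVD.query_cost_le hT ?_, hs', x, hx, hx', huniq⟩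
    rw [hk, FVD.queryCost, FVD.queryCost]
    omega
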